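/- Let $H$ be a real separable Hilbert space, let $A_i:D(A_i)\subset H\to H$, $i=1,\dots,n$, be self-adjoint and strictly positive (possibly unbounded) operators, i.e. $\langle A_iu,u\rangle\ge\Lambda_i\|u\|^2$ on $D(A_i)$ for some $\Lambda_i>0$, and put $D=\bigcap_i D(A_i)$. Assume that the $A_i$ commute on $D$, i.e. $\langle A_ix,A_jy\rangle=\langle A_jx,A_iy\rangle$ for all $x,y\in D$ and all $i,j$. For $\boldsymbol\lambda\in\mathbb R_+^n=(0,\infty)^n$ let $A(\boldsymbol\lambda)=\lambda_1A_1+\cdots+\lambda_nA_n$ with domain $D$, and assume that $A(\boldsymbol\lambda)$ is self-adjoint for at least one $\boldsymbol\lambda\in\mathbb R_+^n$. Then $A(\boldsymbol\lambda)$ is self-adjoint and $-A(\boldsymbol\lambda)$ generates a strongly continuous semigroup $\{e^{-tA(\boldsymbol\lambda)}\}_{t\ge0}$ for every $\boldsymbol\lambda\in\mathbb R_+^n$. Let $0<\alpha<1$, $\bar T>0$, $u_0\in H\setminus\{0\}$, let $$\Phi_\alpha(z)=\sum_{k=0}^\infty\frac{(-z)^k}{k!\,\Gamma(-\alpha k+1-\alpha)}$$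 be the Wright type function, and define $\mathcal F_\alpha=(\mathcal F_{\alpha,1},\dots,\mathcal F_{\alpha,n})$ on $\mathbb R_+^n$ by $$\mathcal F_{\alpha,i}(\boldsymbol\lambda)=\int_0^\infty\!\!\int_0^\infty\Phi_\alpha(\tau)\Phi_\alpha(\sigma)\left\langle A_ie^{-\frac{\tau+\sigma}2\bar T^\alpha A(\boldsymbol\lambda)}u_0,\;e^{-\frac{\tau+\sigma}2\bar T^\alpha A(\boldsymbol\lambda)}u_0\right\rangle d\tau\,d\sigma .$$ Then $e^{-sA(\boldsymbol\lambda)}u_0\in D$ for all $s>0$ and $\boldsymbol\lambda\in\mathbb R_+^n$, the double integrals above and below converge absolutely, and: (a) $\mathcal F_\alpha\in C^1(\mathbb R_+^n;\mathbb R_+^n)$, and its Jacobi matrix $\mathcal F_\alpha'(\boldsymbol\lambda)=(\partial\mathcal F_{\alpha,i}/\partial\lambda_j)_{i,j=1,\dots,n}$ is $$-\bar T^\alpha\left(\int_0^\infty\!\!\int_0^\infty(\tau+\sigma)\Phi_\alpha(\tau)\Phi_\alpha(\sigma)\left\langle A_ie^{-\frac{\tau+\sigma}2\bar T^\alpha A(\boldsymbol\lambda)}u_0,\;A_je^{-\frac{\tau+\sigma}2\bar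 T^\alpha A(\boldsymbol\lambda)}u_0\right\rangle d\tau\,d\sigma\right)_{i,j=1,\dots,n}$$ for every $\boldsymbol\lambda\in\mathbb R_+^n$; (b) if $u_0$ is admissible, i.e. $u_0\in D$ and $A_1u_0,\dots,A_nu_0$ are linearly independent in $H$, then $\mathcal F_\alpha'(\boldsymbol\lambda)$ is negative definite for every $\boldsymbol\lambda\in\mathbb R_+^n$. -/

import Mathlib

open Set Filter Topology MeasureTheory

noncomputable section

namespace FracInverse

/-- The Wright type function `Φ_α(z) = ∑ (-z)^k / (k! Γ(-α k + 1 - α))`, on real arguments. The series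
is absolutely convergent for `0 < α < 1`; at the poles of `Γ` the reciprocal `1 / Γ` is `0`, in Lean as
in the usual convention. -/
def wright (α z : ℝ) : ℝ :=
  ∑' k : ℕ, (-z) ^ k / ((k.factorial : ℝ) * Real.Gamma (-α * k + 1 - α))

variable {H : Type*} [NormedAddCommGroup H] [InnerProductSpace ℝ H]

/-- `⟨A u, u⟩ ≥ Λ ‖u‖²` on `D(A)` for some coercivity constant `Λ > 0`. -/
def IsStrictlyPositive (A : H →ₗ.[ℝ] H) : Prop :=
  ∃ Λ : ℝ, 0 < Λ ∧ ∀ u : A.domain, Λ * ‖(u : H)‖ ^ 2 ≤ inner ℝ (A u) (u : H)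

/-- `S`, restricted to `[0, ∞)`, is a strongly continuous semigroup of bounded operators whose
infinitesimal generator (with its exact domain) is `B`. -/
structure IsSemigroupGeneratedBy (S : ℝ → H →L[ℝ] H) (B : H →ₗ.[ℝ] H) : Prop where
  map_zero : S 0 = ContinuousLinearMap.id ℝ H
  map_add : ∀ s t : ℝ, 0 ≤ s → 0 ≤ t → S (s + t) = (S s).comp (S t)
  continuousOn : ∀ x : H, ContinuousOn (fun t : ℝ => S t x) (Ici 0)
  generator : ∀ x y : H, (x, y) ∈ B.graph ↔
    Tendsto (fun h : ℝ => h⁻¹ • (S h x - x)) (𝓝[>] 0) (𝓝 y)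

open Classical in
/-- `e^{-tA}`, for `t ≥ 0`: the semigroup generated by `-A` (unique when it exists; the value is `0`
when `-A` is not a generator). -/
def expNeg (A : H →ₗ.[ℝ] H) (t : ℝ) : H →L[ℝ] H :=
  if h : ∃ S : ℝ → H →L[ℝ] H, IsSemigroupGeneratedBy S (-A) then h.choose t else 0

open Classical in
/-- The vector `A x` for `x ∈ D(A)` (and `0` for other `x`). -/
def appl (A : H →ₗ.[ℝ] H) (x : H) : H :=
  if h : x ∈ A.domain then A ⟨x, h⟩ else 0

variable {n : ℕ}

/-- The common domain `D = ⋂ᵢ D(A_i)`. -/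
def commonDomain (A : Fin n → H →ₗ.[ℝ] H) : Submodule ℝ H := ⨅ i, (A i).domain

theorem commonDomain_le (A : Fin n → H →ₗ.[ℝ] H) (i : Fin n) :
    commonDomain A ≤ (A i).domain := iInf_le _ i

/-- `A(λ) = λ₁ A₁ + ⋯ + λₙ Aₙ` with domain `D`. -/
def opSum (A : Fin n → H →ₗ.[ℝ] H) (lam : Fin n → ℝ) : H →ₗ.[ℝ] H where
  domain := commonDomain A
  toFun := ∑ i, lam i • (A i).toFun.comp (Submodule.inclusion (commonDomain_le A i))

/-- The operators commute on `D`: `⟨A_i x, A_j y⟩ = ⟨A_j x, A_i y⟩` for all `x, y ∈ D`. -/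
def MutuallyCommuting (A : Fin n → H →ₗ.[ℝ] H) : Prop :=
  ∀ i j : Fin n, ∀ x y : H, ∀ (hx : x ∈ commonDomain A) (hy : y ∈ commonDomain A),
    inner ℝ (A i ⟨x, commonDomain_le A i hx⟩) (A j ⟨y, commonDomain_le A j hy⟩) =
      inner ℝ (A j ⟨x, commonDomain_le A j hx⟩) (A i ⟨y, commonDomain_le A i hy⟩)

/-- `u₀` is admissible: `u₀ ∈ D` and `A₁ u₀, …, Aₙ u₀` are linearly independent. -/
def IsAdmissible (A : Fin n → H →ₗ.[ℝ] H) (u₀ : H) : Prop :=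
  ∃ h : u₀ ∈ commonDomain A, LinearIndependent ℝ fun i => A i ⟨u₀, commonDomain_le A i h⟩

/-- The open orthant `ℝ₊ⁿ = (0, ∞)ⁿ`. -/
def posOrthant (n : ℕ) : Set (Fin n → ℝ) := {lam | ∀ i, 0 < lam i}

/-- `e^{-((τ+σ)/2) T^α A(λ)} u₀`. -/
def evolved (A : Fin n → H →ₗ.[ℝ] H) (u₀ : H) (T α : ℝ) (lam : Fin n → ℝ) (τ σ : ℝ) : H :=
  expNeg (opSum A lam) ((τ + σ) / 2 * T ^ α) u₀

/-- The integrand of the `i`-th component of `F_α`. -/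
def energyIntegrand (A : Fin n → H →ₗ.[ℝ] H) (u₀ : H) (T α : ℝ) (lam : Fin n → ℝ) (i : Fin n)
    (τ σ : ℝ) : ℝ :=
  wright α τ * wright α σ *
    inner ℝ (appl (A i) (evolved A u₀ T α lam τ σ)) (evolved A u₀ T α lam τ σ)

/-- The map `F_α`. -/
def energyMap (A : Fin n → H →ₗ.[ℝ] H) (u₀ : H) (T α : ℝ) (lam : Fin n → ℝ) : Fin n → ℝ :=
  fun i => ∫ τ in Ioi (0 : ℝ), ∫ σ in Ioi (0 : ℝ), energyIntegrand A u₀ T α lam i τ σ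

/-- The Gram matrix of `A₁ v, …, Aₙ v`, `v = e^{-((τ+σ)/2) T^α A(λ)} u₀`, weighted by
`(τ + σ) Φ_α(τ) Φ_α(σ)`. -/
def gramIntegrand (A : Fin n → H →ₗ.[ℝ] H) (u₀ : H) (T α : ℝ) (lam : Fin n → ℝ) (i j : Fin n)
    (τ σ : ℝ) : ℝ :=
  (τ + σ) * wright α τ * wright α σ *
    inner ℝ (appl (A i) (evolved A u₀ T α lam τ σ)) (appl (A j) (evolved A u₀ T α lam τ σ))

/-- The integrated, weighted Gram matrix. -/
def gramMatrix (A : Fin n → H →ₗ.[ℝ] H) (u₀ : H) (T α : ℝ) (lam : Fin n → ℝ) :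
    Matrix (Fin n) (Fin n) ℝ :=
  Matrix.of fun i j =>
    ∫ τ in Ioi (0 : ℝ), ∫ σ in Ioi (0 : ℝ), gramIntegrand A u₀ T α lam i j τ σ

/-- The Jacobi matrix `(∂F_i/∂λ_j)` of a map `F : ℝⁿ → ℝⁿ` at a point. -/
def jacobiMatrix (F : (Fin n → ℝ) → Fin n → ℝ) (lam : Fin n → ℝ) : Matrix (Fin n) (Fin n) ℝ :=
  Matrix.of fun i j => fderiv ℝ F lam (Pi.single j 1) i

end FracInverse

end

/-! No spectral theorem is used: the unbounded problem is reduced to commuting bounded operators.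
Fix `l` with A(l) self-adjoint and n > 0. Then K = A(l)⁻¹ and T_i = A_i A(l)⁻¹ are bounded,
self-adjoint and commute (`exists_boundedModel`), D is the range of K, and A(x) = P_x K⁻¹ with P_x =
Σ x_i T_i. Since T_i ≥ 0 and Σ l_i T_i = 1, P_x is invertible for every x in the orthant, which
carries self-adjointness from A(l) over to A(x). The operators A(l)^k e^{-A(x)} are norm limits, as
ε → 0, of B^k exp(-P_x B) with B = (K + ε)⁻¹. One estimate, ‖A(l)^k e^{-A(x)}‖ ≤ k!/c^k when x ≥ c
l, yields the convergence, the smoothing e^{-sA(x)}u₀ ∈ D, and differentiability in x, with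
derivative -P_z A(l) e^{-A(x)} in the direction z (`hasFDerivAt_limExp`).

By self-adjointness the integrand of F_i is Φ_α(τ)Φ_α(σ)⟨A_i e^{-rA(x)}u₀, u₀⟩ with r = (τ+σ)T^α.
The inner product is O(1/r), and so is its x_j-derivative -r⟨A_i A_j e^{-rA(x)}u₀, u₀⟩. As 1/(τ+σ) ≤
(τσ)^{-1/2}, a product of two copies of τ^{-1/2}Φ_α(τ) dominates everything, and differentiation
under the integral is allowed for any u₀ in H.

The analysis of Φ_α starts from a ray integral, which gives the Mellin transform Γ(q)/Γ(1-α(1-q))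
(`mellin_wright`). With y = τ^{-1/α}, Mellin inversion then identifies ∫ Φ_α(τ) y e^{-sy} dτ with α
s^{α-1} e^{-s^α}, which is completely monotone, and a Post–Widder concentration argument gives Φ_α ≥
0 (`wright_nonneg`).

For (b), the quadratic form of the Gram matrix is a nonnegatively weighted integral of
‖e^{-(r/2)A(x)} Σ z_i A_i u₀‖². Near τ = σ = 0 it is strictly positive, because Φ_α(0) = 1/Γ(1-α) >
0 and the semigroup is strongly continuous. Positivity of F_i has the same proof. -/

noncomputable section

namespace FracInverse

/-! ### Exponentials of commuting families in a Banach algebra. -/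

section BanachAlgebra

variable {𝔸 : Type*} [NormedRing 𝔸] [NormedAlgebra ℝ 𝔸] [CompleteSpace 𝔸]

/-- Commutation gives e^{C(s)} = e^{C(t)} e^{C(s)-C(t)}, so only the derivative of the exponential
at 0 is needed. -/
theorem hasDerivAt_exp_of_commute {C : ℝ → 𝔸} {C' : 𝔸} {t : ℝ} (hC : HasDerivAt C C' t)
    (hcomm : ∀ s, Commute (C t) (C s)) :
    HasDerivAt (fun s => NormedSpace.exp (C s)) (NormedSpace.exp (C t) * C') t := by
  let _ : NormedAlgebra ℚ 𝔸 := NormedAlgebra.restrictScalars ℚ ℝ 𝔸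
  have h1 : HasDerivAt (fun s => C s - C t) C' t := hC.sub_const _
  have h2 : HasDerivAt (fun s => NormedSpace.exp (C s - C t)) C' t := by
    have h3 : HasFDerivAt (NormedSpace.exp : 𝔸 → 𝔸) (1 : 𝔸 →L[ℝ] 𝔸) (C t - C t) := by
      rw [sub_self]; exact hasFDerivAt_exp_zero
    exact h3.comp_hasDerivAt t h1
  refine (h2.const_mul (NormedSpace.exp (C t))).congr_of_eventuallyEq (Eventually.of_forall ?_)
  intro s
  have hc : Commute (C t) (C s - C t) := (hcomm s).sub_right (Commute.refl _)
  simp only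
  rw [← NormedSpace.exp_add_of_commute hc]
  congr 1
  abel

theorem commute_ringInverse {M : Type*} [Ring M] {a u : M} (h : Commute a u) (hu : IsUnit u) :
    Commute a (Ring.inverse u) := by
  obtain ⟨u, rfl⟩ := hu
  rw [Ring.inverse_unit]
  exact h.units_inv_right

end BanachAlgebra

/-! ### Bounded positive operators on a real Hilbert space. -/

section Operators

variable {H : Type*} [NormedAddCommGroup H] [InnerProductSpace ℝ H]

theorem clm_mul_apply (S T : H →L[ℝ] H) (x : H) : (S * T) x = S (T x) := rfl

variable [CompleteSpace H]

theorem sa_inner {T : H →L[ℝ] H} (hT : IsSelfAdjoint T) (x y : H) :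
    inner ℝ (T x) y = inner ℝ x (T y) := hT.isSymmetric x y

theorem isSelfAdjoint_of_inner {T : H →L[ℝ] H} (h : ∀ x y, inner ℝ (T x) y = inner ℝ x (T y)) :
    IsSelfAdjoint T := ContinuousLinearMap.isSelfAdjoint_iff_isSymmetric.2 h

theorem isUnit_of_coercive {T : H →L[ℝ] H} {c : ℝ} (hc : 0 < c)
    (h : ∀ x, c * ‖x‖ ^ 2 ≤ inner ℝ (T x) x) : IsUnit T := by
  refine ContinuousLinearMap.isUnit_of_forall_le_norm_inner_map T (c := ⟨c, hc.le⟩) hc fun x => ?_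
  rw [mul_comm]
  exact (h x).trans (le_abs_self _)

theorem denseRange_of_injective {K : H →L[ℝ] H} (hK : IsSelfAdjoint K)
    (hinj : Function.Injective K) : DenseRange K := by
  have h : K.range.topologicalClosure = ⊤ := by
    rw [Submodule.topologicalClosure_eq_top_iff, Submodule.eq_bot_iff]
    intro z hz
    apply hinj
    rw [map_zero, ← inner_self_eq_zero (𝕜 := ℝ), ← sa_inner hK]
    have := hz (K (K z)) ⟨K z, rfl⟩
    rwa [sa_inner hK, sa_inner hK] at this ⊢
  have h2 := (Submodule.dense_iff_topologicalClosure_eq_top (s := K.range)).2 h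
  exact h2

theorem isPositive_pow {C : H →L[ℝ] H} (hC : C.IsPositive) (k : ℕ) : (C ^ k).IsPositive := by
  have hsa : ∀ m, IsSelfAdjoint (C ^ m) := fun m => hC.isSelfAdjoint.pow m
  rw [ContinuousLinearMap.isPositive_iff']
  refine ⟨hsa k, fun x => ?_⟩
  obtain ⟨m, rfl | rfl⟩ := Nat.even_or_odd' k
  · rw [two_mul, pow_add, clm_mul_apply, sa_inner (hsa m)]
    exact real_inner_self_nonneg
  · have : C ^ (2 * m + 1) = C ^ m * (C * C ^ m) := by
      rw [← pow_succ', ← pow_add]; congr 1; omega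
    rw [this, clm_mul_apply, sa_inner (hsa m), clm_mul_apply]
    exact hC.inner_nonneg_left _

/-- In the series of ⟨e^C w, C^k w⟩ every term is nonnegative, so the term j = k alone, ‖C^k w‖²/k!,
is a lower bound. This replaces the spectral bound x^k ≤ k! e^x. -/
theorem norm_pow_apply_le_exp {C : H →L[ℝ] H} (hC : C.IsPositive) (k : ℕ) (w : H) :
    ‖(C ^ k) w‖ ≤ k.factorial * ‖NormedSpace.exp C w‖ := by
  have hsum : HasSum (fun j : ℕ => (j.factorial : ℝ)⁻¹ * inner ℝ ((C ^ j) w) ((C ^ k) w))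
      (inner ℝ (NormedSpace.exp C w) ((C ^ k) w)) := by
    have h1 := NormedSpace.exp_series_hasSum_exp' (𝕂 := ℝ) C
    have h2 := h1.mapL ((innerSL ℝ ((C ^ k) w)).comp (ContinuousLinearMap.apply ℝ H w))
    simpa [inner_smul_right, real_inner_comm] using h2
  have hnn : ∀ j : ℕ, 0 ≤ (j.factorial : ℝ)⁻¹ * inner ℝ ((C ^ j) w) ((C ^ k) w) := by
    intro j
    refine mul_nonneg (by positivity) ?_
    rw [sa_inner (hC.isSelfAdjoint.pow j), ← clm_mul_apply, ← pow_add]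
    exact (isPositive_pow hC _).inner_nonneg_right _
  have h3 : (k.factorial : ℝ)⁻¹ * inner ℝ ((C ^ k) w) ((C ^ k) w) ≤
      inner ℝ (NormedSpace.exp C w) ((C ^ k) w) := le_hasSum hsum k fun j _ => hnn j
  have h4 := h3.trans (real_inner_le_norm _ _)
  rw [real_inner_self_eq_norm_sq, inv_mul_le_iff₀ (by positivity)] at h4
  by_cases h0 : ‖(C ^ k) w‖ = 0
  · rw [h0]; positivity
  · have h5 : 0 < ‖(C ^ k) w‖ := lt_of_le_of_ne (norm_nonneg _) (Ne.symm h0)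
    nlinarith

theorem norm_pow_mul_exp_neg_le {C : H →L[ℝ] H} (hC : C.IsPositive) (k : ℕ) :
    ‖C ^ k * NormedSpace.exp (-C)‖ ≤ k.factorial := by
  let _ : NormedAlgebra ℚ (H →L[ℝ] H) := NormedAlgebra.restrictScalars ℚ ℝ _
  refine ContinuousLinearMap.opNorm_le_bound _ (by positivity) fun u => ?_
  refine (norm_pow_apply_le_exp hC k (NormedSpace.exp (-C) u)).trans_eq ?_
  rw [← clm_mul_apply, ← NormedSpace.exp_add_of_commute (Commute.neg_right (Commute.refl C))]
  simp

theorem norm_exp_neg_le_one {C : H →L[ℝ] H} (hC : C.IsPositive) :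
    ‖NormedSpace.exp (-C)‖ ≤ 1 := by
  simpa using norm_pow_mul_exp_neg_le hC 0

/-- If `K ≥ 0` is injective, commutes with the self-adjoint `T`, and `K T ≥ 0`, then `T ≥ 0`. -/
theorem isPositive_of_mul_nonneg {K T : H →L[ℝ] H} (hK : K.IsPositive)
    (hinj : Function.Injective K) (hT : IsSelfAdjoint T) (hKT : Commute K T)
    (h : ∀ f, 0 ≤ inner ℝ (T f) (K f)) : T.IsPositive := by
  rw [ContinuousLinearMap.isPositive_iff']
  refine ⟨hT, ?_⟩
  have hclosed : IsClosed {x : H | 0 ≤ inner ℝ (T x) x} :=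
    isClosed_le continuous_const (by fun_prop)
  have hd := denseRange_of_injective hK.isSelfAdjoint hinj
  refine fun x => hd.induction_on (p := fun x => 0 ≤ inner ℝ (T x) x) x hclosed fun g => ?_
  -- Follow ⟨T v, v⟩ along the flow v = e^{-tK}Kg: its derivative -2⟨T v, K v⟩ is nonpositive, and
  -- it tends to 0 because ‖e^{-tK}K‖ ≤ 1/t. Hence its initial value ⟨T K g, K g⟩ is nonnegative,
  -- and the range of K is dense.
  set e : ℝ → H →L[ℝ] H := fun t => NormedSpace.exp (t • (-K))
  set φ : ℝ → ℝ := fun t => inner ℝ (T (e t (K g))) (e t (K g))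
  have he : ∀ t, HasDerivAt e (-K * e t) t := fun t => hasDerivAt_exp_smul_const' (-K) t
  have hev : ∀ t, HasDerivAt (fun t => e t (K g)) (-(K (e t (K g)))) t := fun t => by
    simpa using (he t).clm_apply (hasDerivAt_const t (K g))
  have hφ : ∀ t, HasDerivAt φ (-2 * inner ℝ (T (e t (K g))) (K (e t (K g)))) t := fun t => by
    have h1 := ((T.hasFDerivAt.comp_hasDerivAt t (hev t))).inner ℝ (hev t)
    refine h1.congr_deriv ?_
    have : inner ℝ (T (K (e t (K g)))) (e t (K g)) = inner ℝ (T (e t (K g))) (K (e t (K g))) := by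
      rw [← clm_mul_apply, ← hKT.eq, clm_mul_apply,
        sa_inner hK.isSelfAdjoint]
    rw [map_neg, inner_neg_left, inner_neg_right, this, Function.comp_apply]
    ring
  have hanti : Antitone φ := antitone_of_hasDerivAt_nonpos hφ fun t => by
    have := h (e t (K g))
    simp only [Pi.zero_apply]
    linarith
  have hbound : ∀ t, 0 < t → ‖e t (K g)‖ ≤ t⁻¹ * ‖g‖ := fun t ht => by
    have h1 := norm_pow_mul_exp_neg_le (hK.smul_of_nonneg (c := t) (by exact ht.le)) 1
    have hc : Commute K (e t) := ((Commute.refl K).neg_right.smul_right t).exp_right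
    have h2 : e t (K g) = t⁻¹ • (((t • K) ^ 1 * NormedSpace.exp (-(t • K))) g) := by
      rw [pow_one, ← smul_neg, ← clm_mul_apply, ← hc.eq]
      simp [e, smul_smul, ht.ne']
    rw [h2, norm_smul, Real.norm_of_nonneg (inv_nonneg.2 ht.le)]
    gcongr
    refine (ContinuousLinearMap.le_opNorm _ _).trans ?_
    simpa using mul_le_mul_of_nonneg_right h1 (norm_nonneg g)
  have h0 : φ 0 = inner ℝ (T (K g)) (K g) := by simp [φ, e]
  have hlim : Tendsto φ atTop (𝓝 0) := by
    have hz : Tendsto (fun t => e t (K g)) atTop (𝓝 0) := by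
      refine squeeze_zero_norm' ((eventually_gt_atTop 0).mono hbound) ?_
      simpa using tendsto_inv_atTop_zero.mul_const ‖g‖
    have : Tendsto (fun t => inner ℝ (T (e t (K g))) (e t (K g))) atTop
        (𝓝 (inner ℝ (T (0 : H)) (0 : H))) :=
      ((T.continuous.tendsto 0).comp hz).inner hz
    simpa [φ] using this
  rw [← h0]
  exact hanti.le_of_tendsto hlim 0

end Operators

/-- This c is the coercivity constant of A(x) relative to A(l); every later estimate depends on x
only through it. Strictness keeps it valid near x. -/
theorem exists_coercivity {n : ℕ} (l : Fin n → ℝ) {x : Fin n → ℝ} (hx : x ∈ posOrthant n) :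
    ∃ c : ℝ, 0 < c ∧ ∀ i, c * l i < x i := by
  have h : ∀ i : Fin n, ∀ᶠ c in 𝓝[>] (0 : ℝ), c * l i < x i := fun i => by
    have : Tendsto (fun c : ℝ => c * l i) (𝓝[>] 0) (𝓝 0) := by
      simpa using ((continuous_mul_const (l i)).tendsto 0).mono_left nhdsWithin_le_nhds
    exact this.eventually (gt_mem_nhds (hx i))
  obtain ⟨c, hc, hc0⟩ := ((eventually_all.2 h).and self_mem_nhdsWithin).exists
  exact ⟨c, hc0, hc⟩

/-! ### The bounded model and the regularised operators B^k exp(-P_x B). -/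

section Model

variable {H : Type*} [NormedAddCommGroup H] [InnerProductSpace ℝ H] {n : ℕ}

/-- `P_x = x₁ T₁ + ⋯ + xₙ Tₙ`, linearly in `x`. -/
def symbol (T : Fin n → H →L[ℝ] H) : (Fin n → ℝ) →L[ℝ] (H →L[ℝ] H) :=
  ∑ i, (ContinuousLinearMap.proj i : (Fin n → ℝ) →L[ℝ] ℝ).smulRight (T i)

theorem symbol_apply (T : Fin n → H →L[ℝ] H) (x : Fin n → ℝ) :
    symbol T x = ∑ i, x i • T i := by
  simp [symbol]

theorem commute_symbol {T : Fin n → H →L[ℝ] H} {A : H →L[ℝ] H} (hA : ∀ i, Commute A (T i)) (x : Fin n → ℝ) :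
    Commute A (symbol T x) := by
  rw [symbol_apply]
  exact Commute.sum_right _ _ _ fun i _ => (hA i).smul_right _

variable [CompleteSpace H]

/-- Bounded commuting operators `K = A(l)⁻¹` and `T i = A_i A(l)⁻¹`. -/
structure IsBoundedModel (K : H →L[ℝ] H) (T : Fin n → H →L[ℝ] H) (l : Fin n → ℝ) : Prop where
  K_pos : K.IsPositive
  K_inj : Function.Injective K
  T_sa : ∀ i, IsSelfAdjoint (T i)
  T_comm : ∀ i j, Commute (T i) (T j)
  KT_comm : ∀ i, Commute K (T i)
  KT_nonneg : ∀ i f, 0 ≤ inner ℝ (T i f) (K f)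
  l_pos : ∀ i, 0 < l i
  sum_eq : symbol T l = 1

/-- The resolvent `(K + ε)⁻¹`. -/
def resolv (K : H →L[ℝ] H) (ε : ℝ) : H →L[ℝ] H := Ring.inverse (K + ε • 1)

/-- `B^k exp (-P_x B)` for the resolvent `B = (K + ε)⁻¹`. -/
def approxExp (K : H →L[ℝ] H) (T : Fin n → H →L[ℝ] H) (k : ℕ) (ε : ℝ) (x : Fin n → ℝ) :
    H →L[ℝ] H :=
  resolv K ε ^ k * NormedSpace.exp (-(symbol T x * resolv K ε))

/-- The limit of `approxExp` as `ε → 0`, that is `A(l)^k exp (-A(x))`. -/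
def limExp (K : H →L[ℝ] H) (T : Fin n → H →L[ℝ] H) (k : ℕ) (x : Fin n → ℝ) : H →L[ℝ] H :=
  limUnder (𝓝[>] (0 : ℝ)) fun ε => approxExp K T k ε x

theorem isUnit_add_smul {K : H →L[ℝ] H} (hK : K.IsPositive) {ε : ℝ} (hε : 0 < ε) :
    IsUnit (K + ε • 1) := by
  refine isUnit_of_coercive hε fun x => ?_
  have := hK.inner_nonneg_left x
  simpa [inner_add_left, inner_smul_left] using this

theorem add_smul_mul_resolv {K : H →L[ℝ] H} (hK : K.IsPositive) {ε : ℝ} (hε : 0 < ε) :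
    (K + ε • 1) * resolv K ε = 1 := Ring.mul_inverse_cancel _ (isUnit_add_smul hK hε)

theorem commute_resolv {K A : H →L[ℝ] H} (hK : K.IsPositive) {ε : ℝ} (hε : 0 < ε)
    (h : Commute A K) : Commute A (resolv K ε) :=
  commute_ringInverse (h.add_right ((Commute.one_right A).smul_right ε)) (isUnit_add_smul hK hε)

theorem commute_resolv_resolv {K : H →L[ℝ] H} (hK : K.IsPositive) {ε δ : ℝ} (hε : 0 < ε)
    (hδ : 0 < δ) : Commute (resolv K δ) (resolv K ε) :=
  commute_resolv hK hε (commute_resolv hK hδ (Commute.refl K)).symm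

theorem isSelfAdjoint_resolv {K : H →L[ℝ] H} (hK : K.IsPositive) {ε : ℝ} (hε : 0 < ε) :
    IsSelfAdjoint (resolv K ε) := by
  have hsa : IsSelfAdjoint (K + ε • (1 : H →L[ℝ] H)) :=
    hK.isSelfAdjoint.add ((IsSelfAdjoint.all ε).smul (IsSelfAdjoint.one _))
  have h1 := add_smul_mul_resolv hK hε
  refine isSelfAdjoint_of_inner fun x y => ?_
  have h2 : ∀ z, (K + ε • (1 : H →L[ℝ] H)) (resolv K ε z) = z := fun z => by
    rw [← clm_mul_apply, h1]; rfl
  conv_lhs => rw [← h2 y]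
  conv_rhs => rw [← h2 x]
  rw [sa_inner hsa]

theorem hasDerivAt_resolv {K : H →L[ℝ] H} (hK : K.IsPositive) {ε : ℝ} (hε : 0 < ε) :
    HasDerivAt (resolv K) (-(resolv K ε) ^ 2) ε := by
  obtain ⟨u, hu⟩ := isUnit_add_smul hK hε
  have h1 : HasDerivAt (fun ε : ℝ => K + ε • (1 : H →L[ℝ] H)) 1 ε := by
    simpa using ((hasDerivAt_id ε).smul_const (1 : H →L[ℝ] H)).const_add K
  have h2 := hasFDerivAt_ringInverse (𝕜 := ℝ) u
  rw [hu] at h2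
  have h3 := h2.comp_hasDerivAt ε h1
  refine h3.congr_deriv ?_
  have : resolv K ε = ↑u⁻¹ := by rw [resolv, ← hu, Ring.inverse_unit]
  simp [this, pow_two]

namespace IsBoundedModel

variable {K : H →L[ℝ] H} {T : Fin n → H →L[ℝ] H} {l : Fin n → ℝ} (M : IsBoundedModel K T l)
include M

theorem T_pos (i : Fin n) : (T i).IsPositive :=
  isPositive_of_mul_nonneg M.K_pos M.K_inj (M.T_sa i) (M.KT_comm i) (M.KT_nonneg i)

theorem symbol_sa (x : Fin n → ℝ) : IsSelfAdjoint (symbol T x) := by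
  rw [symbol_apply]
  exact isSelfAdjoint_sum _ fun i _ => (IsSelfAdjoint.all (x i)).smul (M.T_sa i)

theorem symbol_pos {x : Fin n → ℝ} (hx : ∀ i, 0 ≤ x i) : (symbol T x).IsPositive := by
  rw [symbol_apply]
  exact ContinuousLinearMap.isPositive_sum _ fun i _ => (M.T_pos i).smul_of_nonneg (hx i)

theorem commute_K_symbol (x : Fin n → ℝ) : Commute K (symbol T x) := commute_symbol M.KT_comm x

theorem commute_T_symbol (i : Fin n) (x : Fin n → ℝ) : Commute (T i) (symbol T x) :=
  commute_symbol (M.T_comm i) x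

theorem commute_symbol_symbol (x y : Fin n → ℝ) : Commute (symbol T x) (symbol T y) :=
  commute_symbol (fun i => (M.commute_T_symbol i x).symm) y

theorem commute_symbol_resolv (x : Fin n → ℝ) {ε : ℝ} (hε : 0 < ε) :
    Commute (symbol T x) (resolv K ε) := commute_resolv M.K_pos hε (M.commute_K_symbol x).symm

theorem symbol_sub_eq (x : Fin n → ℝ) (c : ℝ) :
    symbol T x = c • (1 : H →L[ℝ] H) + symbol T (x - c • l) := by
  rw [map_sub, map_smul, M.sum_eq]; abel

/-- Substituting u = (K + ε)w turns ⟨P_x B u, u⟩ into ⟨P_x w, K w⟩ + ε⟨P_x w, w⟩, and both terms are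
nonnegative. -/
theorem isPositive_symbol_mul_resolv {x : Fin n → ℝ} (hx : ∀ i, 0 ≤ x i) {ε : ℝ} (hε : 0 < ε) :
    (symbol T x * resolv K ε).IsPositive := by
  rw [ContinuousLinearMap.isPositive_iff']
  refine ⟨((M.symbol_sa x).commute_iff (isSelfAdjoint_resolv M.K_pos hε)).1 (M.commute_symbol_resolv x hε), ?_⟩
  intro u
  obtain ⟨w, rfl⟩ : ∃ w, u = (K + ε • (1 : H →L[ℝ] H)) w :=
    ⟨resolv K ε u, by rw [← clm_mul_apply, add_smul_mul_resolv M.K_pos hε]; rfl⟩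
  have h1 : resolv K ε ((K + ε • (1 : H →L[ℝ] H)) w) = w := by
    rw [← clm_mul_apply, resolv, Ring.inverse_mul_cancel _ (isUnit_add_smul M.K_pos hε)]; rfl
  rw [clm_mul_apply, h1]
  have h2 : 0 ≤ inner ℝ (symbol T x w) (K w) := by
    rw [symbol_apply]
    simp only [_root_.sum_apply, _root_.smul_apply, sum_inner, inner_smul_left]
    exact Finset.sum_nonneg fun i _ => mul_nonneg (by simpa using hx i) (M.KT_nonneg i w)
  have h3 := (M.symbol_pos hx).inner_nonneg_left w
  simp only [_root_.add_apply, _root_.smul_apply, inner_add_right,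
    inner_smul_right]
  exact add_nonneg h2 (mul_nonneg hε.le h3)

theorem isPositive_resolv {ε : ℝ} (hε : 0 < ε) : (resolv K ε).IsPositive := by
  have := M.isPositive_symbol_mul_resolv (fun i => (M.l_pos i).le) hε
  rwa [M.sum_eq, one_mul] at this

/-- Since Σ l_i T_i = 1, P_x = c + P_{x-cl} with P_{x-cl}B ≥ 0. The factor e^{-cB} absorbs B^k at
the cost k!/c^k, and the other exponential is a contraction. The bound does not involve ε. -/
theorem norm_approxExp_le (k : ℕ) {ε c : ℝ} (hε : 0 < ε) (hc : 0 < c) {x : Fin n → ℝ}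
    (hx : ∀ i, c * l i ≤ x i) : ‖approxExp K T k ε x‖ ≤ k.factorial / c ^ k := by
  let _ : NormedAlgebra ℚ (H →L[ℝ] H) := NormedAlgebra.restrictScalars ℚ ℝ _
  set B := resolv K ε
  have hB := M.isPositive_resolv hε
  have hpos := M.isPositive_symbol_mul_resolv (x := x - c • l) (fun i => by simpa using hx i) hε
  have hcomm : Commute (-(c • B)) (-(symbol T (x - c • l) * B)) :=
    ((((M.commute_symbol_resolv _ hε).symm.mul_right (Commute.refl B)).smul_left c).neg_left).neg_right
  have h1 : approxExp K T k ε x = (c ^ k)⁻¹ • (((c • B) ^ k * NormedSpace.exp (-(c • B))) *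
      NormedSpace.exp (-(symbol T (x - c • l) * B))) := by
    rw [mul_assoc, ← NormedSpace.exp_add_of_commute hcomm, smul_pow, smul_mul_assoc, smul_smul,
      inv_mul_cancel₀ (by positivity), one_smul, approxExp, M.symbol_sub_eq x c]
    congr 2
    rw [add_mul, smul_mul_assoc, one_mul, neg_add]
  rw [h1, norm_smul, norm_inv, norm_pow, Real.norm_of_nonneg hc.le, div_eq_inv_mul]
  gcongr
  refine (norm_mul_le _ _).trans ?_
  have h2 := norm_pow_mul_exp_neg_le (hB.smul_of_nonneg (c := c) (by exact hc.le)) k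
  have h3 := norm_exp_neg_le_one hpos
  calc _ ≤ (k.factorial : ℝ) * 1 := by gcongr
    _ = _ := mul_one _

theorem approxExp_mul (j k : ℕ) {ε : ℝ} (hε : 0 < ε) (x y : Fin n → ℝ) :
    approxExp K T j ε x * approxExp K T k ε y = approxExp K T (j + k) ε (x + y) := by
  let _ : NormedAlgebra ℚ (H →L[ℝ] H) := NormedAlgebra.restrictScalars ℚ ℝ _
  have hc1 : ∀ z, Commute (symbol T z * resolv K ε) (resolv K ε) := fun z =>
    (M.commute_symbol_resolv z hε).mul_left (Commute.refl _)
  have hc2 : Commute (-(symbol T x * resolv K ε)) (-(symbol T y * resolv K ε)) :=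
    (((M.commute_symbol_symbol x y).mul_left (M.commute_symbol_resolv y hε).symm).mul_right
      (hc1 x)).neg_left.neg_right
  have hc3 : Commute (NormedSpace.exp (-(symbol T x * resolv K ε))) (resolv K ε ^ k) :=
    ((hc1 x).neg_left.exp_left).pow_right k
  rw [approxExp, approxExp, approxExp, mul_assoc, ← mul_assoc (NormedSpace.exp _), hc3.eq, map_add,
    add_mul, neg_add, NormedSpace.exp_add_of_commute hc2, pow_add]
  simp only [mul_assoc]

theorem commute_approxExp {A : H →L[ℝ] H} (hAK : Commute A K) (hAT : ∀ i, Commute A (T i)) (k : ℕ)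
    {ε : ℝ} (hε : 0 < ε) (x : Fin n → ℝ) : Commute A (approxExp K T k ε x) := by
  have h1 := commute_resolv M.K_pos hε hAK
  exact (h1.pow_right k).mul_right (((commute_symbol hAT x).mul_right h1).neg_right.exp_right)

theorem isSelfAdjoint_approxExp (k : ℕ) {ε : ℝ} (hε : 0 < ε) (x : Fin n → ℝ) :
    IsSelfAdjoint (approxExp K T k ε x) := by
  have h1 : Commute (symbol T x * resolv K ε) (resolv K ε) :=
    (M.commute_symbol_resolv x hε).mul_left (Commute.refl _)
  have h2 : IsSelfAdjoint (symbol T x * resolv K ε) :=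
    ((M.symbol_sa x).commute_iff (isSelfAdjoint_resolv M.K_pos hε)).1 (M.commute_symbol_resolv x hε)
  have h3 : Commute (resolv K ε ^ k) (NormedSpace.exp (-(symbol T x * resolv K ε))) :=
    (h1.symm.neg_right.exp_right).pow_left k
  exact (((isSelfAdjoint_resolv M.K_pos hε).pow k).commute_iff h2.neg.exp).1 h3

theorem mul_approxExp_succ (k : ℕ) {ε : ℝ} (hε : 0 < ε) (x : Fin n → ℝ) :
    K * approxExp K T (k + 1) ε x + ε • approxExp K T (k + 1) ε x = approxExp K T k ε x := by
  have h := add_smul_mul_resolv M.K_pos hε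
  rw [← one_mul (approxExp K T k ε x), ← h, approxExp, approxExp, pow_succ']
  simp only [add_mul, smul_mul_assoc, one_mul, mul_assoc]

theorem hasDerivAt_approxExp_param (k : ℕ) {ε : ℝ} (hε : 0 < ε) (x : Fin n → ℝ) :
    HasDerivAt (fun ε => approxExp K T k ε x)
      (-((k : ℝ) • approxExp K T (k + 1) ε x) + symbol T x * approxExp K T (k + 2) ε x) ε := by
  have hB := hasDerivAt_resolv M.K_pos hε
  have hpow : ∀ k : ℕ, HasDerivAt (fun ε => resolv K ε ^ k) (-((k : ℝ) • resolv K ε ^ (k + 1))) ε := by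
    intro k
    induction k with
    | zero => simpa using hasDerivAt_const ε (1 : H →L[ℝ] H)
    | succ k ih =>
      have := ih.mul hB
      simp only [pow_succ _ k]
      refine this.congr_deriv ?_
      rw [neg_mul, smul_mul_assoc, mul_neg, ← pow_add, ← pow_succ]
      push_cast
      rw [add_smul, one_smul, neg_add]
  have hexp : HasDerivAt (fun ε => NormedSpace.exp (-(symbol T x * resolv K ε)))
      (NormedSpace.exp (-(symbol T x * resolv K ε)) * (symbol T x * resolv K ε ^ 2)) ε := by
    have h1 : HasDerivAt (fun ε => -(symbol T x * resolv K ε)) (symbol T x * resolv K ε ^ 2) ε := by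
      exact (hB.const_mul (symbol T x)).neg.congr_deriv (by simp)
    -- The exponential rule asks for commutation at every s, while the resolvents are known to
    -- commute only for s > 0; the exponent is therefore cut off to 0 elsewhere, which changes
    -- nothing near ε.
    have hev : (fun s => if 0 < s then -(symbol T x * resolv K s) else 0) =ᶠ[𝓝 ε]
        fun ε => -(symbol T x * resolv K ε) := by
      filter_upwards [lt_mem_nhds hε] with s hs
      simp only [if_pos hs]
    have h2 := hasDerivAt_exp_of_commute (h1.congr_of_eventuallyEq hev) (fun s => by
      by_cases hs : 0 < s
      · simp only [if_pos hs, if_pos hε]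
        exact (((Commute.refl (symbol T x)).mul_left (M.commute_symbol_resolv x hε).symm).mul_right
          ((M.commute_symbol_resolv x hs).mul_left (commute_resolv_resolv M.K_pos hs hε))).neg_left.neg_right
      · simp only [if_neg hs]
        exact Commute.zero_right _)
    simp only [if_pos hε] at h2
    refine h2.congr_of_eventuallyEq ?_
    filter_upwards [hev] with s hs
    rw [hs]
  refine ((hpow k).mul hexp).congr_deriv ?_
  have hc1 : Commute (symbol T x) (resolv K ε) := M.commute_symbol_resolv x hε
  have hc2 : Commute (NormedSpace.exp (-(symbol T x * resolv K ε))) (symbol T x * resolv K ε ^ 2) :=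
    (((Commute.refl (symbol T x)).mul_left hc1.symm).mul_right
      ((hc1.mul_left (Commute.refl _)).pow_right 2)).neg_left.exp_left
  rw [hc2.eq, approxExp, approxExp, neg_mul, smul_mul_assoc, pow_add _ k 2, ← mul_assoc, ← mul_assoc,
    ← mul_assoc, ← mul_assoc, (hc1.pow_right k).eq]

/-- The ε-derivative only involves the same operators of orders k+1 and k+2, bounded uniformly in ε.
So the family is Lipschitz in ε, hence Cauchy as ε → 0. -/
theorem norm_approxExp_sub_le (k : ℕ) {c : ℝ} (hc : 0 < c) {x : Fin n → ℝ}
    (hx : ∀ i, c * l i ≤ x i) : ∃ L : ℝ, ∀ ε δ : ℝ, 0 < ε → 0 < δ →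
      ‖approxExp K T k ε x - approxExp K T k δ x‖ ≤ L * ‖ε - δ‖ := by
  refine ⟨k * ((k + 1).factorial / c ^ (k + 1)) + ‖symbol T x‖ * ((k + 2).factorial / c ^ (k + 2)), ?_⟩
  intro ε δ hε hδ
  refine (convex_Ioi (0 : ℝ)).norm_image_sub_le_of_norm_hasDerivWithin_le
    (fun η hη => (M.hasDerivAt_approxExp_param k hη x).hasDerivWithinAt) (fun η hη => ?_) hδ hε
  have h1 := M.norm_approxExp_le (k + 1) hη hc hx
  have h2 := M.norm_approxExp_le (k + 2) hη hc hx
  refine (norm_add_le _ _).trans (add_le_add ?_ ?_)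
  · rw [norm_neg, norm_smul, Real.norm_of_nonneg (Nat.cast_nonneg k)]
    gcongr
  · refine (norm_mul_le _ _).trans ?_
    gcongr

theorem tendsto_approxExp (k : ℕ) {x : Fin n → ℝ} (hx : x ∈ posOrthant n) :
    Tendsto (fun ε => approxExp K T k ε x) (𝓝[>] 0) (𝓝 (limExp K T k x)) := by
  obtain ⟨c, hc, hcx⟩ := exists_coercivity l hx
  obtain ⟨L, hL⟩ := M.norm_approxExp_sub_le k hc fun i => (hcx i).le
  refine tendsto_nhds_limUnder (cauchy_iff_exists_le_nhds.1 ?_)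
  refine cauchy_map_iff.2 ⟨inferInstance, tendsto_uniformity_iff_dist_tendsto_zero.2 ?_⟩
  have h1 : Tendsto (fun p : ℝ × ℝ => L * ‖p.1 - p.2‖) (𝓝[>] 0 ×ˢ 𝓝[>] 0) (𝓝 0) := by
    have : Tendsto (fun p : ℝ × ℝ => L * ‖p.1 - p.2‖) (𝓝 (0, 0)) (𝓝 (L * ‖(0 : ℝ) - 0‖)) :=
      Continuous.tendsto (by fun_prop) _
    rw [nhds_prod_eq] at this
    simpa using this.mono_left (Filter.prod_mono nhdsWithin_le_nhds nhdsWithin_le_nhds)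
  refine squeeze_zero' (Eventually.of_forall fun _ => dist_nonneg) ?_ h1
  have : ∀ᶠ ε in 𝓝[>] (0 : ℝ), 0 < ε := self_mem_nhdsWithin
  filter_upwards [this.prod_mk this] with p hp
  rw [dist_eq_norm]
  exact hL _ _ hp.1 hp.2

end IsBoundedModel

end Model

theorem isOpen_posOrthant (n : ℕ) : IsOpen (posOrthant n) := by
  have : posOrthant n = ⋂ i, {lam : Fin n → ℝ | 0 < lam i} := by ext; simp [posOrthant]
  rw [this]
  exact isOpen_iInter_of_finite fun i => isOpen_lt continuous_const (continuous_apply i)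

theorem add_mem_posOrthant {n : ℕ} {x y : Fin n → ℝ} (hx : x ∈ posOrthant n) (hy : y ∈ posOrthant n) :
    x + y ∈ posOrthant n := fun i => add_pos (hx i) (hy i)

theorem smul_mem_posOrthant {n : ℕ} {x : Fin n → ℝ} (hx : x ∈ posOrthant n) {t : ℝ} (ht : 0 < t) :
    t • x ∈ posOrthant n := fun i => mul_pos ht (hx i)

/-! ### The limits A(l)^k e^{-A(x)}: algebra, bounds and derivatives in x. -/

namespace IsBoundedModel

variable {H : Type*} [NormedAddCommGroup H] [InnerProductSpace ℝ H] {n : ℕ} [CompleteSpace H]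
variable {K : H →L[ℝ] H} {T : Fin n → H →L[ℝ] H} {l : Fin n → ℝ} (M : IsBoundedModel K T l)
include M

theorem mem_posOrthant_of_le {c : ℝ} (hc : 0 < c) {x : Fin n → ℝ} (hx : ∀ i, c * l i ≤ x i) :
    x ∈ posOrthant n := fun i => (mul_pos hc (M.l_pos i)).trans_le (hx i)

theorem norm_limExp_le (k : ℕ) {c : ℝ} (hc : 0 < c) {x : Fin n → ℝ} (hx : ∀ i, c * l i ≤ x i) :
    ‖limExp K T k x‖ ≤ k.factorial / c ^ k := by
  refine le_of_tendsto (M.tendsto_approxExp k (M.mem_posOrthant_of_le hc hx)).norm ?_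
  filter_upwards [self_mem_nhdsWithin] with ε hε
  exact M.norm_approxExp_le k hε hc hx

theorem limExp_mul (j k : ℕ) {x y : Fin n → ℝ} (hx : x ∈ posOrthant n) (hy : y ∈ posOrthant n) :
    limExp K T j x * limExp K T k y = limExp K T (j + k) (x + y) := by
  refine tendsto_nhds_unique ((M.tendsto_approxExp j hx).mul (M.tendsto_approxExp k hy))
    ((M.tendsto_approxExp (j + k) (add_mem_posOrthant hx hy)).congr' ?_)
  filter_upwards [self_mem_nhdsWithin] with ε hε
  exact (M.approxExp_mul j k hε x y).symm

theorem commute_limExp {A : H →L[ℝ] H} (hAK : Commute A K) (hAT : ∀ i, Commute A (T i)) (k : ℕ)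
    {x : Fin n → ℝ} (hx : x ∈ posOrthant n) : Commute A (limExp K T k x) := by
  have h := M.tendsto_approxExp k hx
  refine tendsto_nhds_unique (h.const_mul A) ((h.mul_const A).congr' ?_)
  filter_upwards [self_mem_nhdsWithin] with ε hε
  exact (M.commute_approxExp hAK hAT k hε x).eq.symm

theorem isSelfAdjoint_limExp (k : ℕ) {x : Fin n → ℝ} (hx : x ∈ posOrthant n) :
    IsSelfAdjoint (limExp K T k x) := by
  have h := M.tendsto_approxExp k hx
  refine tendsto_nhds_unique (((continuous_star.tendsto _).comp h).congr' ?_) h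
  filter_upwards [self_mem_nhdsWithin] with ε hε
  exact (M.isSelfAdjoint_approxExp k hε x).star_eq

theorem commute_T_limExp (i : Fin n) (k : ℕ) {x : Fin n → ℝ} (hx : x ∈ posOrthant n) :
    Commute (T i) (limExp K T k x) :=
  M.commute_limExp (M.KT_comm i).symm (M.T_comm i) k hx

theorem commute_K_limExp (k : ℕ) {x : Fin n → ℝ} (hx : x ∈ posOrthant n) :
    Commute K (limExp K T k x) :=
  M.commute_limExp (Commute.refl K) M.KT_comm k hx

theorem K_mul_limExp_succ (k : ℕ) {x : Fin n → ℝ} (hx : x ∈ posOrthant n) :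
    K * limExp K T (k + 1) x = limExp K T k x := by
  have h := M.tendsto_approxExp (k + 1) hx
  have hid : Tendsto (fun ε : ℝ => ε) (𝓝[>] 0) (𝓝 0) := tendsto_id.mono_left nhdsWithin_le_nhds
  have h2 := (h.const_mul K).add (hid.smul h)
  rw [zero_smul, add_zero] at h2
  refine tendsto_nhds_unique h2 ((M.tendsto_approxExp k hx).congr' ?_)
  filter_upwards [self_mem_nhdsWithin] with ε hε
  exact (M.mul_approxExp_succ k hε x).symm

theorem hasDerivAt_approxExp_line (k : ℕ) {ε : ℝ} (hε : 0 < ε) (x z : Fin n → ℝ) (t : ℝ) :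
    HasDerivAt (fun t : ℝ => approxExp K T k ε (x + t • z))
      (-(symbol T z * approxExp K T (k + 1) ε (x + t • z))) t := by
  have hz := M.commute_symbol_resolv z hε
  have h1 : HasDerivAt (fun t : ℝ => -(symbol T (x + t • z) * resolv K ε))
      (-(symbol T z * resolv K ε)) t := by
    have h2 : HasDerivAt (fun t : ℝ => x + t • z) z t := by
      simpa using ((hasDerivAt_id t).smul_const z).const_add x
    exact (((symbol T).hasFDerivAt.comp_hasDerivAt t h2).mul_const (resolv K ε)).neg
  have hc : ∀ y y', Commute (-(symbol T y * resolv K ε)) (-(symbol T y' * resolv K ε)) :=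
    fun y y' => (((M.commute_symbol_symbol y y').mul_left (M.commute_symbol_resolv y' hε).symm).mul_right
      ((M.commute_symbol_resolv y hε).mul_left (Commute.refl _))).neg_left.neg_right
  have h3 := (hasDerivAt_exp_of_commute h1 (fun s => hc _ _)).const_mul (resolv K ε ^ k)
  refine h3.congr_deriv ?_
  rw [((hc (x + t • z) z).exp_left).eq, approxExp, ← mul_assoc, mul_neg, neg_mul, ← mul_assoc,
    ← mul_assoc, pow_succ, ← (hz.pow_right k).eq]
  simp only [mul_assoc]

/-- A second-order Taylor remainder along the segment from x to y, which stays in the convex region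
{x ≥ c l}. Its constant is free of ε, so it survives the limit and directly gives differentiability
of the limit. -/
theorem norm_approxExp_sub_sub_le (k : ℕ) {ε c : ℝ} (hε : 0 < ε) (hc : 0 < c) {x y : Fin n → ℝ}
    (hx : ∀ i, c * l i ≤ x i) (hy : ∀ i, c * l i ≤ y i) :
    ‖approxExp K T k ε y - approxExp K T k ε x +
        symbol T (y - x) * approxExp K T (k + 1) ε x‖ ≤
      ((k + 2).factorial / c ^ (k + 2)) * ‖symbol T (y - x)‖ ^ 2 := by
  set z := y - x with hz
  set P := symbol T z
  have hseg : ∀ t ∈ Icc (0 : ℝ) 1, ∀ i, c * l i ≤ (x + t • z) i := fun t ht i => by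
    have h1 := hx i; have h2 := hy i
    simp only [hz, Pi.add_apply, Pi.smul_apply, Pi.sub_apply, smul_eq_mul]
    nlinarith [ht.1, ht.2]
  have hstep : ∀ t ∈ Icc (0 : ℝ) 1,
      ‖approxExp K T (k + 1) ε (x + t • z) - approxExp K T (k + 1) ε x‖ ≤
        ‖P‖ * ((k + 2).factorial / c ^ (k + 2)) := fun t ht => by
    have h1 := (convex_Icc (0 : ℝ) 1).norm_image_sub_le_of_norm_hasDerivWithin_le
      (f := fun t : ℝ => approxExp K T (k + 1) ε (x + t • z))
      (C := ‖P‖ * ((k + 2).factorial / c ^ (k + 2)))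
      (fun s _ => (M.hasDerivAt_approxExp_line (k + 1) hε x z s).hasDerivWithinAt)
      (fun s hs => by
        rw [norm_neg]
        refine (norm_mul_le _ _).trans ?_
        gcongr
        exact M.norm_approxExp_le (k + 2) hε hc (hseg s hs))
      (left_mem_Icc.2 zero_le_one) ht
    simp only [zero_smul, add_zero, sub_zero] at h1
    refine h1.trans (mul_le_of_le_one_right (by positivity) ?_)
    rw [Real.norm_of_nonneg ht.1]
    exact ht.2
  have hlin : ∀ t : ℝ, HasDerivAt (fun t : ℝ => approxExp K T k ε (x + t • z) +
      t • (P * approxExp K T (k + 1) ε x))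
      (-(P * approxExp K T (k + 1) ε (x + t • z)) + P * approxExp K T (k + 1) ε x) t := fun t => by
    have := (hasDerivAt_id t).smul_const (P * approxExp K T (k + 1) ε x)
    rw [one_smul] at this
    exact (M.hasDerivAt_approxExp_line k hε x z t).add this
  have h2 := (convex_Icc (0 : ℝ) 1).norm_image_sub_le_of_norm_hasDerivWithin_le
      (C := ‖P‖ * (‖P‖ * ((k + 2).factorial / c ^ (k + 2))))
      (fun s _ => (hlin s).hasDerivWithinAt)
      (fun s hs => by
        rw [neg_add_eq_sub, ← mul_sub]
        refine (norm_mul_le _ _).trans ?_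
        rw [norm_sub_rev]
        gcongr
        exact hstep s hs)
      (left_mem_Icc.2 zero_le_one) (right_mem_Icc.2 zero_le_one)
  simp only [zero_smul, add_zero, sub_zero, one_smul, norm_one, mul_one, hz,
    add_sub_cancel] at h2
  calc _ = _ := by congr 1; abel
    _ ≤ _ := h2
    _ = _ := by ring

theorem norm_limExp_sub_sub_le (k : ℕ) {c : ℝ} (hc : 0 < c) {x y : Fin n → ℝ}
    (hx : ∀ i, c * l i ≤ x i) (hy : ∀ i, c * l i ≤ y i) :
    ‖limExp K T k y - limExp K T k x + symbol T (y - x) * limExp K T (k + 1) x‖ ≤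
      ((k + 2).factorial / c ^ (k + 2)) * ‖symbol T (y - x)‖ ^ 2 := by
  have h1 := M.tendsto_approxExp k (M.mem_posOrthant_of_le hc hx)
  have h2 := M.tendsto_approxExp k (M.mem_posOrthant_of_le hc hy)
  have h3 := M.tendsto_approxExp (k + 1) (M.mem_posOrthant_of_le hc hx)
  refine le_of_tendsto ((h2.sub h1).add (h3.const_mul (symbol T (y - x)))).norm ?_
  filter_upwards [self_mem_nhdsWithin] with ε hε
  exact M.norm_approxExp_sub_sub_le k hε hc hx hy

theorem hasFDerivAt_limExp (k : ℕ) {x : Fin n → ℝ} (hx : x ∈ posOrthant n) :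
    HasFDerivAt (limExp K T k)
      (-(((ContinuousLinearMap.mul ℝ (H →L[ℝ] H)).flip (limExp K T (k + 1) x)).comp (symbol T))) x := by
  obtain ⟨c, hc, hcx⟩ := exists_coercivity l hx
  have hev : ∀ᶠ y in 𝓝 x, ∀ i, c * l i ≤ y i :=
    eventually_all.2 fun i =>
      ((continuous_apply i).tendsto x).eventually ((lt_mem_nhds (hcx i)).mono fun _ h => h.le)
  refine HasFDerivAt.of_isLittleO ?_
  refine Asymptotics.IsBigO.trans_isLittleO (g := fun y => ‖y - x‖ ^ 2) ?_ ?_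
  · refine Asymptotics.IsBigO.of_bound (((k + 2).factorial / c ^ (k + 2)) * ‖symbol T‖ ^ 2) ?_
    filter_upwards [hev] with y hy
    have h1 := M.norm_limExp_sub_sub_le k hc (fun i => (hcx i).le) hy
    have h2 := (symbol T).le_opNorm (y - x)
    simp only [_root_.neg_apply, ContinuousLinearMap.comp_apply, ContinuousLinearMap.flip_apply,
      ContinuousLinearMap.mul_apply', sub_neg_eq_add]
    refine h1.trans ?_
    rw [norm_pow, norm_norm, mul_assoc, ← mul_pow]
    gcongr
  · have h := (Asymptotics.isLittleO_norm_pow_id (E' := Fin n → ℝ) one_lt_two)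
    have ht : Tendsto (fun y => y - x) (𝓝 x) (𝓝 0) := by
      simpa using (continuous_sub_right x).tendsto x
    exact h.comp_tendsto ht

theorem continuousOn_limExp (k : ℕ) : ContinuousOn (limExp K T k) (posOrthant n) :=
  fun _ hx => (M.hasFDerivAt_limExp k hx).continuousAt.continuousWithinAt

/-- The value at the point `x + t z` differentiates to `-P_z A(l) exp (-A(x + t z))`. -/
theorem hasDerivAt_limExp_smul (k : ℕ) {x : Fin n → ℝ} (hx : x ∈ posOrthant n) {t : ℝ} (ht : 0 < t) :
    HasDerivAt (fun t : ℝ => limExp K T k (t • x))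
      (-(symbol T x * limExp K T (k + 1) (t • x))) t := by
  have h2 : HasDerivAt (fun t : ℝ => t • x) x t := by
    simpa using (hasDerivAt_id t).smul_const x
  exact (M.hasFDerivAt_limExp k (smul_mem_posOrthant hx ht)).comp_hasDerivAt t h2

theorem norm_limExp_zero_le_one {x : Fin n → ℝ} (hx : x ∈ posOrthant n) : ‖limExp K T 0 x‖ ≤ 1 := by
  obtain ⟨c, hc, hcx⟩ := exists_coercivity l hx
  simpa using M.norm_limExp_le 0 hc fun i => (hcx i).le

/-- BK = 1 - εB and ‖εB‖ ≤ 1; any bound uniform in ε would do. -/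
theorem norm_resolv_mul_K_le {ε : ℝ} (hε : 0 < ε) : ‖resolv K ε * K‖ ≤ 2 := by
  have hB : ‖resolv K ε‖ ≤ ε⁻¹ := by
    refine ContinuousLinearMap.opNorm_le_bound _ (by positivity) fun u => ?_
    set v := resolv K ε u with hv
    have h1 : K v + ε • v = u := by
      have : ((K + ε • (1 : H →L[ℝ] H)) * resolv K ε) u = u := by
        rw [add_smul_mul_resolv M.K_pos hε]; rfl
      simpa [clm_mul_apply] using this
    have h2 := M.K_pos.inner_nonneg_left v
    have h3 : inner ℝ u v = inner ℝ (K v) v + ε * ‖v‖ ^ 2 := by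
      rw [← real_inner_self_eq_norm_sq, ← real_inner_smul_left, ← inner_add_left, h1]
    have h4 := real_inner_le_norm u v
    rw [inv_mul_eq_div, le_div_iff₀ hε]
    by_cases h0 : ‖v‖ = 0
    · rw [h0, zero_mul]; positivity
    · have h5 : 0 < ‖v‖ := lt_of_le_of_ne (norm_nonneg _) (Ne.symm h0)
      nlinarith
  have h1 : resolv K ε * K = 1 - ε • resolv K ε := by
    have := Ring.inverse_mul_cancel _ (isUnit_add_smul M.K_pos hε)
    rw [mul_add, mul_smul_comm, mul_one] at this
    exact eq_sub_of_add_eq this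
  rw [h1]
  have h2 : ‖(1 : H →L[ℝ] H)‖ ≤ 1 := ContinuousLinearMap.norm_id_le
  have h3 : ‖ε • resolv K ε‖ ≤ 1 := by
    rw [norm_smul, Real.norm_of_nonneg hε.le]
    calc ε * ‖resolv K ε‖ ≤ ε * ε⁻¹ := by gcongr
      _ = 1 := mul_inv_cancel₀ hε.ne'
  linarith [norm_sub_le (1 : H →L[ℝ] H) (ε • resolv K ε)]

/-- The point 0 lies on the boundary of the orthant (n > 0), where the limits are not controlled. At
fixed ε, however, the path t ↦ exp(-tP_xB)K starts at K and has speed at most ‖P_x‖‖BK‖, which is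
bounded uniformly in ε. -/
theorem norm_limExp_zero_mul_sub_le {x : Fin n → ℝ} (hx : x ∈ posOrthant n) {t : ℝ} (ht : 0 < t) :
    ‖limExp K T 0 (t • x) * K - K‖ ≤ 2 * ‖symbol T x‖ * t := by
  have h := M.tendsto_approxExp 0 (smul_mem_posOrthant hx ht)
  refine le_of_tendsto ((h.mul_const K).sub_const K).norm ?_
  filter_upwards [self_mem_nhdsWithin] with ε hε
  have h1 := (convex_Icc 0 t).norm_image_sub_le_of_norm_hasDerivWithin_le
      (C := 2 * ‖symbol T x‖)
      (fun η _ => ((M.hasDerivAt_approxExp_line 0 hε 0 x η).mul_const K).hasDerivWithinAt)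
      (fun η hη => ?_) (left_mem_Icc.2 ht.le) (right_mem_Icc.2 ht.le)
  · simp only [zero_add, zero_smul, sub_zero] at h1
    have h0 : approxExp K T 0 ε 0 = 1 := by simp [approxExp]
    rwa [h0, one_mul, Real.norm_of_nonneg ht.le] at h1
  · have hη' : ∀ i, 0 ≤ (0 + η • x) i := fun i => by
      simpa using mul_nonneg hη.1 (hx i).le
    have hP := M.isPositive_symbol_mul_resolv hη' hε
    have hc : Commute (resolv K ε) (NormedSpace.exp (-(symbol T (0 + η • x) * resolv K ε))) :=
      ((M.commute_symbol_resolv _ hε).symm.mul_right (Commute.refl _)).neg_right.exp_right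
    rw [neg_mul, norm_neg, approxExp, zero_add, pow_one, hc.eq, mul_assoc, mul_assoc]
    calc _ ≤ ‖symbol T x‖ * (1 * 2) := by
            refine (norm_mul_le _ _).trans ?_
            gcongr
            refine (norm_mul_le _ _).trans ?_
            gcongr
            · exact norm_exp_neg_le_one hP
            · exact M.norm_resolv_mul_K_le hε
      _ = _ := by ring

end IsBoundedModel

/-! ### Uniqueness of semigroups with dissipative generator. -/

section Semigroups

variable {H : Type*} [NormedAddCommGroup H] [InnerProductSpace ℝ H]

theorem IsSemigroupGeneratedBy.hasDerivWithinAt {S : ℝ → H →L[ℝ] H} {B : H →ₗ.[ℝ] H}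
    (hS : IsSemigroupGeneratedBy S B) {x y : H} (hxy : (x, y) ∈ B.graph) {t : ℝ} (ht : 0 ≤ t) :
    (S t x, S t y) ∈ B.graph ∧ HasDerivWithinAt (fun t => S t x) (S t y) (Ici t) t := by
  have h1 := (hS.generator x y).1 hxy
  have h2 : Tendsto (fun h : ℝ => h⁻¹ • (S (t + h) x - S t x)) (𝓝[>] 0) (𝓝 (S t y)) := by
    refine (((S t).continuous.tendsto y).comp h1).congr' ?_
    filter_upwards [self_mem_nhdsWithin] with h hh
    simp [hS.map_add t h ht (le_of_lt hh)]
  constructor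
  · rw [hS.generator]
    refine h2.congr' ?_
    filter_upwards [self_mem_nhdsWithin] with h hh
    rw [add_comm, hS.map_add h t (le_of_lt hh) ht]
    simp
  · rw [← hasDerivWithinAt_Ioi_iff_Ici, hasDerivWithinAt_iff_tendsto_slope' (by simp)]
    have h3 : Tendsto (fun s : ℝ => s - t) (𝓝[>] t) (𝓝[>] 0) := by
      refine tendsto_nhdsWithin_iff.2 ⟨?_, ?_⟩
      · simpa using ((continuous_sub_right t).tendsto t).mono_left nhdsWithin_le_nhds
      · filter_upwards [self_mem_nhdsWithin] with s hs
        exact sub_pos.2 (mem_Ioi.1 hs)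
    refine (h2.comp h3).congr fun s => ?_
    simp [slope]

/-- A dissipative densely defined operator generates at most one strongly continuous semigroup. -/
theorem IsSemigroupGeneratedBy.unique {S S' : ℝ → H →L[ℝ] H} {B : H →ₗ.[ℝ] H}
    (hS : IsSemigroupGeneratedBy S B) (hS' : IsSemigroupGeneratedBy S' B)
    (hdiss : ∀ x y, (x, y) ∈ B.graph → inner ℝ y x ≤ 0) (hdense : Dense (B.domain : Set H))
    {t : ℝ} (ht : 0 ≤ t) : S t = S' t := by
  have key : ∀ x ∈ (B.domain : Set H), S t x = S' t x := by
    intro x hx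
    have hxy : (x, B ⟨x, hx⟩) ∈ B.graph := B.mem_graph ⟨x, hx⟩
    set y := B ⟨x, hx⟩
    -- The difference solves w' = Bw with w(0) = 0, so by dissipativity the right derivative of ‖w‖²
    -- is nonpositive.
    set w : ℝ → H := fun s => S s x - S' s x
    have hw : ∀ s ∈ Ico (0 : ℝ) t, HasDerivWithinAt (fun s => ‖w s‖ ^ 2)
        (2 * inner ℝ (w s) (S s y - S' s y)) (Ici s) s := fun s hs =>
      ((hS.hasDerivWithinAt hxy hs.1).2.sub (hS'.hasDerivWithinAt hxy hs.1).2).norm_sq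
    have hcont : ContinuousOn (fun s => ‖w s‖ ^ 2) (Icc 0 t) :=
      ((((hS.continuousOn x).sub (hS'.continuousOn x)).mono Icc_subset_Ici_self).norm).pow 2
    have hle := image_le_of_deriv_right_le_deriv_boundary hcont hw (B := fun _ => (0 : ℝ))
      (B' := fun _ => 0) (by simp [w, hS.map_zero, hS'.map_zero]) continuousOn_const
      (fun s _ => hasDerivWithinAt_const _ _ _) (fun s hs => by
        have h1 := B.graph.sub_mem (hS.hasDerivWithinAt hxy hs.1).1 (hS'.hasDerivWithinAt hxy hs.1).1
        have h2 := hdiss _ _ h1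
        rw [real_inner_comm] at h2
        linarith) (right_mem_Icc.2 ht)
    have h0 : ‖w t‖ = 0 := by
      have h1 : ‖w t‖ ^ 2 ≤ 0 := hle
      have h2 : ‖w t‖ ^ 2 = 0 := le_antisymm h1 (by positivity)
      simpa using h2
    exact sub_eq_zero.1 (norm_eq_zero.1 h0)
  exact ContinuousLinearMap.ext fun x =>
    congrFun (Continuous.ext_on hdense (S t).continuous (S' t).continuous key) x

theorem expNeg_eq {S : ℝ → H →L[ℝ] H} {A : H →ₗ.[ℝ] H} (hS : IsSemigroupGeneratedBy S (-A))
    (hdiss : ∀ x y, (x, y) ∈ (-A).graph → inner ℝ y x ≤ 0) (hdense : Dense (A.domain : Set H)) :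
    IsSemigroupGeneratedBy (expNeg A) (-A) ∧ ∀ t, 0 ≤ t → expNeg A t = S t := by
  have hex : ∃ S : ℝ → H →L[ℝ] H, IsSemigroupGeneratedBy S (-A) := ⟨S, hS⟩
  have h1 : expNeg A = hex.choose := by
    funext t
    rw [expNeg, dif_pos hex]
  rw [h1]
  exact ⟨hex.choose_spec, fun t ht => hex.choose_spec.unique hS hdiss hdense ht⟩

end Semigroups

/-! ### The strongly continuous semigroup of the bounded model and its generator. -/

section ModelSemigroup

variable {H : Type*} [NormedAddCommGroup H] [InnerProductSpace ℝ H] {n : ℕ} [CompleteSpace H]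

/-- The semigroup `e^{-t A(x)}` in terms of the bounded model. -/
def modelSemigroup (K : H →L[ℝ] H) (T : Fin n → H →L[ℝ] H) (x : Fin n → ℝ) (t : ℝ) : H →L[ℝ] H :=
  if 0 < t then limExp K T 0 (t • x) else ContinuousLinearMap.id ℝ H

namespace IsBoundedModel

variable {K : H →L[ℝ] H} {T : Fin n → H →L[ℝ] H} {l : Fin n → ℝ} (M : IsBoundedModel K T l)
include M

theorem norm_modelSemigroup_le {x : Fin n → ℝ} (hx : x ∈ posOrthant n) (t : ℝ) :
    ‖modelSemigroup K T x t‖ ≤ 1 := by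
  unfold modelSemigroup
  split_ifs with h
  · exact M.norm_limExp_zero_le_one (smul_mem_posOrthant hx h)
  · exact ContinuousLinearMap.norm_id_le

/-- On the range of K the convergence is linear in t; density of this range and contractivity extend
it to all of H. -/
theorem tendsto_modelSemigroup_zero {x : Fin n → ℝ} (hx : x ∈ posOrthant n) (u : H) :
    Tendsto (fun t => modelSemigroup K T x t u) (𝓝[>] 0) (𝓝 u) := by
  rw [Metric.tendsto_nhds]
  intro δ hδ
  obtain ⟨f, hf⟩ := (denseRange_of_injective M.K_pos.isSelfAdjoint M.K_inj).exists_dist_lt u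
    (show 0 < δ / 4 by positivity)
  have h1 : Tendsto (fun t : ℝ => 2 * ‖symbol T x‖ * t * ‖f‖) (𝓝[>] 0) (𝓝 0) := by
    have : Tendsto (fun t : ℝ => 2 * ‖symbol T x‖ * t * ‖f‖) (𝓝 0)
      (𝓝 (2 * ‖symbol T x‖ * 0 * ‖f‖)) := Continuous.tendsto (by fun_prop) _
    simpa using this.mono_left nhdsWithin_le_nhds
  filter_upwards [h1.eventually (gt_mem_nhds (show 0 < δ / 4 by positivity)), self_mem_nhdsWithin]
    with t ht ht0
  have ht0 : 0 < t := ht0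
  rw [dist_eq_norm] at hf ⊢
  set S := modelSemigroup K T x t with hS
  have hS' : S = limExp K T 0 (t • x) := by rw [hS, modelSemigroup, if_pos ht0]
  have h2 : S u - u = S (u - K f) - (u - K f) + (S * K - K) f := by
    simp only [map_sub, _root_.sub_apply, clm_mul_apply]
    abel
  have h3 : ‖(S * K - K) f‖ ≤ 2 * ‖symbol T x‖ * t * ‖f‖ := by
    refine (ContinuousLinearMap.le_opNorm _ _).trans ?_
    gcongr
    rw [hS']
    exact M.norm_limExp_zero_mul_sub_le hx ht0
  have h4 : ‖S (u - K f)‖ ≤ ‖u - K f‖ := by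
    refine (S.le_opNorm _).trans ?_
    exact mul_le_of_le_one_left (norm_nonneg _) (M.norm_modelSemigroup_le hx t)
  rw [h2]
  calc _ ≤ ‖S (u - K f)‖ + ‖u - K f‖ + ‖(S * K - K) f‖ :=
        (norm_add_le _ _).trans (by gcongr; exact norm_sub_le _ _)
    _ < δ := by linarith

theorem modelSemigroup_add {x : Fin n → ℝ} (hx : x ∈ posOrthant n) {s t : ℝ} (hs : 0 ≤ s) (ht : 0 ≤ t) :
    modelSemigroup K T x (s + t) = (modelSemigroup K T x s).comp (modelSemigroup K T x t) := by
  rcases hs.eq_or_lt with rfl | hs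
  · simp [modelSemigroup]
  rcases ht.eq_or_lt with rfl | ht
  · simp [modelSemigroup]
  · simp only [modelSemigroup, if_pos hs, if_pos ht, if_pos (add_pos hs ht)]
    rw [add_smul]
    exact (M.limExp_mul 0 0 (smul_mem_posOrthant hx hs) (smul_mem_posOrthant hx ht)).symm

theorem hasDerivAt_modelSemigroup {x : Fin n → ℝ} (hx : x ∈ posOrthant n) {t : ℝ} (ht : 0 < t)
    (f : H) : HasDerivAt (fun t => modelSemigroup K T x t (K f))
      (-(modelSemigroup K T x t (symbol T x f))) t := by
  have h1 := ((M.hasDerivAt_limExp_smul 0 hx ht).clm_apply (hasDerivAt_const t (K f)))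
  have hx' := smul_mem_posOrthant hx ht
  have h2 : (fun t => modelSemigroup K T x t (K f)) =ᶠ[𝓝 t] fun t => limExp K T 0 (t • x) (K f) := by
    filter_upwards [lt_mem_nhds ht] with s hs
    rw [modelSemigroup, if_pos hs]
  refine (h1.congr_of_eventuallyEq h2).congr_deriv ?_
  rw [modelSemigroup, if_pos ht, map_zero, add_zero, _root_.neg_apply, ← clm_mul_apply,
    ← clm_mul_apply, zero_add, mul_assoc, ← (M.commute_K_limExp 1 hx').eq, M.K_mul_limExp_succ 0 hx',
    (commute_symbol (fun i => (M.commute_T_limExp i 0 hx').symm) x).eq]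

theorem continuousOn_modelSemigroup {x : Fin n → ℝ} (hx : x ∈ posOrthant n) (u : H) :
    ContinuousOn (fun t => modelSemigroup K T x t u) (Ici 0) := by
  intro t ht
  rcases (mem_Ici.1 ht).eq_or_lt with rfl | ht
  · rw [← continuousWithinAt_Ioi_iff_Ici, ContinuousWithinAt]
    have : modelSemigroup K T x 0 u = u := by simp [modelSemigroup]
    rw [this]
    exact M.tendsto_modelSemigroup_zero hx u
  · have h1 : ContinuousAt (fun t : ℝ => limExp K T 0 (t • x) u) t :=
      ((M.hasDerivAt_limExp_smul 0 hx ht).continuousAt).clm_apply continuousAt_const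
    refine (h1.congr ?_).continuousWithinAt
    filter_upwards [lt_mem_nhds ht] with s hs
    rw [modelSemigroup, if_pos hs]

/-- P_x = c + P_{x-cl} ≥ c. Invertibility of P_x = A(x)A(l)⁻¹ is why all the A(x) behave alike on
the same domain D. -/
theorem isUnit_symbol {x : Fin n → ℝ} (hx : x ∈ posOrthant n) : IsUnit (symbol T x) := by
  obtain ⟨c, hc, hcx⟩ := exists_coercivity l hx
  refine isUnit_of_coercive hc fun u => ?_
  have h1 := (M.symbol_pos (x := x - c • l) fun i => by simpa using (hcx i).le).inner_nonneg_left u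
  rw [M.symbol_sub_eq x c, _root_.add_apply, inner_add_left]
  simp only [_root_.smul_apply, one_apply_eq_self, inner_smul_left,
    real_inner_self_eq_norm_sq]
  simpa using h1

theorem isSemigroupGeneratedBy_modelSemigroup {x : Fin n → ℝ} (hx : x ∈ posOrthant n)
    {B : H →ₗ.[ℝ] H} (hB : ∀ u v, (u, v) ∈ B.graph ↔ ∃ f, u = K f ∧ v = -(symbol T x f)) :
    IsSemigroupGeneratedBy (modelSemigroup K T x) B where
  map_zero := by simp [modelSemigroup]
  map_add s t hs ht := M.modelSemigroup_add hx hs ht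
  continuousOn u := M.continuousOn_modelSemigroup hx u
  generator := by
    have hfwd : ∀ f, Tendsto (fun h : ℝ => h⁻¹ • (modelSemigroup K T x h (K f) - K f)) (𝓝[>] 0)
        (𝓝 (-(symbol T x f))) := fun f => by
      -- The orbit is differentiable for t > 0 and its derivative has a limit at 0+, so that limit
      -- is the one-sided derivative at 0.
      have h1 : HasDerivWithinAt (fun t => modelSemigroup K T x t (K f)) (-(symbol T x f)) (Ici 0) 0 := by
        refine hasDerivWithinAt_Ici_of_tendsto_deriv (s := Ioi 0)
          (fun t ht => (M.hasDerivAt_modelSemigroup hx ht f).differentiableAt.differentiableWithinAt)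
          (((M.continuousOn_modelSemigroup hx (K f)) 0 (mem_Ici.2 le_rfl)).mono Ioi_subset_Ici_self)
          self_mem_nhdsWithin ?_
        refine ((M.tendsto_modelSemigroup_zero hx (symbol T x f)).neg).congr' ?_
        filter_upwards [self_mem_nhdsWithin] with t ht
        exact (M.hasDerivAt_modelSemigroup hx ht f).deriv.symm
      rw [← hasDerivWithinAt_Ioi_iff_Ici, hasDerivWithinAt_iff_tendsto_slope' (by simp)] at h1
      refine h1.congr fun s => ?_
      simp [slope, modelSemigroup]
    intro u v
    rw [hB]
    constructor
    · rintro ⟨f, rfl, rfl⟩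
      exact hfwd f
    · intro h
      -- The generator has no larger domain: applying K to the difference quotient of u gives Kv =
      -- -P_x u, and inverting P_x, which commutes with K, puts u in the range of K.
      have h1 : Tendsto (fun h : ℝ => h⁻¹ • (modelSemigroup K T x h (K u) - K u)) (𝓝[>] 0)
          (𝓝 (K v)) := by
        refine ((K.continuous.tendsto v).comp h).congr' ?_
        filter_upwards [self_mem_nhdsWithin] with t ht
        have ht : 0 < t := ht
        simp only [modelSemigroup, if_pos ht, Function.comp_apply, map_smul, map_sub]
        rw [← clm_mul_apply K, (M.commute_K_limExp 0 (smul_mem_posOrthant hx ht)).eq, clm_mul_apply]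
      have h2 := tendsto_nhds_unique h1 (hfwd u)
      obtain ⟨P, hP⟩ := M.isUnit_symbol hx
      have hc : Commute K (↑P⁻¹ : H →L[ℝ] H) := by
        have := M.commute_K_symbol x
        rw [← hP] at this
        exact this.units_inv_right
      have h3 : symbol T x u = -(K v) := by rw [h2, neg_neg]
      have h4 : ∀ z, (↑P⁻¹ : H →L[ℝ] H) (symbol T x z) = z := fun z => by
        rw [← hP, ← clm_mul_apply, Units.inv_mul]; rfl
      have h5 : ∀ z, symbol T x ((↑P⁻¹ : H →L[ℝ] H) z) = z := fun z => by
        rw [← hP, ← clm_mul_apply, Units.mul_inv]; rfl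
      refine ⟨-((↑P⁻¹ : H →L[ℝ] H) v), ?_, ?_⟩
      · rw [map_neg, ← clm_mul_apply K, hc.eq, clm_mul_apply, ← map_neg, ← h3, h4]
      · rw [map_neg, h5, neg_neg]

end IsBoundedModel

end ModelSemigroup

/-! ### Reduction of the unbounded operators to the bounded model. -/

section Reduction

variable {H : Type*} [NormedAddCommGroup H] [InnerProductSpace ℝ H] {n : ℕ}

theorem opSum_apply (A : Fin n → H →ₗ.[ℝ] H) (l : Fin n → ℝ) (u : (opSum A l).domain) :
    opSum A l u = ∑ i, l i • A i ⟨u, commonDomain_le A i u.2⟩ := by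
  exact LinearMap.sum_apply (R := ℝ) (M := commonDomain A) Finset.univ
    (fun i => l i • (A i).toFun.comp (Submodule.inclusion (commonDomain_le A i))) u

theorem appl_of_mem {A : H →ₗ.[ℝ] H} {x : H} (h : x ∈ A.domain) : appl A x = A ⟨x, h⟩ := dif_pos h

/-- For n = 0 the sum is the zero operator and has no coercivity; hence the condition on n. -/
theorem exists_coercive_opSum {A : Fin n → H →ₗ.[ℝ] H} (hpos : ∀ i, IsStrictlyPositive (A i))
    (hn : 0 < n) {l : Fin n → ℝ} (hl : l ∈ posOrthant n) :
    ∃ m : ℝ, 0 < m ∧ ∀ u : (opSum A l).domain, m * ‖(u : H)‖ ^ 2 ≤ inner ℝ (opSum A l u) (u : H) := by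
  choose Λ hΛ hA using hpos
  have : Nonempty (Fin n) := ⟨⟨0, hn⟩⟩
  refine ⟨∑ i, l i * Λ i, Finset.sum_pos (fun i _ => mul_pos (hl i) (hΛ i)) Finset.univ_nonempty, ?_⟩
  intro u
  rw [opSum_apply, sum_inner, Finset.sum_mul]
  refine Finset.sum_le_sum fun i _ => ?_
  rw [real_inner_smul_left, mul_assoc]
  exact mul_le_mul_of_nonneg_left (hA i ⟨u, commonDomain_le A i u.2⟩) (hl i).le

/-- `K`, `T` represent the operators `A`: `D = range K` and `A_i K = T_i`. -/
structure Represents (A : Fin n → H →ₗ.[ℝ] H) (K : H →L[ℝ] H) (T : Fin n → H →L[ℝ] H) : Prop where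
  mem_iff : ∀ u, u ∈ commonDomain A ↔ ∃ f, u = K f
  apply_eq : ∀ i f (h : K f ∈ (A i).domain), A i ⟨K f, h⟩ = T i f

namespace Represents

variable {A : Fin n → H →ₗ.[ℝ] H} {K : H →L[ℝ] H} {T : Fin n → H →L[ℝ] H} (R : Represents A K T)
include R

theorem mem (f : H) : K f ∈ commonDomain A := (R.mem_iff _).2 ⟨f, rfl⟩

theorem appl_eq (i : Fin n) (f : H) : appl (A i) (K f) = T i f := by
  rw [appl_of_mem (commonDomain_le A i (R.mem f)), R.apply_eq]

theorem opSum_eq (x : Fin n → ℝ) (f : H) : opSum A x ⟨K f, R.mem f⟩ = symbol T x f := by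
  rw [opSum_apply, symbol_apply, _root_.sum_apply]
  refine Finset.sum_congr rfl fun i _ => ?_
  rw [R.apply_eq, _root_.smul_apply]

theorem mem_graph_iff (x : Fin n → ℝ) (u v : H) :
    (u, v) ∈ (opSum A x).graph ↔ ∃ f, u = K f ∧ v = symbol T x f := by
  rw [LinearPMap.mem_graph_iff]
  constructor
  · rintro ⟨⟨w, hw⟩, hw1, hw2⟩
    simp only at hw1 hw2
    subst hw1
    obtain ⟨f, rfl⟩ := (R.mem_iff w).1 hw
    exact ⟨f, rfl, by rw [← hw2, R.opSum_eq]⟩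
  · rintro ⟨f, rfl, rfl⟩
    exact ⟨⟨K f, R.mem f⟩, rfl, R.opSum_eq x f⟩

theorem mem_neg_graph_iff (x : Fin n → ℝ) (u v : H) :
    (u, v) ∈ (-opSum A x).graph ↔ ∃ f, u = K f ∧ v = -(symbol T x f) := by
  have h : (u, v) ∈ (-opSum A x).graph ↔ (u, -v) ∈ (opSum A x).graph := by
    simp only [LinearPMap.mem_graph_iff]
    constructor
    · rintro ⟨w, hw1, hw2⟩
      refine ⟨w, hw1, ?_⟩
      simp only [LinearPMap.neg_apply] at hw2 ⊢
      rw [← hw2, neg_neg]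
    · rintro ⟨w, hw1, hw2⟩
      refine ⟨w, hw1, ?_⟩
      simp only [LinearPMap.neg_apply] at hw2 ⊢
      rw [hw2, neg_neg]
  rw [h, R.mem_graph_iff]
  simp only [neg_eq_iff_eq_neg]

end Represents

variable [CompleteSpace H]

theorem isFormalAdjoint_of_isSelfAdjoint {B : H →ₗ.[ℝ] H} (hB : IsSelfAdjoint B) (u v : B.domain) :
    inner ℝ (B u) (v : H) = inner ℝ (u : H) (B v) := by
  have h := LinearPMap.adjoint_isFormalAdjoint hB.dense_domain
  rw [LinearPMap.isSelfAdjoint_def.1 hB] at h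
  exact h u v

/-- The lower bound and the closed graph make the range closed; a vector orthogonal to the range
lies in the kernel of B* = B, which the lower bound makes trivial. -/
theorem surjective_of_isSelfAdjoint {B : H →ₗ.[ℝ] H} (hB : IsSelfAdjoint B) {m : ℝ} (hm : 0 < m)
    (hBm : ∀ u : B.domain, m * ‖(u : H)‖ ≤ ‖B u‖) : Function.Surjective B := by
  have hcl : IsClosed (B.graph : Set (H × H)) := hB.isClosed
  have : CompleteSpace B.graph := hcl.completeSpace_coe
  set φ : B.graph →L[ℝ] H := (ContinuousLinearMap.snd ℝ H H).comp B.graph.subtypeL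
  have hanti : AntilipschitzWith (Real.toNNReal (max m⁻¹ 1)) φ := by
    refine φ.antilipschitz_of_bound fun p => ?_
    obtain ⟨⟨x, y⟩, hp⟩ := p
    obtain ⟨u, hu1, hu2⟩ := (LinearPMap.mem_graph_iff B).1 hp
    simp only at hu1 hu2
    have h1 : m * ‖x‖ ≤ ‖y‖ := by rw [← hu1, ← hu2]; exact hBm u
    have h2 : φ ⟨(x, y), hp⟩ = y := rfl
    rw [h2, Real.coe_toNNReal _ (le_max_of_le_right zero_le_one)]
    change max ‖x‖ ‖y‖ ≤ _
    refine max_le ?_ ?_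
    · calc ‖x‖ ≤ m⁻¹ * ‖y‖ := by rw [inv_mul_eq_div, le_div_iff₀ hm, mul_comm]; exact h1
        _ ≤ _ := by gcongr; exact le_max_left _ _
    · calc ‖y‖ = 1 * ‖y‖ := (one_mul _).symm
        _ ≤ _ := by gcongr; exact le_max_right _ _
  have hrc : IsClosed (φ.range : Set H) := by
    have := hanti.isClosed_range φ.uniformContinuous
    exact this
  have hperp : φ.rangeᗮ = ⊥ := by
    rw [Submodule.eq_bot_iff]
    intro z hz
    have h0 : ∀ u : B.domain, inner ℝ (0 : H) (u : H) = inner ℝ z (B u) := fun u => by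
      rw [inner_zero_left, real_inner_comm]
      exact (hz (B u) ⟨⟨((u : H), B u), B.mem_graph u⟩, rfl⟩).symm
    have hz1 := B.mem_adjoint_domain_of_exists z ⟨0, h0⟩
    have hz2 := LinearPMap.adjoint_apply_eq hB.dense_domain ⟨z, hz1⟩ h0
    have hgr : (z, (0 : H)) ∈ B.graph := by
      have h3 := B.adjoint.mem_graph ⟨z, hz1⟩
      rw [hz2] at h3
      have h4 : B.adjoint.graph = B.graph := by rw [LinearPMap.isSelfAdjoint_def.1 hB]
      rwa [h4] at h3
    obtain ⟨u, hu1, hu2⟩ := (LinearPMap.mem_graph_iff B).1 hgr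
    simp only at hu1 hu2
    have := hBm u
    rw [hu1, hu2, norm_zero] at this
    have h4 : ‖z‖ ≤ 0 := by
      by_contra hcon
      push Not at hcon
      nlinarith
    exact norm_le_zero_iff.1 h4
  have : CompleteSpace φ.range := hrc.completeSpace_coe
  have htop : φ.range = ⊤ := Submodule.orthogonal_eq_bot_iff.1 hperp
  intro f
  have hf : f ∈ φ.range := by rw [htop]; trivial
  obtain ⟨⟨⟨x, y⟩, hp⟩, hy⟩ := hf
  obtain ⟨u, -, hu2⟩ := (LinearPMap.mem_graph_iff B).1 hp
  exact ⟨u, hu2.trans hy⟩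

/-- Every commutation relation is a symmetry of a product: symmetry of A_i gives that of K T_i, and
the weak commutation hypothesis on D gives that of T_i and T_i T_j. -/
theorem exists_boundedModel {A : Fin n → H →ₗ.[ℝ] H} (hsa : ∀ i, IsSelfAdjoint (A i))
    (hpos : ∀ i, IsStrictlyPositive (A i)) (hcomm : MutuallyCommuting A) (hn : 0 < n)
    {l : Fin n → ℝ} (hl : l ∈ posOrthant n) (hB : IsSelfAdjoint (opSum A l)) :
    ∃ (K : H →L[ℝ] H) (T : Fin n → H →L[ℝ] H), IsBoundedModel K T l ∧ Represents A K T := by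
  obtain ⟨m, hm, hBm⟩ := exists_coercive_opSum hpos hn hl
  set B := opSum A l with hBdef
  have hbd : ∀ u : B.domain, m * ‖(u : H)‖ ≤ ‖B u‖ := fun u => by
    have h1 := (hBm u).trans (real_inner_le_norm _ _)
    by_cases h0 : ‖(u : H)‖ = 0
    · rw [h0, mul_zero]; positivity
    · have h5 : 0 < ‖(u : H)‖ := lt_of_le_of_ne (norm_nonneg _) (Ne.symm h0)
      nlinarith
  have hsurj := surjective_of_isSelfAdjoint hB hm hbd
  have hinj : Function.Injective B.toFun := by
    rw [← LinearMap.ker_eq_bot, LinearMap.ker_eq_bot']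
    intro u hu
    have h1 := hbd u
    have h2 : B u = 0 := hu
    rw [h2, norm_zero] at h1
    have h3 : ‖(u : H)‖ ≤ 0 := by
      by_contra hcon
      push Not at hcon
      nlinarith
    exact Subtype.ext (norm_le_zero_iff.1 h3)
  let e : B.domain ≃ₗ[ℝ] H := LinearEquiv.ofBijective B.toFun ⟨hinj, hsurj⟩
  have he : ∀ u : B.domain, e u = B u := fun u => rfl
  have heB : ∀ f, B (e.symm f) = f := fun f => by rw [← he, e.apply_symm_apply]
  let K₀ : H →ₗ[ℝ] H := B.domain.subtype ∘ₗ e.symm.toLinearMap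
  let T₀ : Fin n → H →ₗ[ℝ] H := fun i =>
    (A i).toFun ∘ₗ Submodule.inclusion (commonDomain_le A i) ∘ₗ e.symm.toLinearMap
  have hK₀ : ∀ f, K₀ f = (e.symm f : H) := fun f => rfl
  have hmem : ∀ f, K₀ f ∈ commonDomain A := fun f => (e.symm f).2
  have hT₀ : ∀ i f, T₀ i f = A i ⟨K₀ f, commonDomain_le A i (hmem f)⟩ := fun i f => rfl
  have hsum : ∀ f, ∑ i, l i • T₀ i f = f := fun f => by
    have h := heB f
    rw [opSum_apply] at h
    exact h
  have hTK : ∀ i f g, inner ℝ (T₀ i f) (K₀ g) = inner ℝ (K₀ f) (T₀ i g) := fun i f g => by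
    rw [hT₀, hT₀]
    exact isFormalAdjoint_of_isSelfAdjoint (hsa i) ⟨K₀ f, _⟩ ⟨K₀ g, _⟩
  have hTT : ∀ i j f g, inner ℝ (T₀ i f) (T₀ j g) = inner ℝ (T₀ j f) (T₀ i g) := fun i j f g => by
    rw [hT₀, hT₀, hT₀, hT₀]
    exact hcomm i j _ _ (hmem f) (hmem g)
  have hKsym : K₀.IsSymmetric := fun f g => by
    have := isFormalAdjoint_of_isSelfAdjoint hB (e.symm f) (e.symm g)
    rw [heB, heB] at this
    exact this.symm
  -- Insert Σ l_j T_j = 1 in the free slot on each side; the terms then match by ⟨T_i f, T_j g⟩ =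
  -- ⟨T_j f, T_i g⟩.
  have hTsym : ∀ i, (T₀ i).IsSymmetric := fun i f g => by
    conv_lhs => rw [← hsum g]
    conv_rhs => rw [← hsum f]
    simp only [inner_sum, sum_inner, real_inner_smul_left, real_inner_smul_right]
    refine Finset.sum_congr rfl fun j _ => ?_
    rw [hTT]
  -- Boundedness is the Hellinger–Toeplitz theorem: an everywhere defined symmetric operator is
  -- continuous.
  let K : H →L[ℝ] H := ⟨K₀, hKsym.continuous⟩
  let T : Fin n → H →L[ℝ] H := fun i => ⟨T₀ i, (hTsym i).continuous⟩
  have hKsa : IsSelfAdjoint K := isSelfAdjoint_of_inner hKsym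
  have hTsa : ∀ i, IsSelfAdjoint (T i) := fun i => isSelfAdjoint_of_inner (hTsym i)
  have hKTsa : ∀ i, IsSelfAdjoint (K * T i) := fun i => isSelfAdjoint_of_inner fun f g => by
    change inner ℝ (K₀ (T₀ i f)) g = inner ℝ f (K₀ (T₀ i g))
    rw [hKsym, hTK, ← hKsym f]
  have hTTsa : ∀ i j, IsSelfAdjoint (T i * T j) := fun i j => isSelfAdjoint_of_inner fun f g => by
    change inner ℝ (T₀ i (T₀ j f)) g = inner ℝ f (T₀ i (T₀ j g))
    rw [hTsym i, hTT, ← hTsym i f]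
  refine ⟨K, T, ⟨?_, ?_, hTsa, fun i j => ((hTsa i).commute_iff (hTsa j)).2 (hTTsa i j),
    fun i => (hKsa.commute_iff (hTsa i)).2 (hKTsa i), ?_, hl, ?_⟩, ⟨?_, ?_⟩⟩
  · rw [ContinuousLinearMap.isPositive_iff']
    refine ⟨hKsa, fun f => ?_⟩
    have h1 := hBm (e.symm f)
    rw [heB, real_inner_comm] at h1
    exact le_trans (by positivity) h1
  · intro f g hfg
    exact e.symm.injective (Subtype.ext hfg)
  · intro i f
    obtain ⟨c, hc, hci⟩ := hpos i
    exact le_trans (by positivity) (hci ⟨K₀ f, commonDomain_le A i (hmem f)⟩)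
  · ext f
    rw [symbol_apply, _root_.sum_apply]
    exact hsum f
  · intro u
    constructor
    · intro hu
      refine ⟨B ⟨u, hu⟩, ?_⟩
      change u = ((e.symm (e ⟨u, hu⟩) : B.domain) : H)
      rw [e.symm_apply_apply]
    · rintro ⟨f, rfl⟩
      exact hmem f
  · intro i f h
    rfl

namespace Represents

variable {A : Fin n → H →ₗ.[ℝ] H} {K : H →L[ℝ] H} {T : Fin n → H →L[ℝ] H} (R : Represents A K T)
variable {l : Fin n → ℝ} (M : IsBoundedModel K T l)
include R M

theorem dense_commonDomain : Dense (commonDomain A : Set H) := by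
  have h1 := denseRange_of_injective M.K_pos.isSelfAdjoint M.K_inj
  refine h1.mono ?_
  rintro _ ⟨f, rfl⟩
  exact R.mem f

/-- If z is in the domain of the adjoint with image w, testing against K f gives Kw = P_x z, so z =
K P_x⁻¹ w lies in D. -/
theorem isSelfAdjoint_opSum {x : Fin n → ℝ} (hx : x ∈ posOrthant n) :
    IsSelfAdjoint (opSum A x) := by
  have hd : Dense ((opSum A x).domain : Set H) := R.dense_commonDomain M
  have hform : (opSum A x).IsFormalAdjoint (opSum A x) := by
    rintro ⟨u, hu⟩ ⟨v, hv⟩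
    obtain ⟨f, rfl⟩ := (R.mem_iff u).1 hu
    obtain ⟨g, rfl⟩ := (R.mem_iff v).1 hv
    change inner ℝ (opSum A x ⟨K f, _⟩) (K g) = inner ℝ (K f) (opSum A x ⟨K g, _⟩)
    rw [R.opSum_eq, R.opSum_eq, ← sa_inner M.K_pos.isSelfAdjoint, ← clm_mul_apply,
      (M.commute_K_symbol x).eq, clm_mul_apply, sa_inner (M.symbol_sa x)]
  have hle := hform.le_adjoint hd
  rw [LinearPMap.isSelfAdjoint_def]
  refine (LinearPMap.eq_of_le_of_domain_eq hle (le_antisymm hle.1 ?_)).symm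
  intro z hz
  set w := (opSum A x).adjoint ⟨z, hz⟩ with hw
  have h1 : ∀ f, inner ℝ w (K f) = inner ℝ z (symbol T x f) := fun f => by
    have := LinearPMap.adjoint_isFormalAdjoint hd ⟨z, hz⟩ ⟨K f, R.mem f⟩
    rwa [R.opSum_eq] at this
  have h2 : K w = symbol T x z := by
    refine ext_inner_right ℝ fun f => ?_
    rw [sa_inner M.K_pos.isSelfAdjoint, h1, sa_inner (M.symbol_sa x)]
  obtain ⟨P, hP⟩ := M.isUnit_symbol hx
  have hc : Commute K (↑P⁻¹ : H →L[ℝ] H) := by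
    have := M.commute_K_symbol x
    rw [← hP] at this
    exact this.units_inv_right
  refine (R.mem_iff z).2 ⟨(↑P⁻¹ : H →L[ℝ] H) w, ?_⟩
  rw [← clm_mul_apply, hc.eq, clm_mul_apply, h2, ← hP, ← clm_mul_apply, Units.inv_mul]
  rfl

theorem expNeg_opSum {x : Fin n → ℝ} (hx : x ∈ posOrthant n) :
    IsSemigroupGeneratedBy (expNeg (opSum A x)) (-(opSum A x)) ∧
      ∀ t, 0 ≤ t → expNeg (opSum A x) t = modelSemigroup K T x t := by
  refine expNeg_eq (M.isSemigroupGeneratedBy_modelSemigroup hx (R.mem_neg_graph_iff x)) ?_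
    (R.dense_commonDomain M)
  intro u v huv
  obtain ⟨f, rfl, rfl⟩ := (R.mem_neg_graph_iff x u v).1 huv
  rw [inner_neg_left, symbol_apply]
  simp only [_root_.sum_apply, _root_.smul_apply, sum_inner, real_inner_smul_left]
  exact neg_nonpos.2 (Finset.sum_nonneg fun i _ => mul_nonneg (hx i).le (M.KT_nonneg i f))

theorem expNeg_opSum_apply {x : Fin n → ℝ} (hx : x ∈ posOrthant n) {t : ℝ} (ht : 0 < t) :
    expNeg (opSum A x) t = limExp K T 0 (t • x) := by
  rw [(R.expNeg_opSum M hx).2 t ht.le, modelSemigroup, if_pos ht]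

theorem expNeg_opSum_eq_K {x : Fin n → ℝ} (hx : x ∈ posOrthant n) {t : ℝ} (ht : 0 < t) (u : H) :
    expNeg (opSum A x) t u = K (limExp K T 1 (t • x) u) := by
  rw [R.expNeg_opSum_apply M hx ht, ← M.K_mul_limExp_succ 0 (smul_mem_posOrthant hx ht)]
  rfl

end Represents

end Reduction

/-! ### Euler's Gamma integral along rotated rays. -/

section GammaRotation

theorem integrableOn_rpow_mul_exp_neg {s c : ℝ} (hs : 0 < s) (hc : 0 < c) :
    IntegrableOn (fun ρ : ℝ => ρ ^ (s - 1) * Real.exp (-(c * ρ))) (Ioi 0) := by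
  have := integrableOn_rpow_mul_exp_neg_mul_rpow (p := 1) (s := s - 1) (b := c) (by linarith) one_pos hc
  simpa only [Real.rpow_one, neg_mul] using this

theorem norm_cpow_mul_cexp_neg {a w : ℂ} {ρ : ℝ} (hρ : 0 < ρ) :
    ‖(ρ : ℂ) ^ (a - 1) * Complex.exp (-(w * ρ))‖ = ρ ^ (a.re - 1) * Real.exp (-(w.re * ρ)) := by
  rw [norm_mul, Complex.norm_cpow_eq_rpow_re_of_pos hρ, Complex.norm_exp]
  simp

theorem measurable_cpow_mul_cexp_neg (a w : ℂ) :
    Measurable fun ρ : ℝ => (ρ : ℂ) ^ (a - 1) * Complex.exp (-(w * ρ)) := by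
  fun_prop

theorem integrableOn_cpow_mul_cexp_neg {a w : ℂ} (ha : 0 < a.re) (hw : 0 < w.re) :
    IntegrableOn (fun ρ : ℝ => (ρ : ℂ) ^ (a - 1) * Complex.exp (-(w * ρ))) (Ioi 0) := by
  refine (integrableOn_rpow_mul_exp_neg ha hw).mono'
    (measurable_cpow_mul_cexp_neg a w).aestronglyMeasurable ?_
  filter_upwards [ae_restrict_mem measurableSet_Ioi] with ρ hρ
  exact (norm_cpow_mul_cexp_neg hρ).le

/-- Euler's integral along a rotated ray: `∫ ρ^(a-1) e^(-wρ) dρ = Γ(a) w^(-a)` for `Re w > 0`. -/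
theorem integral_cpow_mul_cexp_neg {a w : ℂ} (ha : 0 < a.re) (hw : 0 < w.re) :
    ∫ ρ in Ioi (0 : ℝ), (ρ : ℂ) ^ (a - 1) * Complex.exp (-(w * ρ)) = Complex.Gamma a * w ^ (-a) := by
  set U : Set ℂ := {w | 0 < w.re} with hU
  have hUo : IsOpen U := isOpen_lt continuous_const Complex.continuous_re
  have hUc : IsPreconnected U := (convex_halfSpace_re_gt 0).isPreconnected
  have hF : AnalyticOnNhd ℂ (fun w : ℂ => ∫ ρ in Ioi (0 : ℝ), (ρ : ℂ) ^ (a - 1) *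
      Complex.exp (-(w * ρ))) U := by
    refine DifferentiableOn.analyticOnNhd (fun w₀ hw₀ => ?_) hUo
    have hw₀ : 0 < w₀.re := hw₀
    have hs : {w : ℂ | w₀.re / 2 < w.re} ∈ 𝓝 w₀ :=
      (isOpen_lt continuous_const Complex.continuous_re).mem_nhds (by
        change w₀.re / 2 < w₀.re; linarith)
    have key := hasDerivAt_integral_of_dominated_loc_of_deriv_le (μ := volume.restrict (Ioi (0 : ℝ)))
      (F := fun (w : ℂ) (ρ : ℝ) => (ρ : ℂ) ^ (a - 1) * Complex.exp (-(w * ρ)))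
      (F' := fun (w : ℂ) (ρ : ℝ) => (ρ : ℂ) ^ (a - 1) * (Complex.exp (-(w * ρ)) * (-ρ)))
      (bound := fun ρ => ρ ^ ((a.re + 1) - 1) * Real.exp (-(w₀.re / 2 * ρ))) hs
      (Eventually.of_forall fun w => (measurable_cpow_mul_cexp_neg a w).aestronglyMeasurable)
      (integrableOn_cpow_mul_cexp_neg ha hw₀)
      (Measurable.aestronglyMeasurable (by fun_prop)) ?_
      (integrableOn_rpow_mul_exp_neg (by linarith) (by linarith)) ?_
    · exact key.2.differentiableAt.differentiableWithinAt
    · filter_upwards [ae_restrict_mem measurableSet_Ioi] with ρ hρ w hw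
      have hρ : 0 < ρ := hρ
      have hw : w₀.re / 2 < w.re := hw
      rw [← mul_assoc, norm_mul, norm_cpow_mul_cexp_neg hρ, norm_neg, Complex.norm_real,
        Real.norm_of_nonneg hρ.le, mul_right_comm, ← Real.rpow_add_one hρ.ne']
      have : a.re - 1 + 1 = a.re + 1 - 1 := by ring
      rw [this]
      gcongr
    · filter_upwards with ρ w _
      have h1 : HasDerivAt (fun w : ℂ => -(w * ρ)) (-(ρ : ℂ)) w := by
        exact ((hasDerivAt_id w).mul_const (ρ : ℂ)).neg.congr_deriv (by simp)
      exact h1.cexp.const_mul _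
  have hG : AnalyticOnNhd ℂ (fun w : ℂ => Complex.Gamma a * w ^ (-a)) U := by
    refine DifferentiableOn.analyticOnNhd (fun w hw => ?_) hUo
    have hw : w ∈ Complex.slitPlane := Or.inl hw
    exact ((differentiableAt_id.cpow_const hw).const_mul _).differentiableWithinAt
  have hreal : ∀ r : ℝ, 0 < r → ∫ ρ in Ioi (0 : ℝ), (ρ : ℂ) ^ (a - 1) * Complex.exp (-((r : ℂ) * ρ)) =
      Complex.Gamma a * (r : ℂ) ^ (-a) := fun r hr => by
    rw [Complex.integral_cpow_mul_exp_neg_mul_Ioi ha hr, mul_comm, one_div,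
      Complex.inv_cpow _ _ (by rw [Complex.arg_ofReal_of_nonneg hr.le]; exact Real.pi_pos.ne),
      Complex.cpow_neg]
  -- Identity theorem: both sides are analytic in w on the right half-plane and agree on the
  -- positive reals, which accumulate at 1.
  have hfreq : ∃ᶠ w in 𝓝[≠] (1 : ℂ), ∫ ρ in Ioi (0 : ℝ), (ρ : ℂ) ^ (a - 1) *
      Complex.exp (-(w * ρ)) = Complex.Gamma a * w ^ (-a) := by
    have ht : Tendsto (fun r : ℝ => (r : ℂ)) (𝓝[≠] 1) (𝓝[≠] 1) := by
      refine tendsto_nhdsWithin_iff.2 ⟨?_, ?_⟩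
      · have := (Complex.continuous_ofReal.tendsto 1).mono_left (nhdsWithin_le_nhds (s := {1}ᶜ))
        simpa using this
      · filter_upwards [self_mem_nhdsWithin] with r hr
        simpa using hr
    refine ht.frequently (Eventually.frequently ?_)
    filter_upwards [nhdsWithin_le_nhds (lt_mem_nhds (zero_lt_one' ℝ))] with r hr
    exact hreal r hr
  exact hF.eqOn_of_preconnected_of_frequently_eq hG hUc (by simp [hU]) hfreq hw

end GammaRotation

/-! ### The integral representation of Φ_α. -/

section WrightKernel

/-- The angle `π α / (1 + α)` of the ray in the integral representation of `Φ_α`. -/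
def rayAngle (α : ℝ) : ℝ := Real.pi * α / (1 + α)

/-- The direction `e^{iπα/(1+α)}`. -/
def rayDir (α : ℝ) : ℂ := Complex.exp (rayAngle α * Complex.I)

/-- The integrand of the integral representation of `Φ_α`. -/
def wrightKernel (α z ρ : ℝ) : ℂ :=
  rayDir α * ((ρ : ℂ) ^ ((α : ℂ) - 1) * Complex.exp (-((starRingEnd ℂ) (rayDir α) * ρ))) *
    Complex.exp (-(z * (rayDir α * (ρ : ℂ) ^ (α : ℂ))))

/-- The complex integral whose imaginary part is `π Φ_α`. -/
def wrightInt (α z : ℝ) : ℂ := ∫ ρ in Ioi (0 : ℝ), wrightKernel α z ρ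

variable {α : ℝ}

theorem rayAngle_pos (hα : 0 < α) : 0 < rayAngle α := by
  unfold rayAngle; have := Real.pi_pos; positivity

theorem rayAngle_lt (hα : 0 < α) (hα1 : α < 1) : rayAngle α < Real.pi / 2 := by
  unfold rayAngle
  rw [div_lt_div_iff₀ (by linarith) two_pos]
  nlinarith [Real.pi_pos]

theorem rayDir_re : (rayDir α).re = Real.cos (rayAngle α) := by
  rw [rayDir, Complex.exp_ofReal_mul_I_re]

theorem cos_rayAngle_pos (hα : 0 < α) (hα1 : α < 1) : 0 < Real.cos (rayAngle α) :=
  Real.cos_pos_of_mem_Ioo ⟨by linarith [rayAngle_pos hα, Real.pi_pos], rayAngle_lt hα hα1⟩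

theorem norm_rayDir : ‖rayDir α‖ = 1 := Complex.norm_exp_ofReal_mul_I _

theorem conj_rayDir_re : ((starRingEnd ℂ) (rayDir α)).re = Real.cos (rayAngle α) := by
  rw [Complex.conj_re, rayDir_re]

theorem rayDir_cpow (hα : 0 < α) (hα1 : α < 1) (s : ℂ) :
    rayDir α ^ s = Complex.exp (rayAngle α * Complex.I * s) := by
  have h1 := rayAngle_pos hα
  have h2 := rayAngle_lt hα hα1
  rw [rayDir, Complex.cpow_def_of_ne_zero (Complex.exp_ne_zero _), Complex.log_exp]
  · simp; linarith [Real.pi_pos]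
  · simp; linarith [Real.pi_pos]

theorem conj_rayDir : (starRingEnd ℂ) (rayDir α) = Complex.exp (-(rayAngle α * Complex.I)) := by
  rw [rayDir, ← Complex.exp_conj]
  simp

theorem conj_rayDir_cpow (hα : 0 < α) (hα1 : α < 1) (s : ℂ) :
    (starRingEnd ℂ) (rayDir α) ^ s = Complex.exp (-(rayAngle α * Complex.I) * s) := by
  have h1 := rayAngle_pos hα
  have h2 := rayAngle_lt hα hα1
  rw [conj_rayDir, Complex.cpow_def_of_ne_zero (Complex.exp_ne_zero _), Complex.log_exp]
  · simp; linarith [Real.pi_pos]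
  · simp; linarith [Real.pi_pos]

/-- The angle θ = πα/(1+α) is chosen so that (1+α)θ = πα, the phase in the reflection formula, while
θ < π/2 keeps both exponentials of the kernel decaying for z ≥ 0. -/
theorem rayDir_cpow_mul (hα : 0 < α) (hα1 : α < 1) (s : ℂ) :
    rayDir α ^ s * (starRingEnd ℂ) (rayDir α) ^ (-(α * s)) = Complex.exp (Real.pi * α * s * Complex.I) := by
  rw [rayDir_cpow hα hα1, conj_rayDir_cpow hα hα1, ← Complex.exp_add]
  congr 1
  have : ((1 : ℂ) + α) ≠ 0 := by
    have : (1 + α : ℝ) ≠ 0 := by positivity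
    exact_mod_cast this
  unfold rayAngle
  push_cast
  field_simp

theorem norm_wrightKernel {z ρ : ℝ} (hρ : 0 < ρ) : ‖wrightKernel α z ρ‖ =
    ρ ^ (α - 1) * Real.exp (-(Real.cos (rayAngle α) * ρ)) *
      Real.exp (-(z * (Real.cos (rayAngle α) * ρ ^ α))) := by
  rw [wrightKernel, norm_mul, norm_mul, norm_rayDir, one_mul, norm_cpow_mul_cexp_neg hρ,
    conj_rayDir_re, Complex.norm_exp, Complex.ofReal_re, ← Complex.ofReal_cpow hρ.le]
  congr 2
  simp [rayDir_re]

theorem measurable_wrightKernel : Measurable fun p : ℝ × ℝ => wrightKernel α p.1 p.2 := by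
  unfold wrightKernel
  fun_prop

/-- Sublinear growth lets e^{-cρ} beat e^{|z|ρ^α}, which dominates the power series of the kernel.
The threshold R solves R^{α-1} = δ. -/
theorem rpow_le_mul_add (hα : 0 < α) (hα1 : α < 1) {δ : ℝ} (hδ : 0 < δ) :
    ∃ C : ℝ, ∀ ρ : ℝ, 0 < ρ → ρ ^ α ≤ δ * ρ + C := by
  set R : ℝ := δ ^ (-(1 - α)⁻¹)
  have hR : 0 < R := Real.rpow_pos_of_pos hδ _
  refine ⟨R ^ α, fun ρ hρ => ?_⟩
  rcases le_total ρ R with h | h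
  · have := Real.rpow_le_rpow hρ.le h hα.le
    have : 0 < δ * ρ := by positivity
    linarith
  · have h1 : ρ ^ α = ρ ^ (α - 1) * ρ := by
      rw [← Real.rpow_add_one hρ.ne']; congr 1; ring
    have h2 : ρ ^ (α - 1) ≤ R ^ (α - 1) := Real.rpow_le_rpow_of_nonpos hR h (by linarith)
    have h3 : R ^ (α - 1) = δ := by
      rw [← Real.rpow_mul hδ.le]
      have : -(1 - α)⁻¹ * (α - 1) = 1 := by
        have : (1 - α) ≠ 0 := by linarith
        field_simp
        ring
      rw [this, Real.rpow_one]
    rw [h3] at h2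
    rw [h1]
    have : 0 < R ^ α := Real.rpow_pos_of_pos hR _
    nlinarith

theorem integrableOn_rpow_mul_exp_mul_exp (hα : 0 < α) (hα1 : α < 1) (z : ℝ) {c : ℝ} (hc : 0 < c) :
    IntegrableOn (fun ρ : ℝ => ρ ^ (α - 1) * Real.exp (-(c * ρ)) * Real.exp (|z| * ρ ^ α)) (Ioi 0) := by
  obtain ⟨C, hC⟩ := rpow_le_mul_add hα hα1 (δ := c / (2 * (|z| + 1))) (by positivity)
  have h1 := (integrableOn_rpow_mul_exp_neg hα (half_pos hc)).mul_const (Real.exp (|z| * C))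
  refine h1.mono' (Measurable.aestronglyMeasurable (by fun_prop)) ?_
  filter_upwards [ae_restrict_mem measurableSet_Ioi] with ρ hρ
  have hρ : 0 < ρ := hρ
  rw [Real.norm_of_nonneg (by positivity), mul_assoc, mul_assoc, ← Real.exp_add, ← Real.exp_add]
  refine mul_le_mul_of_nonneg_left (Real.exp_le_exp.2 ?_) (by positivity)
  have h2 := mul_le_mul_of_nonneg_left (hC ρ hρ) (abs_nonneg z)
  have h3 : |z| * (c / (2 * (|z| + 1)) * ρ) ≤ c / 2 * ρ := by
    have : |z| * (c / (2 * (|z| + 1)) * ρ) = (|z| / (|z| + 1)) * (c / 2 * ρ) := by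
      field_simp
    rw [this]
    refine mul_le_of_le_one_left (by positivity) ?_
    rw [div_le_one (by positivity)]
    linarith
  rw [mul_add] at h2
  linarith

theorem gamma_mul_sin {x : ℝ} (hx : 0 < x) :
    Real.Gamma x * Real.sin (Real.pi * x) = Real.pi * (Real.Gamma (1 - x))⁻¹ := by
  have h := Real.Gamma_mul_Gamma_one_sub x
  have hΓ := Real.Gamma_pos_of_pos hx
  -- When the sine vanishes, 1 - x is a pole: Γ takes the value 0 there by convention, so its
  -- inverse is 0, as the series of Φ_α requires.
  by_cases h0 : Real.sin (Real.pi * x) = 0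
  · rw [h0, div_zero] at h
    rw [h0, mul_zero, (mul_eq_zero.1 h).resolve_left hΓ.ne']
    simp
  · rw [eq_div_iff h0] at h
    have h1 : Real.Gamma (1 - x) ≠ 0 := by
      intro h1
      rw [h1] at h
      simp at h
      exact Real.pi_pos.ne h
    rw [eq_mul_inv_iff_mul_eq₀ h1]
    linear_combination h

theorem wright_term_eq (hα : 0 < α) (hα1 : α < 1) (z : ℝ) (k : ℕ) :
    ∫ ρ in Ioi (0 : ℝ), rayDir α * ((ρ : ℂ) ^ ((α : ℂ) - 1) *
        Complex.exp (-((starRingEnd ℂ) (rayDir α) * ρ))) *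
        ((-(z * (rayDir α * (ρ : ℂ) ^ (α : ℂ)))) ^ k / k.factorial) =
      ((-z) ^ k / k.factorial * Real.Gamma (α * (k + 1)) : ℝ) *
        Complex.exp (Real.pi * α * (k + 1) * Complex.I) := by
  have h1 : ∀ ρ ∈ Ioi (0 : ℝ), rayDir α * ((ρ : ℂ) ^ ((α : ℂ) - 1) *
        Complex.exp (-((starRingEnd ℂ) (rayDir α) * ρ))) *
        ((-(z * (rayDir α * (ρ : ℂ) ^ (α : ℂ)))) ^ k / k.factorial) =
      ((-z : ℂ) ^ k / k.factorial * rayDir α ^ (k + 1)) * ((ρ : ℂ) ^ ((α : ℂ) * (k + 1) - 1) *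
        Complex.exp (-((starRingEnd ℂ) (rayDir α) * ρ))) := fun ρ hρ => by
    have hρ0 : (ρ : ℂ) ≠ 0 := by exact_mod_cast (ne_of_gt hρ)
    have h2 : (ρ : ℂ) ^ ((α : ℂ) * (k + 1) - 1) = (ρ : ℂ) ^ ((α : ℂ) - 1) * ((ρ : ℂ) ^ (α : ℂ)) ^ k := by
      rw [← Complex.cpow_mul_nat, ← Complex.cpow_add _ _ hρ0]
      congr 1
      ring
    rw [h2, pow_succ]
    ring
  rw [setIntegral_congr_fun measurableSet_Ioi h1, integral_const_mul, integral_cpow_mul_cexp_neg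
    (by
      have : ((α : ℂ) * (k + 1)).re = α * (k + 1) := by
        have : ((α : ℂ) * (k + 1)) = ((α * (k + 1) : ℝ) : ℂ) := by push_cast; ring
        rw [this, Complex.ofReal_re]
      rw [this]; positivity) (by rw [conj_rayDir_re]; exact cos_rayAngle_pos hα hα1)]
  have h3 := rayDir_cpow_mul hα hα1 (k + 1)
  have h4 : rayDir α ^ ((k : ℂ) + 1) = rayDir α ^ (k + 1) := by
    rw [← Complex.cpow_natCast]; push_cast; rfl
  rw [h4] at h3
  rw [← h3]
  push_cast
  rw [← Complex.Gamma_ofReal]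
  push_cast
  ring

/-- Expanding the last exponential of the kernel and integrating termwise gives Γ(α(k+1))
e^{iπα(k+1)}; the imaginary part is π/Γ(1-α(k+1)) by reflection. -/
theorem hasSum_wright (hα : 0 < α) (hα1 : α < 1) (z : ℝ) :
    HasSum (fun k : ℕ => (-z) ^ k / ((k.factorial : ℝ) * Real.Gamma (-α * k + 1 - α)))
      ((wrightInt α z).im / Real.pi) := by
  have hc := cos_rayAngle_pos hα hα1
  have h := hasSum_integral_of_dominated_convergence (μ := volume.restrict (Ioi (0 : ℝ)))
    (F := fun (k : ℕ) (ρ : ℝ) => rayDir α * ((ρ : ℂ) ^ ((α : ℂ) - 1) *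
        Complex.exp (-((starRingEnd ℂ) (rayDir α) * ρ))) *
        ((-(z * (rayDir α * (ρ : ℂ) ^ (α : ℂ)))) ^ k / k.factorial))
    (f := wrightKernel α z)
    (bound := fun (k : ℕ) (ρ : ℝ) => ρ ^ (α - 1) * Real.exp (-(Real.cos (rayAngle α) * ρ)) *
      ((|z| * ρ ^ α) ^ k / k.factorial))
    (fun k => Measurable.aestronglyMeasurable (by fun_prop)) (fun k => ?_) ?_ ?_ ?_
  · simp only [wright_term_eq hα hα1] at h
    have h2 := ((Complex.hasSum_iff _ _).1 h).2.div_const Real.pi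
    have h3 : (fun k : ℕ => (-z) ^ k / ((k.factorial : ℝ) * Real.Gamma (-α * k + 1 - α))) =
        fun k : ℕ => (((((-z) ^ k / k.factorial * Real.Gamma (α * (k + 1)) : ℝ) : ℂ) *
          Complex.exp (Real.pi * α * (k + 1) * Complex.I))).im / Real.pi := by
      funext k
      have h4 : (Real.pi * α * (k + 1) * Complex.I : ℂ) =
          ((Real.pi * (α * (k + 1)) : ℝ) : ℂ) * Complex.I := by push_cast; ring
      rw [h4, Complex.im_ofReal_mul, Complex.exp_ofReal_mul_I_im, mul_assoc,
        gamma_mul_sin (by positivity)]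
      have h5 : 1 - α * (k + 1) = -α * k + 1 - α := by ring
      rw [h5]
      have := Real.pi_pos.ne'
      field_simp
    rw [h3]
    exact h2
  · filter_upwards [ae_restrict_mem measurableSet_Ioi] with ρ hρ
    have hρ : 0 < ρ := hρ
    rw [norm_mul, norm_mul, norm_rayDir, one_mul, norm_cpow_mul_cexp_neg hρ, conj_rayDir_re,
      norm_div, norm_pow, norm_neg, norm_mul, norm_mul, norm_rayDir, one_mul,
      Complex.norm_cpow_eq_rpow_re_of_pos hρ]
    simp
  · filter_upwards with ρ
    exact (Real.summable_pow_div_factorial _).mul_left _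
  · refine (integrableOn_rpow_mul_exp_mul_exp hα hα1 z hc).congr_fun (fun ρ _ => ?_) measurableSet_Ioi
    simp only
    rw [tsum_mul_left, Real.exp_eq_exp_ℝ, NormedSpace.exp_eq_tsum_div]
  · filter_upwards with ρ
    have := (NormedSpace.expSeries_div_hasSum_exp (-(z * (rayDir α * (ρ : ℂ) ^ (α : ℂ))))).mul_left
      (rayDir α * ((ρ : ℂ) ^ ((α : ℂ) - 1) * Complex.exp (-((starRingEnd ℂ) (rayDir α) * ρ))))
    rwa [← Complex.exp_eq_exp_ℂ] at this

end WrightKernel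

/-! ### Continuity and Mellin transform of Φ_α. -/

section WrightMellin

variable {α : ℝ}

theorem wright_eq (hα : 0 < α) (hα1 : α < 1) (z : ℝ) : wright α z = (wrightInt α z).im / Real.pi :=
  (hasSum_wright hα hα1 z).tsum_eq

theorem wright_zero_pos (hα1 : α < 1) : 0 < wright α 0 := by
  have h : wright α 0 = 1 / Real.Gamma (1 - α) := by
    rw [wright, tsum_eq_single 0]
    · simp
    · intro k hk
      simp [hk]
  rw [h]
  exact one_div_pos.2 (Real.Gamma_pos_of_pos (by linarith))

theorem continuousOn_wright (hα : 0 < α) (hα1 : α < 1) : ContinuousOn (wright α) (Ici 0) := by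
  have hc := cos_rayAngle_pos hα hα1
  have h1 : ContinuousOn (wrightInt α) (Ici 0) := by
    refine continuousOn_of_dominated
      (bound := fun ρ => ρ ^ (α - 1) * Real.exp (-(Real.cos (rayAngle α) * ρ)))
      (fun z _ => (measurable_wrightKernel.comp measurable_prodMk_left).aestronglyMeasurable) ?_
      (integrableOn_rpow_mul_exp_neg hα hc) ?_
    · intro z hz
      filter_upwards [ae_restrict_mem measurableSet_Ioi] with ρ hρ
      have hρ : 0 < ρ := hρ
      have hz : 0 ≤ z := hz
      rw [norm_wrightKernel hρ]
      refine mul_le_of_le_one_right (by positivity) ?_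
      rw [Real.exp_le_one_iff, neg_nonpos]
      positivity
    · filter_upwards with ρ
      unfold wrightKernel
      fun_prop
  refine ((Complex.continuous_im.comp_continuousOn h1).div_const Real.pi).congr fun z _ => ?_
  exact wright_eq hα hα1 z

/-- Integrating absolute values in τ first needs Re q > 0 and leaves ρ^{α(1-Re q)-1} e^{-ρ cos θ},
integrable because Re q < 1. -/
theorem integrable_cpow_mul_wrightKernel (hα : 0 < α) (hα1 : α < 1) {q : ℂ} (hq0 : 0 < q.re)
    (hq1 : q.re < 1) :
    Integrable (fun p : ℝ × ℝ => (p.1 : ℂ) ^ (q - 1) * wrightKernel α p.1 p.2)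
      ((volume.restrict (Ioi 0)).prod (volume.restrict (Ioi 0))) := by
  have hc := cos_rayAngle_pos hα hα1
  have hm : Measurable (fun p : ℝ × ℝ => (p.1 : ℂ) ^ (q - 1) * wrightKernel α p.1 p.2) :=
    Measurable.mul (by fun_prop) measurable_wrightKernel
  have hnorm : ∀ τ ∈ Ioi (0 : ℝ), ∀ ρ ∈ Ioi (0 : ℝ),
      ‖(τ : ℂ) ^ (q - 1) * wrightKernel α τ ρ‖ =
        (ρ ^ (α - 1) * Real.exp (-(Real.cos (rayAngle α) * ρ))) *
          (τ ^ (q.re - 1) * Real.exp (-((Real.cos (rayAngle α) * ρ ^ α) * τ))) := by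
    intro τ hτ ρ hρ
    rw [norm_mul, norm_wrightKernel hρ, Complex.norm_cpow_eq_rpow_re_of_pos hτ,
      mul_comm (Real.cos (rayAngle α) * ρ ^ α) τ]
    simp only [Complex.sub_re, Complex.one_re]
    ring
  rw [integrable_prod_iff' hm.aestronglyMeasurable]
  constructor
  · filter_upwards [ae_restrict_mem measurableSet_Ioi] with ρ hρ
    have hρ' : 0 < ρ := hρ
    refine ((integrableOn_rpow_mul_exp_neg hq0 (c := Real.cos (rayAngle α) * ρ ^ α)
      (by positivity)).const_mul (ρ ^ (α - 1) * Real.exp (-(Real.cos (rayAngle α) * ρ)))).mono'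
      (hm.comp measurable_prodMk_right).aestronglyMeasurable ?_
    filter_upwards [ae_restrict_mem measurableSet_Ioi] with τ hτ
    exact (hnorm τ hτ ρ hρ).le
  · have h1 : IntegrableOn (fun ρ : ℝ => (Real.cos (rayAngle α) ^ (-q.re) * Real.Gamma q.re) *
        (ρ ^ ((α - α * q.re) - 1) * Real.exp (-(Real.cos (rayAngle α) * ρ)))) (Ioi 0) :=
      (integrableOn_rpow_mul_exp_neg (by nlinarith) hc).const_mul _
    refine h1.congr_fun (fun ρ hρ => ?_) measurableSet_Ioi
    have hρ' : 0 < ρ := hρ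
    simp only
    rw [setIntegral_congr_fun measurableSet_Ioi (fun τ hτ => hnorm τ hτ ρ hρ), integral_const_mul,
      Real.integral_rpow_mul_exp_neg_mul_Ioi hq0 (by positivity), one_div,
      Real.inv_rpow (by positivity), Real.mul_rpow hc.le (by positivity), ← Real.rpow_mul hρ'.le,
      mul_inv, ← Real.rpow_neg hc.le, ← Real.rpow_neg hρ'.le]
    have : ρ ^ ((α - α * q.re) - 1) = ρ ^ (α - 1) * ρ ^ (-(α * q.re)) := by
      rw [← Real.rpow_add hρ']; congr 1; ring
    rw [this]
    ring

theorem rayDir_mul_rpow_cpow {ρ : ℝ} (hρ : 0 < ρ) (s : ℂ) :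
    (rayDir α * (ρ : ℂ) ^ (α : ℂ)) ^ s = rayDir α ^ s * (ρ : ℂ) ^ (α * s) := by
  have h0 : rayDir α ≠ 0 := Complex.exp_ne_zero _
  have h1 : 0 < ρ ^ α := Real.rpow_pos_of_pos hρ α
  have hρ0 : (ρ : ℂ) ≠ 0 := by exact_mod_cast hρ.ne'
  have h2 : ((ρ ^ α : ℝ) : ℂ) ≠ 0 := by exact_mod_cast h1.ne'
  rw [← Complex.ofReal_cpow hρ.le, mul_comm, Complex.cpow_def_of_ne_zero (mul_ne_zero h2 h0),
    Complex.cpow_def_of_ne_zero h0, Complex.cpow_def_of_ne_zero hρ0, ← Complex.exp_add,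
    Complex.log_ofReal_mul h1 h0, Real.log_rpow hρ, ← Complex.ofReal_log hρ.le]
  congr 1
  push_cast
  ring

theorem integral_cpow_mul_wrightInt (hα : 0 < α) (hα1 : α < 1) {q : ℂ} (hq0 : 0 < q.re)
    (hq1 : q.re < 1) :
    IntegrableOn (fun τ : ℝ => (τ : ℂ) ^ (q - 1) * wrightInt α τ) (Ioi 0) ∧
    ∫ τ in Ioi (0 : ℝ), (τ : ℂ) ^ (q - 1) * wrightInt α τ =
      Complex.Gamma q * Complex.Gamma (α * (1 - q)) * Complex.exp (Real.pi * α * (1 - q) * Complex.I) := by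
  have hc := cos_rayAngle_pos hα hα1
  have hint := integrable_cpow_mul_wrightKernel hα hα1 hq0 hq1
  have hpull : ∀ τ : ℝ, ∫ ρ in Ioi (0 : ℝ), (τ : ℂ) ^ (q - 1) * wrightKernel α τ ρ =
      (τ : ℂ) ^ (q - 1) * wrightInt α τ := fun τ => integral_const_mul _ _
  constructor
  · have := hint.integral_prod_left
    simp only [hpull] at this
    exact this
  · have hswap := integral_integral_swap (f := fun τ ρ : ℝ => (τ : ℂ) ^ (q - 1) * wrightKernel α τ ρ) hint
    simp only [hpull] at hswap
    rw [hswap]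
    have hinner : ∀ ρ ∈ Ioi (0 : ℝ), ∫ τ in Ioi (0 : ℝ), (τ : ℂ) ^ (q - 1) * wrightKernel α τ ρ =
        (rayDir α ^ (1 - q) * Complex.Gamma q) * ((ρ : ℂ) ^ (α * (1 - q) - 1) *
          Complex.exp (-((starRingEnd ℂ) (rayDir α) * ρ))) := fun ρ hρ => by
      have hρ' : 0 < ρ := hρ
      have hρ0 : (ρ : ℂ) ≠ 0 := by exact_mod_cast hρ'.ne'
      have hre : 0 < (rayDir α * (ρ : ℂ) ^ (α : ℂ)).re := by
        rw [← Complex.ofReal_cpow hρ'.le, Complex.re_mul_ofReal, rayDir_re]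
        positivity
      have h1 : ∀ τ ∈ Ioi (0 : ℝ), (τ : ℂ) ^ (q - 1) * wrightKernel α τ ρ =
          (rayDir α * ((ρ : ℂ) ^ ((α : ℂ) - 1) * Complex.exp (-((starRingEnd ℂ) (rayDir α) * ρ)))) *
            ((τ : ℂ) ^ (q - 1) * Complex.exp (-((rayDir α * (ρ : ℂ) ^ (α : ℂ)) * τ))) := fun τ _ => by
        rw [wrightKernel, mul_comm (rayDir α * (ρ : ℂ) ^ (α : ℂ)) (τ : ℂ)]
        ring
      rw [setIntegral_congr_fun measurableSet_Ioi h1, integral_const_mul,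
        integral_cpow_mul_cexp_neg hq0 hre, rayDir_mul_rpow_cpow hρ']
      have h2 : (ρ : ℂ) ^ (α * (1 - q) - 1) = (ρ : ℂ) ^ ((α : ℂ) - 1) * (ρ : ℂ) ^ (α * -q) := by
        rw [← Complex.cpow_add _ _ hρ0]; congr 1; ring
      have h3 : rayDir α ^ (1 - q) = rayDir α * rayDir α ^ (-q) := by
        have h0 : rayDir α ≠ 0 := Complex.exp_ne_zero _
        rw [sub_eq_add_neg, Complex.cpow_add _ _ h0, Complex.cpow_one]
      rw [h2, h3]
      ring
    rw [setIntegral_congr_fun measurableSet_Ioi hinner, integral_const_mul,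
      integral_cpow_mul_cexp_neg _ (by rw [conj_rayDir_re]; exact hc), ← rayDir_cpow_mul hα hα1]
    · ring
    · simp only [Complex.re_ofReal_mul, Complex.sub_re, Complex.one_re]
      nlinarith

theorem wright_eq_sub (hα : 0 < α) (hα1 : α < 1) (z : ℝ) :
    (wright α z : ℂ) = (wrightInt α z - (starRingEnd ℂ) (wrightInt α z)) / (2 * Real.pi * Complex.I) := by
  rw [wright_eq hα hα1, Complex.sub_conj]
  have := Real.pi_pos.ne'
  push_cast
  field_simp [Complex.I_ne_zero]

/-- The Mellin transform of `Φ_α` in the strip `0 < Re q < 1`. -/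
theorem mellin_wright (hα : 0 < α) (hα1 : α < 1) {q : ℂ} (hq0 : 0 < q.re) (hq1 : q.re < 1) :
    IntegrableOn (fun τ : ℝ => (τ : ℂ) ^ (q - 1) * (wright α τ : ℂ)) (Ioi 0) ∧
    (∫ τ in Ioi (0 : ℝ), (τ : ℂ) ^ (q - 1) * (wright α τ : ℂ)) * Complex.Gamma (1 - α * (1 - q)) =
      Complex.Gamma q := by
  obtain ⟨hi, hv⟩ := integral_cpow_mul_wrightInt hα hα1 hq0 hq1
  -- For complex q the imaginary part cannot be taken after integration. Instead Φ_α is the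
  -- difference of the ray integral and its conjugate over 2πi, and the transform of the conjugate
  -- at q is the conjugate of the transform at the conjugate of q.
  obtain ⟨hi', hv'⟩ := integral_cpow_mul_wrightInt hα hα1 (q := (starRingEnd ℂ) q) (by simpa) (by simpa)
  have hconj : ∀ τ ∈ Ioi (0 : ℝ), (starRingEnd ℂ) ((τ : ℂ) ^ ((starRingEnd ℂ) q - 1) * wrightInt α τ) =
      (τ : ℂ) ^ (q - 1) * (starRingEnd ℂ) (wrightInt α τ) := fun τ hτ => by
    have hτ : 0 < τ := hτ
    have h1 : (starRingEnd ℂ) q - 1 = (starRingEnd ℂ) (q - 1) := by simp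
    rw [map_mul, h1, Complex.cpow_conj _ _ (by rw [Complex.arg_ofReal_of_nonneg hτ.le]; exact Real.pi_pos.ne),
      Complex.conj_conj, Complex.conj_ofReal]
  have hic : IntegrableOn (fun τ : ℝ => (τ : ℂ) ^ (q - 1) * (starRingEnd ℂ) (wrightInt α τ)) (Ioi 0) := by
    have h1 : IntegrableOn (fun τ : ℝ => (starRingEnd ℂ) ((τ : ℂ) ^ ((starRingEnd ℂ) q - 1) *
        wrightInt α τ)) (Ioi 0) := Complex.conjCLE.toContinuousLinearMap.integrable_comp hi'
    exact h1.congr_fun hconj measurableSet_Ioi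
  have hvc : ∫ τ in Ioi (0 : ℝ), (τ : ℂ) ^ (q - 1) * (starRingEnd ℂ) (wrightInt α τ) =
      Complex.Gamma q * Complex.Gamma (α * (1 - q)) * Complex.exp (-(Real.pi * α * (1 - q) * Complex.I)) := by
    rw [← setIntegral_congr_fun measurableSet_Ioi hconj, integral_conj, hv']
    simp [← Complex.exp_conj, ← Complex.Gamma_conj]
  have hfun : ∀ τ : ℝ, (τ : ℂ) ^ (q - 1) * (wright α τ : ℂ) =
      ((τ : ℂ) ^ (q - 1) * wrightInt α τ - (τ : ℂ) ^ (q - 1) * (starRingEnd ℂ) (wrightInt α τ)) /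
        (2 * Real.pi * Complex.I) := fun τ => by
    rw [wright_eq_sub hα hα1]; ring
  simp only [hfun]
  refine ⟨(hi.sub hic).div_const _, ?_⟩
  rw [integral_div, integral_sub hi hic, hv, hvc]
  have hs0 : 0 < (α * (1 - q)).re := by
    simp only [Complex.re_ofReal_mul, Complex.sub_re, Complex.one_re]; nlinarith
  have hs1 : (α * (1 - q)).re < 1 := by
    simp only [Complex.re_ofReal_mul, Complex.sub_re, Complex.one_re]; nlinarith
  have h := Complex.Gamma_mul_Gamma_one_sub (α * (1 - q))
  have h1 : Complex.Gamma (α * (1 - q)) ≠ 0 := Complex.Gamma_ne_zero_of_re_pos hs0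
  have h2 : Complex.Gamma (1 - α * (1 - q)) ≠ 0 := Complex.Gamma_ne_zero_of_re_pos (by
    rw [Complex.sub_re, Complex.one_re]; linarith)
  have hsin : Complex.sin (Real.pi * (α * (1 - q))) ≠ 0 := by
    intro h3
    rw [h3, div_zero] at h
    exact mul_ne_zero h1 h2 h
  rw [eq_div_iff hsin, Complex.sin] at h
  have hpi : (Real.pi : ℂ) ≠ 0 := by exact_mod_cast Real.pi_pos.ne'
  have he1 : Complex.exp (-(Real.pi * (α * (1 - q))) * Complex.I) =
      Complex.exp (-(Real.pi * α * (1 - q) * Complex.I)) := by congr 1; ring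
  have he2 : Complex.exp (Real.pi * (α * (1 - q)) * Complex.I) =
      Complex.exp (Real.pi * α * (1 - q) * Complex.I) := by congr 1; ring
  rw [he1, he2] at h
  field_simp
  have hI : Complex.I * Complex.I = -1 := Complex.I_mul_I
  linear_combination (norm := skip) (2 * Complex.I * Complex.Gamma q) * h
  ring_nf
  rw [Complex.I_sq]
  ring

end WrightMellin

/-! ### Nonnegativity of Φ_α by complete monotonicity and concentration. -/

section WrightPositivity

variable {α : ℝ}

theorem integrableOn_rpow_mul_wright (hα : 0 < α) (hα1 : α < 1) {x : ℝ} (hx0 : 0 < x) (hx1 : x < 1) :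
    IntegrableOn (fun τ : ℝ => τ ^ (x - 1) * wright α τ) (Ioi 0) := by
  have h := (mellin_wright hα hα1 (q := (x : ℂ)) (by simpa) (by simpa)).1
  have h2 : IntegrableOn (fun τ : ℝ => ((τ : ℂ) ^ ((x : ℂ) - 1) * (wright α τ : ℂ)).re) (Ioi 0) := h.re
  refine h2.congr_fun (fun τ hτ => ?_) measurableSet_Ioi
  have hτ : 0 < τ := hτ
  have : (τ : ℂ) ^ ((x : ℂ) - 1) = ((τ ^ (x - 1) : ℝ) : ℂ) := by
    rw [Complex.ofReal_cpow hτ.le]; push_cast; rfl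
  simp only
  rw [this, ← Complex.ofReal_mul, Complex.ofReal_re]

theorem rpow_mul_exp_neg_le {m c y : ℝ} (hm : 0 < m) (hc : 0 < c) (hy : 0 < y) :
    y ^ m * Real.exp (-(c * y)) ≤ (m / c) ^ m := by
  have h1 : c * y / m ≤ Real.exp (c * y / m) := by linarith [Real.add_one_le_exp (c * y / m)]
  have h2 : (c * y / m) ^ m ≤ Real.exp (c * y) := by
    calc (c * y / m) ^ m ≤ (Real.exp (c * y / m)) ^ m := Real.rpow_le_rpow (by positivity) h1 hm.le
      _ = _ := by rw [← Real.exp_mul]; congr 1; field_simp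
  have h3 : y ^ m = (m / c) ^ m * (c * y / m) ^ m := by
    rw [← Real.mul_rpow (by positivity) (by positivity)]; congr 1; field_simp
  rw [h3, Real.exp_neg, mul_assoc]
  refine mul_le_of_le_one_right (by positivity) ?_
  rw [← div_eq_mul_inv]
  exact div_le_one_of_le₀ h2 (Real.exp_pos _).le

/-- With y = τ^{-1/α} one has τ^{-1/2} = y^{α/2}; the remaining power of y is absorbed by the
exponential. The comparison with τ^{-1/2} matches the Mellin integral at 1/2. -/
theorem pow_mul_exp_neg_le_rpow (hα : 0 < α) (hα1 : α < 1) (k : ℕ) {s : ℝ} (hs : 0 < s) :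
    ∃ C : ℝ, ∀ τ : ℝ, 0 < τ →
      (τ ^ (-α⁻¹)) ^ (k + 1) * Real.exp (-(s * τ ^ (-α⁻¹))) ≤ C * τ ^ ((1 / 2 : ℝ) - 1) := by
  have hm : 0 < (k : ℝ) + 1 - α / 2 := by
    have : (0 : ℝ) ≤ k := k.cast_nonneg
    linarith
  refine ⟨(((k : ℝ) + 1 - α / 2) / s) ^ ((k : ℝ) + 1 - α / 2), fun τ hτ => ?_⟩
  have hy : 0 < τ ^ (-α⁻¹) := Real.rpow_pos_of_pos hτ _
  have h1 := rpow_mul_exp_neg_le hm hs hy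
  have h2 : (τ ^ (-α⁻¹)) ^ (k + 1) = (τ ^ (-α⁻¹)) ^ ((k : ℝ) + 1 - α / 2) * τ ^ ((1 / 2 : ℝ) - 1) := by
    have : τ ^ ((1 / 2 : ℝ) - 1) = (τ ^ (-α⁻¹)) ^ (α / 2) := by
      rw [← Real.rpow_mul hτ.le]; congr 1; field_simp; ring
    rw [this, ← Real.rpow_add hy, ← Real.rpow_natCast]
    congr 1
    push_cast
    ring
  rw [h2, mul_right_comm]
  gcongr

/-- `∫ Φ_α(τ) y^(k+1) e^(-s y) dτ` with `y = τ^(-1/α)`: up to sign the derivatives of the Laplace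
transform of a one-sided stable law. -/
def stableLaplace (α : ℝ) (k : ℕ) (s : ℝ) : ℝ :=
  ∫ τ in Ioi (0 : ℝ), wright α τ * ((τ ^ (-α⁻¹)) ^ (k + 1) * Real.exp (-(s * τ ^ (-α⁻¹))))

theorem aestronglyMeasurable_wright (hα : 0 < α) (hα1 : α < 1) :
    AEStronglyMeasurable (wright α) (volume.restrict (Ioi 0)) :=
  ((continuousOn_wright hα hα1).mono Ioi_subset_Ici_self).aestronglyMeasurable measurableSet_Ioi

theorem integrableOn_stableLaplace (hα : 0 < α) (hα1 : α < 1) (k : ℕ) {s : ℝ} (hs : 0 < s) :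
    IntegrableOn (fun τ => wright α τ * ((τ ^ (-α⁻¹)) ^ (k + 1) * Real.exp (-(s * τ ^ (-α⁻¹)))))
      (Ioi 0) := by
  obtain ⟨C, hC⟩ := pow_mul_exp_neg_le_rpow hα hα1 k hs
  have h1 := ((integrableOn_rpow_mul_wright hα hα1 (x := 1 / 2) (by norm_num) (by norm_num)).norm.const_mul C)
  refine h1.mono' ((aestronglyMeasurable_wright hα hα1).mul
    (Measurable.aestronglyMeasurable (by fun_prop))) ?_
  filter_upwards [ae_restrict_mem measurableSet_Ioi] with τ hτ
  have hτ : 0 < τ := hτ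
  have h2 := hC τ hτ
  rw [norm_mul, norm_mul (τ ^ _), Real.norm_of_nonneg (r := τ ^ _) (by positivity),
    Real.norm_of_nonneg (r := _ * Real.exp _) (by positivity), mul_comm, ← mul_assoc]
  gcongr

theorem hasDerivAt_stableLaplace (hα : 0 < α) (hα1 : α < 1) (k : ℕ) {s : ℝ} (hs : 0 < s) :
    HasDerivAt (stableLaplace α k) (-(stableLaplace α (k + 1) s)) s := by
  have hU : Ioi (s / 2) ∈ 𝓝 s := Ioi_mem_nhds (by linarith)
  have key := hasDerivAt_integral_of_dominated_loc_of_deriv_le (μ := volume.restrict (Ioi (0 : ℝ)))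
    (F := fun s τ => wright α τ * ((τ ^ (-α⁻¹)) ^ (k + 1) * Real.exp (-(s * τ ^ (-α⁻¹)))))
    (F' := fun s τ => -(wright α τ * ((τ ^ (-α⁻¹)) ^ (k + 1 + 1) * Real.exp (-(s * τ ^ (-α⁻¹))))))
    (bound := fun τ => ‖wright α τ * ((τ ^ (-α⁻¹)) ^ (k + 1 + 1) * Real.exp (-(s / 2 * τ ^ (-α⁻¹))))‖) hU
    (Eventually.of_forall fun s => (aestronglyMeasurable_wright hα hα1).mul
      (Measurable.aestronglyMeasurable (by fun_prop)))
    (integrableOn_stableLaplace hα hα1 k hs)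
    ((aestronglyMeasurable_wright hα hα1).mul
      (Measurable.aestronglyMeasurable (by fun_prop))).neg ?_
    (integrableOn_stableLaplace hα hα1 (k + 1) (half_pos hs)).norm ?_
  · refine key.2.congr_deriv ?_
    rw [integral_neg, stableLaplace]
  · filter_upwards [ae_restrict_mem measurableSet_Ioi] with τ hτ r hr
    have hτ : 0 < τ := hτ
    have hr : s / 2 < r := hr
    rw [norm_neg, norm_mul, norm_mul (wright α τ), Real.norm_of_nonneg (r := _ * Real.exp _) (by positivity),
      Real.norm_of_nonneg (r := _ * Real.exp _) (by positivity)]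
    gcongr
  · filter_upwards with τ r _
    have h1 : HasDerivAt (fun r : ℝ => -(r * τ ^ (-α⁻¹))) (-(τ ^ (-α⁻¹))) r := by
      exact ((hasDerivAt_id r).mul_const (τ ^ (-α⁻¹))).neg.congr_deriv (by simp)
    refine ((h1.exp.const_mul ((τ ^ (-α⁻¹)) ^ (k + 1))).const_mul (wright α τ)).congr_deriv ?_
    ring

theorem ofReal_rpow_cpow {τ : ℝ} (hτ : 0 < τ) (a : ℝ) (s : ℂ) :
    ((τ ^ a : ℝ) : ℂ) ^ s = (τ : ℂ) ^ (a * s) := by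
  have h1 : ((τ ^ a : ℝ) : ℂ) ≠ 0 := by exact_mod_cast (Real.rpow_pos_of_pos hτ a).ne'
  have h2 : (τ : ℂ) ≠ 0 := by exact_mod_cast hτ.ne'
  rw [Complex.cpow_def_of_ne_zero h1, Complex.cpow_def_of_ne_zero h2, ← Complex.ofReal_log hτ.le,
    ← Complex.ofReal_log (by positivity), Real.log_rpow hτ]
  congr 1
  push_cast
  ring

theorem integrable_mellin_stableLaplace (hα : 0 < α) (hα1 : α < 1) {p : ℂ} (hp0 : 1 - α < p.re)
    (hp1 : p.re < 1) :
    Integrable (fun x : ℝ × ℝ => (x.1 : ℂ) ^ (p - 1) * (wright α x.2 *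
      ((x.2 ^ (-α⁻¹)) ^ (0 + 1) * Real.exp (-(x.1 * x.2 ^ (-α⁻¹)))) : ℝ))
      ((volume.restrict (Ioi 0)).prod (volume.restrict (Ioi 0))) := by
  have hm : AEStronglyMeasurable (fun x : ℝ × ℝ => (x.1 : ℂ) ^ (p - 1) * (wright α x.2 *
      ((x.2 ^ (-α⁻¹)) ^ (0 + 1) * Real.exp (-(x.1 * x.2 ^ (-α⁻¹)))) : ℝ))
      ((volume.restrict (Ioi 0)).prod (volume.restrict (Ioi 0))) := by
    refine (Measurable.aestronglyMeasurable (by fun_prop)).mul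
      (Complex.continuous_ofReal.comp_aestronglyMeasurable ?_)
    exact (aestronglyMeasurable_wright hα hα1).comp_snd.mul (Measurable.aestronglyMeasurable (by fun_prop))
  have hnorm : ∀ s ∈ Ioi (0 : ℝ), ∀ τ ∈ Ioi (0 : ℝ), ‖(s : ℂ) ^ (p - 1) * (wright α τ *
      ((τ ^ (-α⁻¹)) ^ (0 + 1) * Real.exp (-(s * τ ^ (-α⁻¹)))) : ℝ)‖ =
      (‖wright α τ‖ * τ ^ (-α⁻¹)) * (s ^ (p.re - 1) * Real.exp (-(τ ^ (-α⁻¹) * s))) := by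
    intro s hs τ hτ
    have hτ : 0 < τ := hτ
    rw [norm_mul, Complex.norm_cpow_eq_rpow_re_of_pos hs, Complex.norm_real, norm_mul,
      Real.norm_of_nonneg (r := _ * Real.exp _) (by positivity), mul_comm s, zero_add, pow_one]
    simp only [Complex.sub_re, Complex.one_re]
    ring
  have hp : 0 < p.re := by linarith
  rw [integrable_prod_iff' hm]
  constructor
  · filter_upwards [ae_restrict_mem measurableSet_Ioi] with τ hτ
    have hτ' : 0 < τ := hτ
    refine ((integrableOn_rpow_mul_exp_neg hp (c := τ ^ (-α⁻¹))
      (by positivity)).const_mul (‖wright α τ‖ * τ ^ (-α⁻¹))).mono'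
      (Measurable.aestronglyMeasurable (by fun_prop)) ?_
    filter_upwards [ae_restrict_mem measurableSet_Ioi] with s hs
    exact (hnorm s hs τ hτ).le
  · have hx0 : 0 < 1 + (p.re - 1) / α := by
      rw [← neg_lt_iff_pos_add', lt_div_iff₀ hα]; linarith
    have hx1 : 1 + (p.re - 1) / α < 1 := by
      have : (p.re - 1) / α < 0 := div_neg_of_neg_of_pos (by linarith) hα
      linarith
    have h1 := (integrableOn_rpow_mul_wright hα hα1 hx0 hx1).norm.const_mul (Real.Gamma p.re)
    refine IntegrableOn.congr_fun h1 (fun τ hτ => ?_) measurableSet_Ioi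
    have hτ' : 0 < τ := hτ
    simp only
    rw [setIntegral_congr_fun measurableSet_Ioi (fun s hs => hnorm s hs τ hτ), integral_const_mul,
      Real.integral_rpow_mul_exp_neg_mul_Ioi hp (by positivity), one_div, ← Real.rpow_neg hτ'.le,
      ← Real.rpow_mul hτ'.le, norm_mul, Real.norm_of_nonneg (r := τ ^ _) (by positivity)]
    have : τ ^ (1 + (p.re - 1) / α - 1) = τ ^ (-α⁻¹) * τ ^ (- -α⁻¹ * p.re) := by
      rw [← Real.rpow_add hτ']; congr 1; field_simp; ring
    rw [this]
    ring

/-- The s-integral gives Γ(p) τ^{(p-1)/α}, leading to the Mellin transform of Φ_α at q = 1 +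
(p-1)/α, whose denominator Γ(1-α(1-q)) is Γ(p) and cancels. The strip for p is exactly 0 < Re q < 1.
-/
theorem mellin_stableLaplace (hα : 0 < α) (hα1 : α < 1) {p : ℂ} (hp0 : 1 - α < p.re)
    (hp1 : p.re < 1) :
    MellinConvergent (fun s => (stableLaplace α 0 s : ℂ)) p ∧
    mellin (fun s => (stableLaplace α 0 s : ℂ)) p = Complex.Gamma (1 + (p - 1) / α) := by
  have hint := integrable_mellin_stableLaplace hα hα1 hp0 hp1
  have hα0 : (α : ℂ) ≠ 0 := by exact_mod_cast hα.ne'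
  have hpull : ∀ s : ℝ, ∫ τ in Ioi (0 : ℝ), (s : ℂ) ^ (p - 1) * ((wright α τ *
      ((τ ^ (-α⁻¹)) ^ (0 + 1) * Real.exp (-(s * τ ^ (-α⁻¹)))) : ℝ) : ℂ) =
      (s : ℂ) ^ (p - 1) * (stableLaplace α 0 s : ℂ) := fun s => by
    rw [integral_const_mul, integral_complex_ofReal, stableLaplace]
  have hp : 0 < p.re := by linarith
  constructor
  · have := hint.integral_prod_left
    simp only [hpull] at this
    exact this
  · have hswap := integral_integral_swap (f := fun s τ : ℝ => (s : ℂ) ^ (p - 1) * ((wright α τ *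
      ((τ ^ (-α⁻¹)) ^ (0 + 1) * Real.exp (-(s * τ ^ (-α⁻¹)))) : ℝ) : ℂ)) hint
    simp only [hpull] at hswap
    simp only [mellin, smul_eq_mul]
    rw [hswap]
    have hinner : ∀ τ ∈ Ioi (0 : ℝ), ∫ s in Ioi (0 : ℝ), (s : ℂ) ^ (p - 1) * ((wright α τ *
        ((τ ^ (-α⁻¹)) ^ (0 + 1) * Real.exp (-(s * τ ^ (-α⁻¹)))) : ℝ) : ℂ) =
        Complex.Gamma p * ((τ : ℂ) ^ ((1 + (p - 1) / α) - 1) * (wright α τ : ℂ)) := fun τ hτ => by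
      have hτ' : 0 < τ := hτ
      have hτ0 : (τ : ℂ) ≠ 0 := by exact_mod_cast hτ'.ne'
      have hy : 0 < τ ^ (-α⁻¹) := Real.rpow_pos_of_pos hτ' _
      have h1 : ∀ s ∈ Ioi (0 : ℝ), (s : ℂ) ^ (p - 1) * ((wright α τ *
          ((τ ^ (-α⁻¹)) ^ (0 + 1) * Real.exp (-(s * τ ^ (-α⁻¹)))) : ℝ) : ℂ) =
          ((wright α τ : ℂ) * ((τ ^ (-α⁻¹) : ℝ) : ℂ)) *
            ((s : ℂ) ^ (p - 1) * Complex.exp (-(((τ ^ (-α⁻¹) : ℝ) : ℂ) * s))) := fun s _ => by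
        push_cast
        rw [pow_one, mul_comm (s : ℂ) ((τ ^ (-α⁻¹) : ℝ) : ℂ)]
        ring
      rw [setIntegral_congr_fun measurableSet_Ioi h1, integral_const_mul,
        integral_cpow_mul_cexp_neg hp (by simpa using hy)]
      have h2 : (τ : ℂ) ^ ((1 + (p - 1) / α) - 1) = ((τ ^ (-α⁻¹) : ℝ) : ℂ) * ((τ ^ (-α⁻¹) : ℝ) : ℂ) ^ (-p) := by
        have h3 : ((τ ^ (-α⁻¹) : ℝ) : ℂ) = ((τ ^ (-α⁻¹) : ℝ) : ℂ) ^ (1 : ℂ) := (Complex.cpow_one _).symm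
        conv_rhs => enter [1]; rw [h3]
        rw [ofReal_rpow_cpow hτ', ofReal_rpow_cpow hτ', ← Complex.cpow_add _ _ hτ0]
        congr 1
        push_cast
        field_simp
        ring
      rw [h2]
      ring
    rw [setIntegral_congr_fun measurableSet_Ioi hinner, integral_const_mul]
    have hre : (1 + (p - 1) / α).re = 1 + (p.re - 1) / α := by
      simp [Complex.div_ofReal_re]
    have h := (mellin_wright hα hα1 (q := 1 + (p - 1) / α)
      (by rw [hre, ← neg_lt_iff_pos_add', lt_div_iff₀ hα]; linarith)
      (by
        rw [hre]
        have : (p.re - 1) / α < 0 := div_neg_of_neg_of_pos (by linarith) hα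
        linarith)).2
    have h4 : (1 : ℂ) - α * (1 - (1 + (p - 1) / α)) = p := by field_simp; ring
    rw [h4] at h
    rw [mul_comm, h]

theorem mellin_stable_exp (hα : 0 < α) {p : ℂ} (hp0 : 1 - α < p.re) :
    MellinConvergent (fun s : ℝ => (α : ℂ) • ((s : ℂ) ^ ((α : ℂ) - 1) • ((Real.exp (-(s ^ α)) : ℝ) : ℂ))) p ∧
    mellin (fun s : ℝ => (α : ℂ) • ((s : ℂ) ^ ((α : ℂ) - 1) • ((Real.exp (-(s ^ α)) : ℝ) : ℂ))) p =
      Complex.Gamma (1 + (p - 1) / α) := by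
  have hα0 : (α : ℂ) ≠ 0 := by exact_mod_cast hα.ne'
  have hq : (p + (α - 1)) / α = 1 + (p - 1) / α := by field_simp; ring
  have hre : 0 < ((p + (α - 1)) / α).re := by
    rw [Complex.div_ofReal_re]
    refine div_pos ?_ hα
    simp
    linarith
  have hconv : MellinConvergent (fun x : ℝ => ((Real.exp (-x) : ℝ) : ℂ)) ((p + (α - 1)) / α) := by
    refine (Complex.GammaIntegral_convergent hre).congr_fun (fun x _ => ?_) measurableSet_Ioi
    simp only [smul_eq_mul]
    rw [mul_comm]
  constructor
  · refine MellinConvergent.const_smul ?_ _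
    rw [MellinConvergent.cpow_smul]
    exact (MellinConvergent.comp_rpow hα.ne').2 hconv
  · rw [mellin_const_smul, mellin_cpow_smul,
      mellin_comp_rpow (fun x : ℝ => ((Real.exp (-x) : ℝ) : ℂ)), ← Complex.GammaIntegral_eq_mellin,
      ← Complex.Gamma_eq_integral hre, hq, abs_of_pos hα]
    simp [hα0]

theorem norm_complex_Gamma_le {a : ℂ} (ha : 0 < a.re) : ‖Complex.Gamma a‖ ≤ Real.Gamma a.re := by
  have h1 := integral_cpow_mul_cexp_neg ha (w := 1) (by simp)
  have h2 := Real.integral_rpow_mul_exp_neg_mul_Ioi ha one_pos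
  rw [Complex.one_cpow, mul_one] at h1
  rw [div_one, Real.one_rpow, one_mul] at h2
  rw [← h1, ← h2]
  refine (norm_integral_le_integral_norm _).trans_eq (setIntegral_congr_fun measurableSet_Ioi ?_)
  intro ρ hρ
  simp only
  rw [norm_cpow_mul_cexp_neg hρ, Complex.one_re]

/-- On this line q has real part 1/2, and Γ(q) = Γ(q+2)/(q(q+1)) with |Γ(q+2)| ≤ Γ(5/2) gives
quadratic decay, which suffices for inversion. The factor 4 comes from |q|² ≥ (1+y²)/4. -/
theorem verticalIntegrable_gamma (hα : 0 < α) (hα1 : α < 1) (f : ℂ → ℂ)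
    (hf : ∀ y : ℝ, f ((1 - α / 2 : ℝ) + y * Complex.I) =
      Complex.Gamma (1 + (((1 - α / 2 : ℝ) + y * Complex.I) - 1) / α)) :
    Complex.VerticalIntegrable f (1 - α / 2) := by
  have hα0 : (α : ℂ) ≠ 0 := by exact_mod_cast hα.ne'
  set q : ℝ → ℂ := fun y => ((1 / 2 : ℝ) : ℂ) + ((y / α : ℝ) : ℂ) * Complex.I with hq
  have hre : ∀ y, (q y).re = 1 / 2 := fun y => by simp [hq]
  have him : ∀ y, (q y).im = y / α := fun y => by simp [hq]
  have hfq : ∀ y : ℝ, f ((1 - α / 2 : ℝ) + y * Complex.I) = Complex.Gamma (q y) := fun y => by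
    rw [hf, hq]
    congr 1
    push_cast
    field_simp
    ring
  unfold Complex.VerticalIntegrable
  simp only [hfq]
  refine (integrable_inv_one_add_sq.const_mul (4 * Real.Gamma (5 / 2))).mono' ?_ ?_
  · refine Continuous.aestronglyMeasurable (continuous_iff_continuousAt.2 fun y => ?_)
    have h1 : ContinuousAt Complex.Gamma (q y) := by
      refine (Complex.differentiableAt_Gamma _ fun m hm => ?_).continuousAt
      have h2 := congrArg Complex.re hm
      rw [hre] at h2
      simp at h2
      have : (0 : ℝ) ≤ m := m.cast_nonneg
      linarith
    refine ContinuousAt.comp (f := q) h1 (Continuous.continuousAt ?_)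
    rw [hq]
    fun_prop
  · filter_upwards with y
    have h0 : q y ≠ 0 := fun h => by have := hre y; rw [h] at this; simp at this
    have h1 : q y + 1 ≠ 0 := fun h => by
      have := congrArg Complex.re h
      rw [Complex.add_re, hre] at this
      norm_num at this
    have h2 : Complex.Gamma (q y + 1 + 1) = (q y + 1) * (q y * Complex.Gamma (q y)) := by
      rw [Complex.Gamma_add_one _ h1, Complex.Gamma_add_one _ h0]
    have h3 : ‖Complex.Gamma (q y + 1 + 1)‖ ≤ Real.Gamma (5 / 2) := by
      have h4 : (q y + 1 + 1).re = 5 / 2 := by simp [hre]; norm_num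
      rw [← h4]
      exact norm_complex_Gamma_le (by rw [h4]; norm_num)
    have hsq : ‖q y‖ ^ 2 = 1 / 4 + (y / α) ^ 2 := by
      rw [Complex.sq_norm, Complex.normSq_apply, hre, him]; ring
    have hle : ‖q y‖ ≤ ‖q y + 1‖ := by
      rw [← sq_le_sq₀ (norm_nonneg _) (norm_nonneg _), Complex.sq_norm, Complex.sq_norm,
        Complex.normSq_apply, Complex.normSq_apply]
      simp only [Complex.add_re, Complex.add_im, hre, Complex.one_re, Complex.one_im]
      linarith
    have hy : y ^ 2 ≤ (y / α) ^ 2 := by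
      rw [div_pow, le_div_iff₀ (by positivity)]
      refine mul_le_of_le_one_right (sq_nonneg y) ?_
      exact pow_le_one₀ hα.le hα1.le
    rw [h2, norm_mul, norm_mul] at h3
    have h5 : ‖q y‖ * (‖q y‖ * ‖Complex.Gamma (q y)‖) ≤ Real.Gamma (5 / 2) :=
      le_trans (by gcongr) h3
    rw [← div_eq_mul_inv, le_div_iff₀ (by positivity)]
    have h6 : ‖q y‖ ^ 2 * ‖Complex.Gamma (q y)‖ ≤ Real.Gamma (5 / 2) := by
      rw [pow_two, mul_assoc]; exact h5
    rw [hsq] at h6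
    nlinarith [norm_nonneg (Complex.Gamma (q y)), mul_le_mul_of_nonneg_right hy (norm_nonneg (Complex.Gamma (q y))),
      mul_nonneg (sq_nonneg y) (norm_nonneg (Complex.Gamma (q y)))]

/-- Both sides have the same Mellin transform on the line Re p = 1 - α/2, in the middle of the
strip, so Mellin inversion identifies them. -/
theorem stableLaplace_eq (hα : 0 < α) (hα1 : α < 1) {s : ℝ} (hs : 0 < s) :
    stableLaplace α 0 s = α * s ^ (α - 1) * Real.exp (-(s ^ α)) := by
  set σ : ℝ := 1 - α / 2 with hσ
  have hre : ∀ y : ℝ, ((σ : ℂ) + y * Complex.I).re = σ := fun y => by simp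
  have h1 := fun y : ℝ => (mellin_stableLaplace hα hα1 (p := (σ : ℂ) + y * Complex.I)
    (by rw [hre]; linarith) (by rw [hre]; linarith))
  have h2 := fun y : ℝ => (mellin_stable_exp hα (p := (σ : ℂ) + y * Complex.I)
    (by rw [hre]; linarith))
  have e1 := mellinInv_mellin_eq σ (fun s => (stableLaplace α 0 s : ℂ)) hs (by simpa using (h1 0).1)
    (verticalIntegrable_gamma hα hα1 _ fun y => (h1 y).2)
    (Complex.continuous_ofReal.continuousAt.comp (hasDerivAt_stableLaplace hα hα1 0 hs).continuousAt)
  have e2 := mellinInv_mellin_eq σ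
    (fun s : ℝ => (α : ℂ) • ((s : ℂ) ^ ((α : ℂ) - 1) • ((Real.exp (-(s ^ α)) : ℝ) : ℂ))) hs
    (by simpa using (h2 0).1) (verticalIntegrable_gamma hα hα1 _ fun y => (h2 y).2) (by
      simp only [smul_eq_mul]
      refine continuousAt_const.mul (ContinuousAt.mul ?_ ?_)
      · exact Complex.continuousAt_ofReal_cpow_const _ _ (Or.inr hs.ne')
      · refine Complex.continuous_ofReal.continuousAt.comp (Real.continuous_exp.continuousAt.comp ?_)
        exact (Real.continuousAt_rpow_const _ _ (Or.inl hs.ne')).neg)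
  have h3 : mellinInv σ (mellin fun s => (stableLaplace α 0 s : ℂ)) s = mellinInv σ
      (mellin (fun s : ℝ => (α : ℂ) • ((s : ℂ) ^ ((α : ℂ) - 1) • ((Real.exp (-(s ^ α)) : ℝ) : ℂ)))) s := by
    simp only [mellinInv, (h1 _).2, (h2 _).2]
  rw [e1, e2] at h3
  have h4 : (s : ℂ) ^ ((α : ℂ) - 1) = ((s ^ (α - 1) : ℝ) : ℂ) := by
    rw [Complex.ofReal_cpow hs.le]; push_cast; rfl
  rw [h4, smul_eq_mul, smul_eq_mul, ← Complex.ofReal_mul, ← Complex.ofReal_mul, Complex.ofReal_inj] at h3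
  rw [h3, mul_assoc]

/-- The convex cone generated by the functions `s ↦ s^(-p) exp (-s^α)`, `p ≥ 0`. -/
inductive StableCone (α : ℝ) : (ℝ → ℝ) → Prop
  | base (c p : ℝ) (hc : 0 ≤ c) (hp : 0 ≤ p) :
      StableCone α fun s => c * (s ^ (-p) * Real.exp (-(s ^ α)))
  | add (f g : ℝ → ℝ) (hf : StableCone α f) (hg : StableCone α g) : StableCone α fun s => f s + g s

theorem StableCone.nonneg {f : ℝ → ℝ} (hf : StableCone α f) {s : ℝ} (hs : 0 < s) : 0 ≤ f s := by
  induction hf with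
  | base c p hc hp => positivity
  | add f g _ _ ihf ihg => exact add_nonneg ihf ihg

/-- Differentiating a generator yields, up to sign, the exponents p + 1 and p + 1 - α, the latter
nonnegative because α < 1. Hence every member of the cone is completely monotone. -/
theorem StableCone.exists_hasDerivAt (hα : 0 < α) (hα1 : α < 1) {f : ℝ → ℝ} (hf : StableCone α f) :
    ∃ g, StableCone α g ∧ ∀ s, 0 < s → HasDerivAt f (-(g s)) s := by
  induction hf with
  | base c p hc hp =>
    refine ⟨_, StableCone.add _ _ (StableCone.base (c * p) (p + 1) (by positivity) (by positivity))
      (StableCone.base (c * α) (p + 1 - α) (by positivity) (by linarith)), fun s hs => ?_⟩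
    have h1 := Real.hasDerivAt_rpow_const (p := -p) (Or.inl hs.ne')
    have h2 := (Real.hasDerivAt_rpow_const (p := α) (Or.inl hs.ne')).neg.exp
    refine ((h1.mul h2).const_mul c).congr_deriv ?_
    have h3 : s ^ (-(p + 1)) = s ^ (-p - 1) := by congr 1; ring
    have h4 : s ^ (-(p + 1 - α)) = s ^ (-p) * s ^ (α - 1) := by
      rw [← Real.rpow_add hs]; congr 1; ring
    rw [h3, h4, Pi.neg_apply]
    ring
  | add f g _ _ ihf ihg =>
    obtain ⟨f', hf', hf''⟩ := ihf
    obtain ⟨g', hg', hg''⟩ := ihg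
    refine ⟨_, StableCone.add _ _ hf' hg', fun s hs => ?_⟩
    exact ((hf'' s hs).add (hg'' s hs)).congr_deriv (by ring)

theorem stableLaplace_nonneg (hα : 0 < α) (hα1 : α < 1) (k : ℕ) {s : ℝ} (hs : 0 < s) :
    0 ≤ stableLaplace α k s := by
  have h : ∀ k, ∃ g, StableCone α g ∧ ∀ s, 0 < s → stableLaplace α k s = g s := by
    intro k
    induction k with
    | zero =>
      refine ⟨_, StableCone.base α (1 - α) hα.le (by linarith), fun s hs => ?_⟩
      rw [stableLaplace_eq hα hα1 hs, mul_assoc]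
      congr 3
      ring
    | succ k ih =>
      obtain ⟨g, hg, hgs⟩ := ih
      obtain ⟨g', hg', hgs'⟩ := hg.exists_hasDerivAt hα hα1
      refine ⟨g', hg', fun s hs => ?_⟩
      have h1 := hasDerivAt_stableLaplace hα hα1 k hs
      have h2 : stableLaplace α k =ᶠ[𝓝 s] g := by
        filter_upwards [lt_mem_nhds hs] with r hr
        exact hgs r hr
      have h3 := ((hgs' s hs).congr_of_eventuallyEq h2).unique h1
      linarith
  obtain ⟨g, hg, hgs⟩ := h k
  rw [hgs s hs]
  exact hg.nonneg hs

/-- Unimodality of s e^{-s/y} around its peak s = y, from 1 + x ≤ e^x; the hypothesis treats s ≤ t ≤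
y and y ≤ t ≤ s together. -/
theorem mul_exp_neg_le {s t y : ℝ} (ht : 0 < t) (h : (s - t) / t ≤ (s - t) / y) :
    s * Real.exp (-(s / y)) ≤ t * Real.exp (-(t / y)) := by
  have h1 : s / t ≤ Real.exp ((s - t) / y) := by
    have : s / t = (s - t) / t + 1 := by field_simp; ring
    rw [this]
    exact (Real.add_one_le_exp _).trans (Real.exp_le_exp.2 h)
  rw [div_le_iff₀ ht] at h1
  have h2 : Real.exp (-(t / y)) = Real.exp ((s - t) / y) * Real.exp (-(s / y)) := by
    rw [← Real.exp_add]; congr 1; ring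
  rw [h2, ← mul_assoc, mul_comm t]
  gcongr

theorem mul_exp_neg_lt {s y : ℝ} (hy : 0 < y) (h : s ≠ y) :
    s * Real.exp (-(s / y)) < y * Real.exp (-(y / y)) := by
  have h1 : s / y < Real.exp ((s - y) / y) := by
    have : s / y = (s - y) / y + 1 := by field_simp; ring
    rw [this]
    exact Real.add_one_lt_exp (div_ne_zero (sub_ne_zero.2 h) hy.ne')
  rw [div_lt_iff₀ hy] at h1
  have h2 : Real.exp (-(y / y)) = Real.exp ((s - y) / y) * Real.exp (-(s / y)) := by
    rw [← Real.exp_add]; congr 1; ring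
  rw [h2, ← mul_assoc, mul_comm y]
  gcongr

/-- If all the integrals `∫ f v^(k+1)` are nonnegative, then `f ≥ 0` at a strict peak of `v ≥ 0`. -/
theorem nonneg_of_peak {f v : ℝ → ℝ} {t : ℝ} (ht : 0 < t) (hf : ContinuousAt f t)
    (hv : ContinuousAt v t) (hv0 : ∀ τ, 0 < τ → 0 < v τ)
    (hint : ∀ k : ℕ, IntegrableOn (fun τ => f τ * v τ ^ (k + 1)) (Ioi 0))
    (hnn : ∀ k : ℕ, 0 ≤ ∫ τ in Ioi (0 : ℝ), f τ * v τ ^ (k + 1))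
    (hpeak : ∀ a b, 0 < a → a < t → t < b → ∃ η, 0 < η ∧ η < v t ∧
      ∀ τ, 0 < τ → τ ∉ Ioo a b → v τ ≤ η) : 0 ≤ f t := by
  by_contra hneg
  push Not at hneg
  obtain ⟨δ, hδ, hδf⟩ : ∃ δ, 0 < δ ∧ f t < -δ := ⟨-(f t) / 2, by linarith, by linarith⟩
  obtain ⟨r, hr, hrf⟩ := Metric.eventually_nhds_iff.1 (hf.eventually (gt_mem_nhds hδf))
  set r' := min (r / 2) (t / 2) with hr'
  have hr'0 : 0 < r' := by positivity
  have hfab : ∀ τ ∈ Ioo (t - r') (t + r'), f τ < -δ := fun τ hτ => by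
    apply hrf
    rw [Real.dist_eq, abs_lt]
    have : r' ≤ r / 2 := min_le_left _ _
    constructor <;> linarith [hτ.1, hτ.2]
  have hr't : r' ≤ t / 2 := min_le_right _ _
  obtain ⟨η, hη0, hηv, hη⟩ := hpeak (t - r') (t + r') (by linarith) (by linarith) (by linarith)
  obtain ⟨η', hη1, hη2⟩ := exists_between hηv
  obtain ⟨r₂, hr₂, hr₂v⟩ := Metric.eventually_nhds_iff.1 (hv.eventually (lt_mem_nhds hη2))
  set ε := min (r₂ / 2) (r' / 2) with hε
  have hε0 : 0 < ε := by positivity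
  have hε1 : ε ≤ r₂ / 2 := min_le_left _ _
  have hε2 : ε ≤ r' / 2 := min_le_right _ _
  set I := ∫ τ in Ioi (0 : ℝ), ‖f τ * v τ ^ (0 + 1)‖ with hI
  have hη'0 : 0 < η' := hη0.trans hη1
  -- If f < -δ near t, the window of width 2ε where v > η' contributes at most -2εδη'^(k+1), while
  -- outside the larger window v ≤ η limits the positive part to η^k I. As η < η', large k
  -- contradicts nonnegativity of the integral.
  have key : ∀ k : ℕ, δ * (2 * ε) * η' ^ (k + 1) ≤ η ^ k * I := fun k => by
    have hsub : Icc (t - ε) (t + ε) ⊆ Ioi 0 := fun τ hτ => by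
      have := hτ.1
      rw [mem_Ioi]
      linarith
    have hindint : IntegrableOn ((Icc (t - ε) (t + ε)).indicator fun _ => δ * η' ^ (k + 1)) (Ioi 0) :=
      ((integrable_indicator_iff measurableSet_Icc).2 continuousOn_const.integrableOn_Icc).integrableOn
    have hle : ∫ τ in Ioi (0 : ℝ), f τ * v τ ^ (k + 1) ≤ ∫ τ in Ioi (0 : ℝ),
        (η ^ k * ‖f τ * v τ ^ (0 + 1)‖ - (Icc (t - ε) (t + ε)).indicator (fun _ => δ * η' ^ (k + 1)) τ) := by
      refine setIntegral_mono_on (hint k) (((hint 0).norm.const_mul _).sub hindint) measurableSet_Ioi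
        fun τ hτ => ?_
      have hvτ := hv0 τ hτ
      have hfirst : 0 ≤ η ^ k * ‖f τ * v τ ^ (0 + 1)‖ := by positivity
      by_cases h1 : τ ∈ Icc (t - ε) (t + ε)
      · rw [indicator_of_mem h1]
        have h2 : f τ < -δ := hfab τ ⟨by linarith [h1.1], by linarith [h1.2]⟩
        have h3 : η' < v τ := hr₂v (by
          rw [Real.dist_eq, abs_lt]; constructor <;> linarith [h1.1, h1.2])
        have h4 : η' ^ (k + 1) ≤ v τ ^ (k + 1) := by gcongr
        have h5 : 0 < v τ ^ (k + 1) := by positivity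
        nlinarith
      · rw [indicator_of_notMem h1, sub_zero]
        by_cases h2 : τ ∈ Ioo (t - r') (t + r')
        · have h3 := hfab τ h2
          have h5 : 0 < v τ ^ (k + 1) := by positivity
          nlinarith
        · have h3 := hη τ hτ h2
          calc f τ * v τ ^ (k + 1) = v τ ^ k * (f τ * v τ ^ (0 + 1)) := by ring
            _ ≤ v τ ^ k * ‖f τ * v τ ^ (0 + 1)‖ := by gcongr; exact le_abs_self _
            _ ≤ _ := by gcongr
    rw [integral_sub ((hint 0).norm.const_mul _) hindint, integral_const_mul,
      setIntegral_indicator measurableSet_Icc, inter_eq_right.2 hsub, setIntegral_const] at hle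
    have hvol : volume.real (Icc (t - ε) (t + ε)) = 2 * ε := by
      rw [Real.volume_real_Icc_of_le (by linarith)]; ring
    rw [hvol, smul_eq_mul] at hle
    have := (hnn k).trans hle
    linarith
  have hlim : Tendsto (fun k : ℕ => (η / η') ^ k * I) atTop (𝓝 0) := by
    simpa using (tendsto_pow_atTop_nhds_zero_of_lt_one (by positivity)
      ((div_lt_one hη'0).2 hη1)).mul_const I
  have hge : ∀ k : ℕ, δ * (2 * ε) * η' ≤ (η / η') ^ k * I := fun k => by
    have h1 := key k
    rw [div_pow, div_mul_eq_mul_div, le_div_iff₀ (by positivity)]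
    calc _ = _ := by ring
      _ ≤ _ := h1
  have h2 := ge_of_tendsto' hlim hge
  have : 0 < δ * (2 * ε) * η' := by positivity
  linarith

/-- The Wright function `Φ_α` is nonnegative on `(0, ∞)`. -/
theorem wright_nonneg (hα : 0 < α) (hα1 : α < 1) {t : ℝ} (ht : 0 < t) : 0 ≤ wright α t := by
  set y : ℝ → ℝ := fun τ => τ ^ (-α⁻¹) with hy
  have hypos : ∀ τ, 0 < τ → 0 < y τ := fun τ hτ => Real.rpow_pos_of_pos hτ _
  have hyanti : ∀ τ τ', 0 < τ → τ < τ' → y τ' < y τ := fun τ τ' h h' =>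
    Real.rpow_lt_rpow_of_neg h h' (by simpa using hα)
  -- Taking s = (k+1)/y(t) makes y^{k+1} e^{-sy} the (k+1)-st power of v = y e^{-y/y(t)}, whose
  -- strict peak is at τ = t: this is Post–Widder inversion.
  have hrw : ∀ (k : ℕ) (τ : ℝ), wright α τ * (y τ * Real.exp (-(y τ / y t))) ^ (k + 1) =
      wright α τ * ((τ ^ (-α⁻¹)) ^ (k + 1) * Real.exp (-((k + 1) / y t * τ ^ (-α⁻¹)))) := fun k τ => by
    rw [mul_pow, ← Real.exp_nat_mul]
    congr 3
    push_cast
    ring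
  have hs : ∀ k : ℕ, 0 < ((k : ℝ) + 1) / y t := fun k => by have := hypos t ht; positivity
  refine nonneg_of_peak (v := fun τ => y τ * Real.exp (-(y τ / y t))) ht
    ((continuousOn_wright hα hα1).continuousAt (Ici_mem_nhds ht)) ?_
    (fun τ hτ => mul_pos (hypos τ hτ) (Real.exp_pos _)) ?_ ?_ ?_
  · have h1 : ContinuousAt y t := Real.continuousAt_rpow_const _ _ (Or.inl ht.ne')
    exact h1.mul (Real.continuous_exp.continuousAt.comp (h1.div_const _).neg)
  · intro k
    simp only [hrw]
    exact integrableOn_stableLaplace hα hα1 k (hs k)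
  · intro k
    simp only [hrw]
    exact stableLaplace_nonneg hα hα1 k (hs k)
  · intro a b ha hat htb
    have hb : 0 < b := ht.trans htb
    refine ⟨max (y a * Real.exp (-(y a / y t))) (y b * Real.exp (-(y b / y t))),
      lt_max_of_lt_left (mul_pos (hypos a ha) (Real.exp_pos _)), max_lt ?_ ?_, ?_⟩
    · exact mul_exp_neg_lt (hypos t ht) (hyanti a t ha hat).ne'
    · exact mul_exp_neg_lt (hypos t ht) (hyanti t b ht htb).ne
    · intro τ hτ hτab
      have h1 : τ ≤ a ∨ b ≤ τ := by
        by_contra hcon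
        push Not at hcon
        exact hτab hcon
      rcases h1 with h1 | h1
      · refine le_max_of_le_left (mul_exp_neg_le (hypos a ha) ?_)
        have h2 : y a ≤ y τ := Real.rpow_le_rpow_of_nonpos hτ h1 (by simpa using hα.le)
        exact div_le_div_of_nonneg_left (by linarith) (hypos t ht) (hyanti a t ha hat).le
      · refine le_max_of_le_right (mul_exp_neg_le (hypos b hb) ?_)
        have h2 : y τ ≤ y b := Real.rpow_le_rpow_of_nonpos hb h1 (by simpa using hα.le)
        rw [div_le_div_iff₀ (hypos b hb) (hypos t ht)]
        exact mul_le_mul_of_nonpos_left (hyanti t b ht htb).le (by linarith)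

end WrightPositivity

/-! ### The integrable majorant and positivity of Φ_α near 0. -/

section Weight

/-- The integrable majorant of the double integrals. -/
def wrightWeight (α : ℝ) (p : ℝ × ℝ) : ℝ :=
  (p.1 ^ ((1 / 2 : ℝ) - 1) * wright α p.1) * (p.2 ^ ((1 / 2 : ℝ) - 1) * wright α p.2)

variable {α : ℝ}

theorem integrableOn_wrightWeight (hα : 0 < α) (hα1 : α < 1) :
    IntegrableOn (wrightWeight α) (Ioi 0 ×ˢ Ioi 0) := by
  have h := integrableOn_rpow_mul_wright hα hα1 (x := 1 / 2) (by norm_num) (by norm_num)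
  have := Integrable.mul_prod h h
  rwa [Measure.prod_restrict, ← Measure.volume_eq_prod] at this

theorem inv_add_le_rpow_mul_rpow {a b : ℝ} (ha : 0 < a) (hb : 0 < b) :
    (a + b)⁻¹ ≤ a ^ ((1 / 2 : ℝ) - 1) * b ^ ((1 / 2 : ℝ) - 1) := by
  have e : ∀ x : ℝ, 0 < x → x ^ ((1 / 2 : ℝ) - 1) = (√x)⁻¹ := fun x hx => by
    rw [Real.sqrt_eq_rpow, ← Real.rpow_neg hx.le]; norm_num
  rw [e a ha, e b hb, ← mul_inv]
  have h1 := Real.sqrt_pos.2 ha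
  have h2 := Real.sqrt_pos.2 hb
  refine inv_anti₀ (by positivity) ?_
  nlinarith [Real.sq_sqrt ha.le, Real.sq_sqrt hb.le, sq_nonneg (√a - √b)]

theorem wright_mul_inv_le_wrightWeight (hα : 0 < α) (hα1 : α < 1) {a b : ℝ} (ha : 0 < a) (hb : 0 < b) :
    wright α a * wright α b * (a + b)⁻¹ ≤ wrightWeight α (a, b) := by
  have := mul_le_mul_of_nonneg_left (inv_add_le_rpow_mul_rpow ha hb)
    (mul_nonneg (wright_nonneg hα hα1 ha) (wright_nonneg hα hα1 hb))
  refine this.trans (le_of_eq ?_)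
  simp only [wrightWeight]; ring

theorem continuousOn_wright_mul_wright (hα : 0 < α) (hα1 : α < 1) :
    ContinuousOn (fun p : ℝ × ℝ => wright α p.1 * wright α p.2) (Ioi 0 ×ˢ Ioi 0) :=
  (((continuousOn_wright hα hα1).mono Ioi_subset_Ici_self).comp continuousOn_fst fun _ h => h.1).mul
    (((continuousOn_wright hα hα1).mono Ioi_subset_Ici_self).comp continuousOn_snd fun _ h => h.2)

theorem exists_wright_pos (hα : 0 < α) (hα1 : α < 1) :
    ∃ δ > 0, ∀ t, 0 < t → t < δ → 0 < wright α t := by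
  have h : ∀ᶠ t in 𝓝[≥] (0 : ℝ), 0 < wright α t :=
    (continuousOn_wright hα hα1 0 self_mem_Ici).eventually (lt_mem_nhds (wright_zero_pos hα1))
  obtain ⟨δ, hδ, h⟩ := Metric.mem_nhdsWithin_iff.1 h
  refine ⟨δ, hδ, fun t ht htδ => h ⟨?_, ht.le⟩⟩
  simpa [abs_of_pos ht] using htδ

end Weight

theorem setIntegral_quadrant_pos {f : ℝ × ℝ → ℝ} (hf : IntegrableOn f (Ioi 0 ×ˢ Ioi 0))
    (h0 : ∀ p ∈ Ioi (0 : ℝ) ×ˢ Ioi (0 : ℝ), 0 ≤ f p) {δ : ℝ} (hδ : 0 < δ)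
    (hp : ∀ p ∈ Ioo (0 : ℝ) δ ×ˢ Ioo (0 : ℝ) δ, 0 < f p) :
    0 < ∫ p in Ioi (0 : ℝ) ×ˢ Ioi (0 : ℝ), f p := by
  have hm : MeasurableSet (Ioi (0 : ℝ) ×ˢ Ioi (0 : ℝ)) := measurableSet_Ioi.prod measurableSet_Ioi
  rw [setIntegral_pos_iff_support_of_nonneg_ae
    ((ae_restrict_iff' hm).2 (Eventually.of_forall h0)) hf]
  refine lt_of_lt_of_le ?_ (measure_mono (s := Ioo (0 : ℝ) δ ×ˢ Ioo (0 : ℝ) δ)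
    fun p h => ⟨(hp p h).ne', h.1.1, h.2.1⟩)
  exact ((isOpen_Ioo.prod isOpen_Ioo).measure_pos _ ⟨(δ / 2, δ / 2), by simp [hδ]⟩)

/-! ### The scalar densities of the energy and of the Gram matrix. -/

section Density

variable {H : Type*} [NormedAddCommGroup H] [InnerProductSpace ℝ H] [CompleteSpace H] {n : ℕ}
  {K : H →L[ℝ] H} {Q : Fin n → H →L[ℝ] H} {l : Fin n → ℝ}

/-- `⟨A_i e^{-A(x)} u, u⟩`. -/
def energyDensity (K : H →L[ℝ] H) (Q : Fin n → H →L[ℝ] H) (u : H) (i : Fin n) (x : Fin n → ℝ) : ℝ :=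
  inner ℝ u (Q i (limExp K Q 1 x u))

/-- `⟨A_i A_j e^{-A(x)} u, u⟩`. -/
def gramDensity (K : H →L[ℝ] H) (Q : Fin n → H →L[ℝ] H) (u : H) (i j : Fin n) (x : Fin n → ℝ) : ℝ :=
  inner ℝ u (Q i (Q j (limExp K Q 2 x u)))

namespace IsBoundedModel

variable (M : IsBoundedModel K Q l)

include M

theorem abs_energyDensity_le (u : H) (i : Fin n) {c : ℝ} (hc : 0 < c) {x : Fin n → ℝ}
    (hx : ∀ i, c * l i ≤ x i) : |energyDensity K Q u i x| ≤ ‖Q i‖ * ‖u‖ ^ 2 * c⁻¹ := by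
  have h := M.norm_limExp_le 1 hc hx
  simp only [Nat.factorial_one, Nat.cast_one, pow_one, one_div] at h
  calc _ ≤ ‖u‖ * ‖Q i (limExp K Q 1 x u)‖ := abs_real_inner_le_norm _ _
    _ ≤ ‖u‖ * (‖Q i‖ * (c⁻¹ * ‖u‖)) := by
      gcongr
      exact (Q i).le_opNorm_of_le ((limExp K Q 1 x).le_of_opNorm_le h u)
    _ = _ := by ring

theorem abs_gramDensity_le (u : H) (i j : Fin n) {c : ℝ} (hc : 0 < c) {x : Fin n → ℝ}
    (hx : ∀ i, c * l i ≤ x i) :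
    |gramDensity K Q u i j x| ≤ 2 * ‖Q i‖ * ‖Q j‖ * ‖u‖ ^ 2 * (c ^ 2)⁻¹ := by
  have h := M.norm_limExp_le 2 hc hx
  simp only [Nat.factorial_two, Nat.cast_ofNat, div_eq_mul_inv] at h
  calc _ ≤ ‖u‖ * ‖Q i (Q j (limExp K Q 2 x u))‖ := abs_real_inner_le_norm _ _
    _ ≤ ‖u‖ * (‖Q i‖ * (‖Q j‖ * (2 * (c ^ 2)⁻¹ * ‖u‖))) := by
      gcongr
      exact (Q i).le_opNorm_of_le ((Q j).le_opNorm_of_le ((limExp K Q 2 x).le_of_opNorm_le h u))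
    _ = _ := by ring

theorem continuousOn_energyDensity (u : H) (i : Fin n) :
    ContinuousOn (energyDensity K Q u i) (posOrthant n) :=
  ContinuousOn.inner continuousOn_const ((Q i).continuous.comp_continuousOn
    ((M.continuousOn_limExp 1).clm_apply continuousOn_const))

theorem continuousOn_gramDensity (u : H) (i j : Fin n) :
    ContinuousOn (gramDensity K Q u i j) (posOrthant n) :=
  ContinuousOn.inner continuousOn_const ((Q i).continuous.comp_continuousOn ((Q j).continuous.comp_continuousOn
    ((M.continuousOn_limExp 2).clm_apply continuousOn_const)))

/-- One self-adjoint factor e^{-A(x)} moves across the inner product and merges with the other: two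
half times become one full time, and a single x-derivative remains to be taken. -/
theorem inner_limExp_one_zero (u : H) (i : Fin n) {x : Fin n → ℝ} (hx : x ∈ posOrthant n) :
    inner ℝ (Q i (limExp K Q 1 x u)) (limExp K Q 0 x u) = energyDensity K Q u i (x + x) := by
  have e : limExp K Q 0 x * (Q i * limExp K Q 1 x) = Q i * limExp K Q 1 (x + x) := by
    rw [← mul_assoc, ← (M.commute_T_limExp i 0 hx).eq, mul_assoc, M.limExp_mul 0 1 hx hx]
  rw [real_inner_comm, sa_inner (M.isSelfAdjoint_limExp 0 hx)]
  exact congrArg (fun S : H →L[ℝ] H => inner ℝ u (S u)) e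

theorem inner_limExp_one_one (u : H) (i j : Fin n) {x : Fin n → ℝ} (hx : x ∈ posOrthant n) :
    inner ℝ (Q i (limExp K Q 1 x u)) (Q j (limExp K Q 1 x u)) = gramDensity K Q u i j (x + x) := by
  have e : limExp K Q 1 x * (Q i * (Q j * limExp K Q 1 x)) = Q i * (Q j * limExp K Q 2 (x + x)) := by
    rw [← mul_assoc, ← (M.commute_T_limExp i 1 hx).eq, mul_assoc, ← mul_assoc _ (Q j),
      ← (M.commute_T_limExp j 1 hx).eq, mul_assoc, M.limExp_mul 1 1 hx hx]
  rw [sa_inner (M.T_sa i), sa_inner (M.isSelfAdjoint_limExp 1 hx)]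
  exact congrArg (fun S : H →L[ℝ] H => inner ℝ u (S u)) e

theorem hasFDerivAt_energyDensity (u : H) (i : Fin n) {x : Fin n → ℝ} (hx : x ∈ posOrthant n) :
    HasFDerivAt (energyDensity K Q u i)
      (∑ j, (-gramDensity K Q u i j x) • ContinuousLinearMap.proj (R := ℝ) (φ := fun _ => ℝ) j) x := by
  have h := (((innerSL ℝ u).comp (Q i)).comp (ContinuousLinearMap.apply ℝ H u)).hasFDerivAt.comp x
    (M.hasFDerivAt_limExp 1 hx)
  refine h.congr_fderiv (ContinuousLinearMap.ext fun v => ?_)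
  simp [symbol_apply, gramDensity, mul_comm, _root_.sum_apply]

end IsBoundedModel

end Density

theorem setOf_lt_mem_nhds {n : ℕ} {z x : Fin n → ℝ} (hx : ∀ i, z i < x i) :
    {y : Fin n → ℝ | ∀ i, z i < y i} ∈ 𝓝 x := by
  simp only [ofPred_forall]
  exact (isOpen_iInter_of_finite fun i => isOpen_lt continuous_const (continuous_apply i)).mem_nhds
    (mem_iInter.2 hx)

/-! ### Domination, differentiation under the integral and the C¹ property. -/

namespace Represents

variable {H : Type*} [NormedAddCommGroup H] [InnerProductSpace ℝ H] [CompleteSpace H] {n : ℕ}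
  {A : Fin n → H →ₗ.[ℝ] H} {K : H →L[ℝ] H} {Q : Fin n → H →L[ℝ] H} {l : Fin n → ℝ}
  (R : Represents A K Q) (M : IsBoundedModel K Q l) {α T : ℝ} (hT : 0 < T)

include R M hT

theorem evolved_eq {x : Fin n → ℝ} (hx : x ∈ posOrthant n) {τ σ : ℝ} (hτ : 0 < τ) (hσ : 0 < σ) (u : H) :
    evolved A u T α x τ σ = limExp K Q 0 (((τ + σ) / 2 * T ^ α) • x) u := by
  rw [evolved, R.expNeg_opSum_apply M hx (by positivity)]

theorem appl_evolved_eq {x : Fin n → ℝ} (hx : x ∈ posOrthant n) {τ σ : ℝ} (hτ : 0 < τ) (hσ : 0 < σ)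
    (u : H) (i : Fin n) :
    appl (A i) (evolved A u T α x τ σ) = Q i (limExp K Q 1 (((τ + σ) / 2 * T ^ α) • x) u) := by
  rw [evolved, R.expNeg_opSum_eq_K M hx (by positivity), R.appl_eq]

theorem energyIntegrand_eq {x : Fin n → ℝ} (hx : x ∈ posOrthant n) {τ σ : ℝ} (hτ : 0 < τ) (hσ : 0 < σ)
    (u : H) (i : Fin n) :
    energyIntegrand A u T α x i τ σ =
      wright α τ * wright α σ * energyDensity K Q u i (((τ + σ) * T ^ α) • x) := by
  rw [energyIntegrand, R.appl_evolved_eq M hT hx hτ hσ, R.evolved_eq M hT hx hτ hσ,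
    M.inner_limExp_one_zero u i (smul_mem_posOrthant hx (by positivity)), ← add_smul]
  congr 3; ring

theorem gramIntegrand_eq {x : Fin n → ℝ} (hx : x ∈ posOrthant n) {τ σ : ℝ} (hτ : 0 < τ) (hσ : 0 < σ)
    (u : H) (i j : Fin n) :
    gramIntegrand A u T α x i j τ σ =
      (τ + σ) * wright α τ * wright α σ * gramDensity K Q u i j (((τ + σ) * T ^ α) • x) := by
  rw [gramIntegrand, R.appl_evolved_eq M hT hx hτ hσ, R.appl_evolved_eq M hT hx hτ hσ,
    M.inner_limExp_one_one u i j (smul_mem_posOrthant hx (by positivity)), ← add_smul]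
  congr 3; ring

theorem continuousOn_energyIntegrand (hα : 0 < α) (hα1 : α < 1) {x : Fin n → ℝ} (hx : x ∈ posOrthant n)
    (u : H) (i : Fin n) :
    ContinuousOn (fun p : ℝ × ℝ => energyIntegrand A u T α x i p.1 p.2) (Ioi 0 ×ˢ Ioi 0) := by
  refine ContinuousOn.congr ?_ fun p hp => R.energyIntegrand_eq M hT hx hp.1 hp.2 u i
  refine (continuousOn_wright_mul_wright hα hα1).mul
    ((M.continuousOn_energyDensity u i).comp (by fun_prop) fun p hp => smul_mem_posOrthant hx ?_)
  exact mul_pos (add_pos hp.1 hp.2) (by positivity)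

theorem continuousOn_gramIntegrand (hα : 0 < α) (hα1 : α < 1) {x : Fin n → ℝ} (hx : x ∈ posOrthant n)
    (u : H) (i j : Fin n) :
    ContinuousOn (fun p : ℝ × ℝ => gramIntegrand A u T α x i j p.1 p.2) (Ioi 0 ×ˢ Ioi 0) := by
  refine ContinuousOn.congr (f := fun p : ℝ × ℝ => (p.1 + p.2) * (wright α p.1 * wright α p.2) *
    gramDensity K Q u i j (((p.1 + p.2) * T ^ α) • x)) ?_ fun p hp =>
      (R.gramIntegrand_eq M hT hx hp.1 hp.2 u i j).trans (by ring)
  refine (ContinuousOn.mul (by fun_prop) (continuousOn_wright_mul_wright hα hα1)).mul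
    ((M.continuousOn_gramDensity u i j).comp (by fun_prop) fun p hp => smul_mem_posOrthant hx ?_)
  exact mul_pos (add_pos hp.1 hp.2) (by positivity)

theorem abs_energyIntegrand_le (hα : 0 < α) (hα1 : α < 1) {c : ℝ} (hc : 0 < c) {x : Fin n → ℝ}
    (hx : ∀ i, c * l i ≤ x i) (u : H) (i : Fin n) {p : ℝ × ℝ} (hp : p ∈ Ioi (0 : ℝ) ×ˢ Ioi (0 : ℝ)) :
    |energyIntegrand A u T α x i p.1 p.2| ≤
      ‖Q i‖ * ‖u‖ ^ 2 * (T ^ α * c)⁻¹ * wrightWeight α p := by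
  have hm : 0 < T ^ α := by positivity
  obtain ⟨h1 : 0 < p.1, h2 : 0 < p.2⟩ := hp
  have hr : 0 < (p.1 + p.2) * T ^ α := by positivity
  have hw := mul_nonneg (wright_nonneg hα hα1 h1) (wright_nonneg hα hα1 h2)
  rw [R.energyIntegrand_eq M hT (M.mem_posOrthant_of_le hc hx) h1 h2, abs_mul, abs_of_nonneg hw]
  have hb := M.abs_energyDensity_le u i (mul_pos hr hc) (x := ((p.1 + p.2) * T ^ α) • x) fun i => by
    simpa [mul_assoc] using mul_le_mul_of_nonneg_left (hx i) hr.le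
  calc _ ≤ wright α p.1 * wright α p.2 * (‖Q i‖ * ‖u‖ ^ 2 * ((p.1 + p.2) * T ^ α * c)⁻¹) :=
        mul_le_mul_of_nonneg_left hb hw
    _ = ‖Q i‖ * ‖u‖ ^ 2 * (T ^ α * c)⁻¹ * (wright α p.1 * wright α p.2 * (p.1 + p.2)⁻¹) := by
        rw [mul_assoc (p.1 + p.2), mul_inv (p.1 + p.2)]; ring
    _ ≤ _ := mul_le_mul_of_nonneg_left (wright_mul_inv_le_wrightWeight hα hα1 h1 h2) (by positivity)

/-- Two operators cost (τ+σ)⁻², but the extra weight τ+σ restores the rate (τ+σ)⁻¹ of the energy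
integrand, so the same majorant serves. -/
theorem abs_gramIntegrand_le (hα : 0 < α) (hα1 : α < 1) {c : ℝ} (hc : 0 < c) {x : Fin n → ℝ}
    (hx : ∀ i, c * l i ≤ x i) (u : H) (i j : Fin n) {p : ℝ × ℝ}
    (hp : p ∈ Ioi (0 : ℝ) ×ˢ Ioi (0 : ℝ)) :
    |gramIntegrand A u T α x i j p.1 p.2| ≤
      2 * ‖Q i‖ * ‖Q j‖ * ‖u‖ ^ 2 * ((T ^ α * c) ^ 2)⁻¹ * wrightWeight α p := by
  have hm : 0 < T ^ α := by positivity
  obtain ⟨h1 : 0 < p.1, h2 : 0 < p.2⟩ := hp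
  have h12 : 0 < p.1 + p.2 := by positivity
  have hr : 0 < (p.1 + p.2) * T ^ α := by positivity
  have hw := mul_nonneg (wright_nonneg hα hα1 h1) (wright_nonneg hα hα1 h2)
  rw [R.gramIntegrand_eq M hT (M.mem_posOrthant_of_le hc hx) h1 h2, mul_assoc (p.1 + p.2), abs_mul,
    abs_of_nonneg (mul_nonneg h12.le hw)]
  have hb := M.abs_gramDensity_le u i j (mul_pos hr hc) (x := ((p.1 + p.2) * T ^ α) • x) fun i => by
    simpa [mul_assoc] using mul_le_mul_of_nonneg_left (hx i) hr.le
  calc _ ≤ (p.1 + p.2) * (wright α p.1 * wright α p.2) *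
          (2 * ‖Q i‖ * ‖Q j‖ * ‖u‖ ^ 2 * (((p.1 + p.2) * T ^ α * c) ^ 2)⁻¹) :=
        mul_le_mul_of_nonneg_left hb (mul_nonneg h12.le hw)
    _ = 2 * ‖Q i‖ * ‖Q j‖ * ‖u‖ ^ 2 * ((T ^ α * c) ^ 2)⁻¹ *
          (wright α p.1 * wright α p.2 * (p.1 + p.2)⁻¹) := by field_simp
    _ ≤ _ := mul_le_mul_of_nonneg_left (wright_mul_inv_le_wrightWeight hα hα1 h1 h2) (by positivity)

theorem aestronglyMeasurable_energyIntegrand (hα : 0 < α) (hα1 : α < 1) {x : Fin n → ℝ}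
    (hx : x ∈ posOrthant n) (u : H) (i : Fin n) :
    AEStronglyMeasurable (fun p : ℝ × ℝ => energyIntegrand A u T α x i p.1 p.2)
      (volume.restrict (Ioi 0 ×ˢ Ioi 0)) :=
  (R.continuousOn_energyIntegrand M hT hα hα1 hx u i).aestronglyMeasurable
    (measurableSet_Ioi.prod measurableSet_Ioi)

theorem aestronglyMeasurable_gramIntegrand (hα : 0 < α) (hα1 : α < 1) {x : Fin n → ℝ}
    (hx : x ∈ posOrthant n) (u : H) (i j : Fin n) :
    AEStronglyMeasurable (fun p : ℝ × ℝ => gramIntegrand A u T α x i j p.1 p.2)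
      (volume.restrict (Ioi 0 ×ˢ Ioi 0)) :=
  (R.continuousOn_gramIntegrand M hT hα hα1 hx u i j).aestronglyMeasurable
    (measurableSet_Ioi.prod measurableSet_Ioi)

theorem integrableOn_energyIntegrand (hα : 0 < α) (hα1 : α < 1) {x : Fin n → ℝ}
    (hx : x ∈ posOrthant n) (u : H) (i : Fin n) :
    IntegrableOn (fun p : ℝ × ℝ => energyIntegrand A u T α x i p.1 p.2) (Ioi 0 ×ˢ Ioi 0) := by
  obtain ⟨c, hc, hcx⟩ := exists_coercivity l hx
  refine ((integrableOn_wrightWeight hα hα1).const_mul (‖Q i‖ * ‖u‖ ^ 2 * (T ^ α * c)⁻¹)).mono'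
    (R.aestronglyMeasurable_energyIntegrand M hT hα hα1 hx u i) ?_
  filter_upwards [ae_restrict_mem (measurableSet_Ioi.prod measurableSet_Ioi)] with p hp
  exact R.abs_energyIntegrand_le M hT hα hα1 hc (fun i => (hcx i).le) u i hp

theorem integrableOn_gramIntegrand (hα : 0 < α) (hα1 : α < 1) {x : Fin n → ℝ}
    (hx : x ∈ posOrthant n) (u : H) (i j : Fin n) :
    IntegrableOn (fun p : ℝ × ℝ => gramIntegrand A u T α x i j p.1 p.2) (Ioi 0 ×ˢ Ioi 0) := by
  obtain ⟨c, hc, hcx⟩ := exists_coercivity l hx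
  refine ((integrableOn_wrightWeight hα hα1).const_mul
    (2 * ‖Q i‖ * ‖Q j‖ * ‖u‖ ^ 2 * ((T ^ α * c) ^ 2)⁻¹)).mono'
    (R.aestronglyMeasurable_gramIntegrand M hT hα hα1 hx u i j) ?_
  filter_upwards [ae_restrict_mem (measurableSet_Ioi.prod measurableSet_Ioi)] with p hp
  exact R.abs_gramIntegrand_le M hT hα hα1 hc (fun i => (hcx i).le) u i j hp

theorem energyMap_eq (hα : 0 < α) (hα1 : α < 1) {x : Fin n → ℝ} (hx : x ∈ posOrthant n) (u : H)
    (i : Fin n) : energyMap A u T α x i =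
      ∫ p in Ioi (0 : ℝ) ×ˢ Ioi (0 : ℝ), energyIntegrand A u T α x i p.1 p.2 := by
  have h := R.integrableOn_energyIntegrand M hT hα hα1 hx u i
  rw [Measure.volume_eq_prod] at h ⊢
  exact (setIntegral_prod _ h).symm

theorem gramMatrix_apply (hα : 0 < α) (hα1 : α < 1) {x : Fin n → ℝ} (hx : x ∈ posOrthant n) (u : H)
    (i j : Fin n) : gramMatrix A u T α x i j =
      ∫ p in Ioi (0 : ℝ) ×ˢ Ioi (0 : ℝ), gramIntegrand A u T α x i j p.1 p.2 := by
  have h := R.integrableOn_gramIntegrand M hT hα hα1 hx u i j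
  rw [Measure.volume_eq_prod] at h ⊢
  exact (setIntegral_prod _ h).symm

theorem hasFDerivAt_energyIntegrand {x : Fin n → ℝ} (hx : x ∈ posOrthant n) (u : H) (i : Fin n)
    {p : ℝ × ℝ} (hp : p ∈ Ioi (0 : ℝ) ×ˢ Ioi (0 : ℝ)) :
    HasFDerivAt (fun y => energyIntegrand A u T α y i p.1 p.2)
      (∑ j, (-(T ^ α) * gramIntegrand A u T α x i j p.1 p.2) •
        ContinuousLinearMap.proj (R := ℝ) (φ := fun _ => ℝ) j) x := by
  obtain ⟨h1 : 0 < p.1, h2 : 0 < p.2⟩ := hp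
  have hr : 0 < (p.1 + p.2) * T ^ α := by positivity
  have hd := ((M.hasFDerivAt_energyDensity u i (smul_mem_posOrthant hx hr)).comp x
    (((p.1 + p.2) * T ^ α) • ContinuousLinearMap.id ℝ (Fin n → ℝ)).hasFDerivAt).const_mul
    (wright α p.1 * wright α p.2)
  refine (hd.congr_of_eventuallyEq ?_).congr_fderiv (ContinuousLinearMap.ext fun v => ?_)
  · filter_upwards [(isOpen_posOrthant n).mem_nhds hx] with y hy
    exact R.energyIntegrand_eq M hT hy h1 h2 u i
  · simp only [R.gramIntegrand_eq M hT hx h1 h2, _root_.sum_apply, _root_.smul_apply,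
      ContinuousLinearMap.comp_apply, ContinuousLinearMap.proj_apply, smul_eq_mul, Finset.mul_sum,
      ContinuousLinearMap.id_apply, Pi.smul_apply]
    exact Finset.sum_congr rfl fun j _ => by ring

/-- On the neighbourhood {y > c l} of x the majorant of the derivative does not depend on y. -/
theorem hasFDerivAt_energyMap (hα : 0 < α) (hα1 : α < 1) {x : Fin n → ℝ} (hx : x ∈ posOrthant n)
    (u : H) (i : Fin n) :
    HasFDerivAt (fun y => energyMap A u T α y i)
      (∑ j, (-(T ^ α) * gramMatrix A u T α x i j) •
        ContinuousLinearMap.proj (R := ℝ) (φ := fun _ => ℝ) j) x := by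
  obtain ⟨c, hc, hcx⟩ := exists_coercivity l hx
  have hpos : ∀ y ∈ {y : Fin n → ℝ | ∀ i, c * l i < y i}, y ∈ posOrthant n := fun y hy =>
    M.mem_posOrthant_of_le hc fun i => (hy i).le
  have hs := setOf_lt_mem_nhds hcx
  have hmem : ∀ᵐ p ∂(volume.restrict (Ioi (0 : ℝ) ×ˢ Ioi (0 : ℝ))), p ∈ Ioi (0 : ℝ) ×ˢ Ioi (0 : ℝ) :=
    ae_restrict_mem (measurableSet_Ioi.prod measurableSet_Ioi)
  have hG := fun j => ((R.integrableOn_gramIntegrand M hT hα hα1 hx u i j).const_mul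
    (-(T ^ α))).smul_const (ContinuousLinearMap.proj (R := ℝ) (φ := fun _ : Fin n => ℝ) j)
  have key := hasFDerivAt_integral_of_dominated_of_fderiv_le (𝕜 := ℝ)
    (μ := volume.restrict (Ioi (0 : ℝ) ×ˢ Ioi (0 : ℝ)))
    (F := fun y p => energyIntegrand A u T α y i p.1 p.2)
    (F' := fun y p => ∑ j, (-(T ^ α) * gramIntegrand A u T α y i j p.1 p.2) •
        ContinuousLinearMap.proj (R := ℝ) (φ := fun _ => ℝ) j)
    (bound := fun p => ∑ j, (T ^ α * (2 * ‖Q i‖ * ‖Q j‖ * ‖u‖ ^ 2 * ((T ^ α * c) ^ 2)⁻¹ *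
      wrightWeight α p)) * ‖ContinuousLinearMap.proj (R := ℝ) (φ := fun _ : Fin n => ℝ) j‖)
    hs
    (by filter_upwards [hs] with y hy
        exact R.aestronglyMeasurable_energyIntegrand M hT hα hα1 (hpos y hy) u i)
    (R.integrableOn_energyIntegrand M hT hα hα1 hx u i)
    (integrable_finsetSum _ fun j _ => hG j).aestronglyMeasurable
    (by filter_upwards [hmem] with p hp y hy
        refine (norm_sum_le _ _).trans (Finset.sum_le_sum fun j _ => ?_)
        rw [norm_smul, norm_mul, norm_neg, Real.norm_of_nonneg (by positivity : 0 ≤ T ^ α)]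
        gcongr
        exact R.abs_gramIntegrand_le M hT hα hα1 hc (fun i => (hy i).le) u i j hp)
    (integrable_finsetSum _ fun j _ =>
      (((integrableOn_wrightWeight hα hα1).const_mul _).const_mul _).mul_const _)
    (by filter_upwards [hmem] with p hp y hy
        exact R.hasFDerivAt_energyIntegrand M hT (hpos y hy) u i hp)
  refine (key.congr_of_eventuallyEq ?_).congr_fderiv ?_
  · filter_upwards [hs] with y hy
    exact R.energyMap_eq M hT hα hα1 (hpos y hy) u i
  · rw [integral_finsetSum _ fun j _ => hG j]
    refine Finset.sum_congr rfl fun j _ => ?_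
    rw [integral_smul_const, integral_const_mul, R.gramMatrix_apply M hT hα hα1 hx]

theorem continuousAt_gramMatrix (hα : 0 < α) (hα1 : α < 1) {x : Fin n → ℝ} (hx : x ∈ posOrthant n)
    (u : H) (i j : Fin n) : ContinuousAt (fun y => gramMatrix A u T α y i j) x := by
  obtain ⟨c, hc, hcx⟩ := exists_coercivity l hx
  have hpos : ∀ y ∈ {y : Fin n → ℝ | ∀ i, c * l i < y i}, y ∈ posOrthant n := fun y hy =>
    M.mem_posOrthant_of_le hc fun i => (hy i).le
  have hs := setOf_lt_mem_nhds hcx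
  have hmem : ∀ᵐ p ∂(volume.restrict (Ioi (0 : ℝ) ×ˢ Ioi (0 : ℝ))), p ∈ Ioi (0 : ℝ) ×ˢ Ioi (0 : ℝ) :=
    ae_restrict_mem (measurableSet_Ioi.prod measurableSet_Ioi)
  have key : ContinuousAt (fun y => ∫ p in Ioi (0 : ℝ) ×ˢ Ioi (0 : ℝ),
      gramIntegrand A u T α y i j p.1 p.2) x := by
    refine continuousAt_of_dominated (bound := fun p =>
      2 * ‖Q i‖ * ‖Q j‖ * ‖u‖ ^ 2 * ((T ^ α * c) ^ 2)⁻¹ * wrightWeight α p) ?_ ?_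
      ((integrableOn_wrightWeight hα hα1).const_mul _) ?_
    · filter_upwards [hs] with y hy
      exact R.aestronglyMeasurable_gramIntegrand M hT hα hα1 (hpos y hy) u i j
    · filter_upwards [hs] with y hy
      filter_upwards [hmem] with p hp
      exact R.abs_gramIntegrand_le M hT hα hα1 hc (fun i => (hy i).le) u i j hp
    · filter_upwards [hmem] with p hp
      have hr : 0 < (p.1 + p.2) * T ^ α := mul_pos (add_pos hp.1 hp.2) (by positivity)
      have h1 : ContinuousAt (fun y => gramDensity K Q u i j (((p.1 + p.2) * T ^ α) • y)) x :=
        ((M.continuousOn_gramDensity u i j).continuousAt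
          ((isOpen_posOrthant n).mem_nhds (smul_mem_posOrthant hx hr))).comp
          (f := fun y => ((p.1 + p.2) * T ^ α) • y) (by fun_prop)
      refine (h1.const_mul ((p.1 + p.2) * wright α p.1 * wright α p.2)).congr ?_
      filter_upwards [hs] with y hy
      exact (R.gramIntegrand_eq M hT (hpos y hy) hp.1 hp.2 u i j).symm
  refine key.congr ?_
  filter_upwards [hs] with y hy
  exact (R.gramMatrix_apply M hT hα hα1 (hpos y hy) u i j).symm

end Represents

/-! ### The degenerate case n = 0. -/

section FinZero

variable {H : Type*} [NormedAddCommGroup H] [InnerProductSpace ℝ H] (A : Fin 0 → H →ₗ.[ℝ] H)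

theorem commonDomain_fin_zero : commonDomain A = ⊤ := iInf_of_empty _

theorem mem_neg_graph_opSum_fin_zero (x : Fin 0 → ℝ) (u v : H) :
    (u, v) ∈ (-(opSum A x)).graph ↔ v = 0 := by
  have h0 : ∀ w : (-(opSum A x)).domain, (-(opSum A x)) w = 0 := fun w => by
    rw [LinearPMap.neg_apply]
    have := opSum_apply A x w
    simpa using this
  constructor
  · intro h
    obtain ⟨w, -, hw⟩ := (LinearPMap.mem_graph_iff _).1 h
    exact hw.symm.trans (h0 w)
  · rintro rfl
    have hu : u ∈ (-(opSum A x)).domain := by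
      change u ∈ commonDomain A
      rw [commonDomain_fin_zero]; trivial
    exact (LinearPMap.mem_graph_iff _).2 ⟨⟨u, hu⟩, rfl, h0 _⟩

theorem isSemigroupGeneratedBy_opSum_fin_zero (x : Fin 0 → ℝ) :
    IsSemigroupGeneratedBy (expNeg (opSum A x)) (-(opSum A x)) := by
  refine (expNeg_eq (S := fun _ => ContinuousLinearMap.id ℝ H) ⟨rfl, fun _ _ _ _ => rfl,
    fun _ => continuousOn_const, fun u v => ?_⟩ (fun u v h => ?_) ?_).1
  · rw [mem_neg_graph_opSum_fin_zero]
    simp only [ContinuousLinearMap.id_apply, sub_self, smul_zero, tendsto_const_nhds_iff]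
    exact eq_comm
  · rw [(mem_neg_graph_opSum_fin_zero A x u v).1 h, inner_zero_left]
  · change Dense (commonDomain A : Set H)
    rw [commonDomain_fin_zero]; exact dense_univ

end FinZero

/-! ### Strict positivity, definiteness and the Jacobi matrix. -/

namespace Represents

variable {H : Type*} [NormedAddCommGroup H] [InnerProductSpace ℝ H] [CompleteSpace H] {n : ℕ}
  {A : Fin n → H →ₗ.[ℝ] H} {K : H →L[ℝ] H} {Q : Fin n → H →L[ℝ] H} {l : Fin n → ℝ}
  (R : Represents A K Q) (M : IsBoundedModel K Q l) {α T : ℝ} (hT : 0 < T)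

include M in
-- Strong continuity at 0 suffices here in place of injectivity of the semigroup, since a strictly
-- positive integrand on a small square near the origin is enough.
theorem _root_.FracInverse.IsBoundedModel.exists_limExp_apply_ne_zero {x : Fin n → ℝ}
    (hx : x ∈ posOrthant n) {w : H} (hw : w ≠ 0) :
    ∃ ε : ℝ, 0 < ε ∧ ∀ t, 0 < t → t < ε → limExp K Q 0 (t • x) w ≠ 0 := by
  have h := (M.tendsto_modelSemigroup_zero hx w).eventually (isOpen_ne.mem_nhds hw)
  obtain ⟨ε, hε, h⟩ := Metric.mem_nhdsWithin_iff.1 h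
  refine ⟨ε, hε, fun t ht htε => ?_⟩
  have := h ⟨by simpa [abs_of_pos ht] using htε, ht⟩
  simpa [modelSemigroup, ht] using this

include R M hT

theorem evolved_mem {x : Fin n → ℝ} (hx : x ∈ posOrthant n) {τ σ : ℝ} (hτ : 0 < τ) (hσ : 0 < σ)
    (u : H) : evolved A u T α x τ σ ∈ commonDomain A := by
  rw [evolved, R.expNeg_opSum_eq_K M hx (by positivity)]
  exact R.mem _

theorem energyMap_pos (hpos : ∀ i, IsStrictlyPositive (A i)) (hα : 0 < α) (hα1 : α < 1)
    {x : Fin n → ℝ} (hx : x ∈ posOrthant n) {u : H} (hu : u ≠ 0) (i : Fin n) :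
    0 < energyMap A u T α x i := by
  have hm : 0 < T ^ α := by positivity
  obtain ⟨δ, hδ, hw⟩ := exists_wright_pos hα hα1
  obtain ⟨ε, hε, hne⟩ := M.exists_limExp_apply_ne_zero hx hu
  obtain ⟨Λ, hΛ, hΛA⟩ := hpos i
  have hlow : ∀ p ∈ Ioi (0 : ℝ) ×ˢ Ioi (0 : ℝ), Λ * ‖evolved A u T α x p.1 p.2‖ ^ 2 ≤
      inner ℝ (appl (A i) (evolved A u T α x p.1 p.2)) (evolved A u T α x p.1 p.2) := fun p hp => by
    have hmem := commonDomain_le A i (R.evolved_mem M hT (α := α) hx hp.1 hp.2 u)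
    rw [appl_of_mem hmem]
    exact hΛA ⟨_, hmem⟩
  rw [R.energyMap_eq M hT hα hα1 hx]
  refine setIntegral_quadrant_pos (R.integrableOn_energyIntegrand M hT hα hα1 hx u i) (fun p hp => ?_)
    (lt_min hδ (div_pos hε hm)) fun p hp => ?_
  · exact mul_nonneg (mul_nonneg (wright_nonneg hα hα1 hp.1) (wright_nonneg hα hα1 hp.2))
      ((by positivity : 0 ≤ Λ * ‖evolved A u T α x p.1 p.2‖ ^ 2).trans (hlow p hp))
  · obtain ⟨⟨h1, h1'⟩, h2, h2'⟩ := hp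
    rw [lt_min_iff, lt_div_iff₀ hm] at h1' h2'
    have hv : evolved A u T α x p.1 p.2 ≠ 0 := by
      rw [R.evolved_eq M hT hx h1 h2]
      exact hne _ (by positivity) (by linarith)
    have := norm_pos_iff.2 hv
    exact mul_pos (mul_pos (hw _ h1 h1'.1) (hw _ h2 h2'.1))
      ((by positivity : 0 < Λ * ‖evolved A u T α x p.1 p.2‖ ^ 2).trans_le (hlow p ⟨h1, h2⟩))

/-- The semigroup commutes with A_i on D; this is where u₀ ∈ D enters, as linear independence is
assumed at time 0 only. -/
theorem sum_smul_appl_evolved {x : Fin n → ℝ} (hx : x ∈ posOrthant n) {τ σ : ℝ} (hτ : 0 < τ)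
    (hσ : 0 < σ) (f : H) (z : Fin n → ℝ) :
    ∑ i, z i • appl (A i) (evolved A (K f) T α x τ σ) =
      limExp K Q 0 (((τ + σ) / 2 * T ^ α) • x) (∑ i, z i • appl (A i) (K f)) := by
  have hx' := smul_mem_posOrthant hx (by positivity : 0 < (τ + σ) / 2 * T ^ α)
  rw [map_sum]
  refine Finset.sum_congr rfl fun i _ => ?_
  have e : Q i * (limExp K Q 1 (((τ + σ) / 2 * T ^ α) • x) * K) =
      limExp K Q 0 (((τ + σ) / 2 * T ^ α) • x) * Q i := by
    rw [← (M.commute_K_limExp 1 hx').eq, M.K_mul_limExp_succ 0 hx', (M.commute_T_limExp i 0 hx').eq]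
  rw [map_smul, R.appl_evolved_eq M hT hx hτ hσ, R.appl_eq]
  exact congrArg (z i • ·) (congrArg (fun S : H →L[ℝ] H => S f) e)

/-- The quadratic form integrates the weighted squares ‖Σ z_i A_i v‖²; by independence Σ z_i A_i u ≠
0, and its evolution stays nonzero for short times. -/
theorem posDef_gramMatrix (hα : 0 < α) (hα1 : α < 1) {x : Fin n → ℝ} (hx : x ∈ posOrthant n) {u : H}
    (hu : IsAdmissible A u) : (gramMatrix A u T α x).PosDef := by
  have hm : 0 < T ^ α := by positivity
  obtain ⟨hu, hli⟩ := hu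
  refine Matrix.PosDef.of_dotProduct_mulVec_pos ?_ fun z hz => ?_
  · ext i j
    simp only [gramMatrix, Matrix.conjTranspose_apply, Matrix.of_apply, star_trivial, gramIntegrand,
      real_inner_comm]
  have hint := R.integrableOn_gramIntegrand M hT hα hα1 hx u
  have hquad : star z ⬝ᵥ (gramMatrix A u T α x).mulVec z =
      ∫ p in Ioi (0 : ℝ) ×ˢ Ioi (0 : ℝ), ∑ i, ∑ j, z i * (gramIntegrand A u T α x i j p.1 p.2 * z j) := by
    rw [integral_finsetSum _ fun i _ => integrable_finsetSum _ fun j _ =>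
      ((hint i j).mul_const _).const_mul _]
    simp only [dotProduct, Matrix.mulVec, star_trivial, Finset.mul_sum]
    refine Finset.sum_congr rfl fun i _ => ?_
    rw [integral_finsetSum _ fun j _ => ((hint i j).mul_const _).const_mul _]
    refine Finset.sum_congr rfl fun j _ => ?_
    rw [integral_const_mul, integral_mul_const, R.gramMatrix_apply M hT hα hα1 hx]
  have hsq : ∀ p : ℝ × ℝ, ∑ i, ∑ j, z i * (gramIntegrand A u T α x i j p.1 p.2 * z j) =
      (p.1 + p.2) * wright α p.1 * wright α p.2 *
        ‖∑ i, z i • appl (A i) (evolved A u T α x p.1 p.2)‖ ^ 2 := fun p => by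
    rw [← real_inner_self_eq_norm_sq, sum_inner, Finset.mul_sum]
    refine Finset.sum_congr rfl fun i _ => ?_
    rw [inner_sum, Finset.mul_sum]
    refine Finset.sum_congr rfl fun j _ => ?_
    rw [inner_smul_left, inner_smul_right, gramIntegrand]
    simp only [conj_trivial]
    ring
  obtain ⟨δ, hδ, hw⟩ := exists_wright_pos hα hα1
  have hne0 : ∑ i, z i • appl (A i) u ≠ 0 := fun h => hz <| funext <|
    Fintype.linearIndependent_iff.1 hli z <| by
      simpa only [appl_of_mem (commonDomain_le A _ hu)] using h
  obtain ⟨ε, hε, hne⟩ := M.exists_limExp_apply_ne_zero hx hne0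
  rw [hquad]
  refine setIntegral_quadrant_pos (integrable_finsetSum _ fun i _ => integrable_finsetSum _ fun j _ =>
      ((hint i j).mul_const _).const_mul _) (fun p hp => ?_)
    (lt_min hδ (div_pos hε hm)) fun p hp => ?_
  · rw [hsq]
    exact mul_nonneg (mul_nonneg (mul_nonneg (add_pos hp.1 hp.2).le (wright_nonneg hα hα1 hp.1))
      (wright_nonneg hα hα1 hp.2)) (sq_nonneg _)
  · obtain ⟨⟨h1, h1'⟩, h2, h2'⟩ := hp
    rw [lt_min_iff, lt_div_iff₀ hm] at h1' h2'
    rw [hsq]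
    refine mul_pos (mul_pos (mul_pos (add_pos h1 h2) (hw _ h1 h1'.1)) (hw _ h2 h2'.1))
      (pow_pos (norm_pos_iff.2 ?_) 2)
    obtain ⟨f, rfl⟩ := (R.mem_iff u).1 hu
    rw [R.sum_smul_appl_evolved M hT hx h1 h2]
    exact hne _ (by positivity) (by linarith)

theorem hasFDerivAt_energyMap_pi (hα : 0 < α) (hα1 : α < 1) {x : Fin n → ℝ} (hx : x ∈ posOrthant n)
    (u : H) : HasFDerivAt (energyMap A u T α) (ContinuousLinearMap.pi fun i =>
      ∑ j, (-(T ^ α) * gramMatrix A u T α x i j) •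
        ContinuousLinearMap.proj (R := ℝ) (φ := fun _ => ℝ) j) x :=
  hasFDerivAt_pi.2 fun i => R.hasFDerivAt_energyMap M hT hα hα1 hx u i

theorem jacobiMatrix_energyMap (hα : 0 < α) (hα1 : α < 1) {x : Fin n → ℝ} (hx : x ∈ posOrthant n)
    (u : H) : jacobiMatrix (energyMap A u T α) x = (-(T ^ α)) • gramMatrix A u T α x := by
  ext i j
  rw [jacobiMatrix, Matrix.of_apply, (R.hasFDerivAt_energyMap_pi M hT hα hα1 hx u).fderiv]
  simp [_root_.sum_apply, Pi.single_apply]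

theorem contDiffOn_energyMap (hα : 0 < α) (hα1 : α < 1) (u : H) :
    ContDiffOn ℝ 1 (energyMap A u T α) (posOrthant n) := by
  refine contDiffOn_pi.2 fun i => ?_
  rw [← zero_add (1 : WithTop ℕ∞), contDiffOn_succ_iff_fderiv_of_isOpen (isOpen_posOrthant n)]
  have hd := fun x hx => R.hasFDerivAt_energyMap M hT hα hα1 (x := x) hx u i
  refine ⟨fun x hx => (hd x hx).differentiableAt.differentiableWithinAt, by simp,
    contDiffOn_zero.2 (ContinuousOn.congr ?_ fun x hx => (hd x hx).fderiv)⟩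
  have hc : ∀ j, ContinuousOn (fun x => gramMatrix A u T α x i j) (posOrthant n) := fun j x hx =>
    (R.continuousAt_gramMatrix M hT hα hα1 hx u i j).continuousWithinAt
  fun_prop

end Represents

end FracInverse

end

theorem mainTheorem3 {H : Type*} [NormedAddCommGroup H] [InnerProductSpace ℝ H] [CompleteSpace H]
    [TopologicalSpace.SeparableSpace H] {n : ℕ}
    (A : Fin n → H →ₗ.[ℝ] H)
    (hsa : ∀ i, IsSelfAdjoint (A i))
    (hpos : ∀ i, FracInverse.IsStrictlyPositive (A i))
    (hcomm : FracInverse.MutuallyCommuting A)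
    (hsum : ∃ lam ∈ FracInverse.posOrthant n, IsSelfAdjoint (FracInverse.opSum A lam))
    (α T : ℝ) (hα : 0 < α) (hα1 : α < 1) (hT : 0 < T)
    (u₀ : H) (hu₀ : u₀ ≠ 0) :
    -- all the objects in the formulas below are well defined
    (∀ lam ∈ FracInverse.posOrthant n,
      IsSelfAdjoint (FracInverse.opSum A lam) ∧
      FracInverse.IsSemigroupGeneratedBy (FracInverse.expNeg (FracInverse.opSum A lam))
        (-(FracInverse.opSum A lam)) ∧
      (∀ s : ℝ, 0 < s →
        FracInverse.expNeg (FracInverse.opSum A lam) s u₀ ∈ FracInverse.commonDomain A) ∧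
      (∀ i, IntegrableOn
        (fun p : ℝ × ℝ => FracInverse.energyIntegrand A u₀ T α lam i p.1 p.2)
        (Ioi 0 ×ˢ Ioi 0)) ∧
      (∀ i j, IntegrableOn
        (fun p : ℝ × ℝ => FracInverse.gramIntegrand A u₀ T α lam i j p.1 p.2)
        (Ioi 0 ×ˢ Ioi 0))) ∧
    -- (a) the map is of class `C¹` from the open orthant to itself, with the stated Jacobi matrix
    MapsTo (FracInverse.energyMap A u₀ T α)
      (FracInverse.posOrthant n) (FracInverse.posOrthant n) ∧
    ContDiffOn ℝ 1 (FracInverse.energyMap A u₀ T α) (FracInverse.posOrthant n) ∧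
    (∀ lam ∈ FracInverse.posOrthant n,
      DifferentiableAt ℝ (FracInverse.energyMap A u₀ T α) lam ∧
      FracInverse.jacobiMatrix (FracInverse.energyMap A u₀ T α) lam =
        (-(T ^ α)) • FracInverse.gramMatrix A u₀ T α lam) ∧
    -- (b) for admissible initial data the Jacobi matrix is negative definite
    (FracInverse.IsAdmissible A u₀ → ∀ lam ∈ FracInverse.posOrthant n,
      (-FracInverse.jacobiMatrix (FracInverse.energyMap A u₀ T α) lam).PosDef) := by
  -- For n = 0 the operator A(λ) is 0 on H and not invertible, so the bounded model does not exist;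
  -- the claims are then trivial, with the constant identity semigroup.
  rcases Nat.eq_zero_or_pos n with rfl | hn
  · obtain ⟨l, -, hl⟩ := hsum
    refine ⟨fun x _ => ⟨Subsingleton.elim l x ▸ hl,
      FracInverse.isSemigroupGeneratedBy_opSum_fin_zero A x, fun s _ => ?_, fun i => i.elim0,
      fun i => i.elim0⟩, fun _ _ i => i.elim0, contDiff_of_subsingleton.contDiffOn,
      fun x _ => ⟨(contDiff_of_subsingleton (n := 1)).differentiable (by simp) x,
        Subsingleton.elim _ _⟩, fun _ x _ => ?_⟩
    · rw [FracInverse.commonDomain_fin_zero]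
      trivial
    · exact Matrix.PosDef.of_dotProduct_mulVec_pos (Subsingleton.elim _ _)
        fun z hz => absurd (Subsingleton.elim z 0) hz
  · obtain ⟨l, hl, hB⟩ := hsum
    obtain ⟨K, Q, M, R⟩ := FracInverse.exists_boundedModel hsa hpos hcomm hn hl hB
    have hm : 0 < T ^ α := Real.rpow_pos_of_pos hT α
    refine ⟨fun x hx => ⟨R.isSelfAdjoint_opSum M hx, (R.expNeg_opSum M hx).1, fun s hs => ?_,
      R.integrableOn_energyIntegrand M hT hα hα1 hx u₀,
      R.integrableOn_gramIntegrand M hT hα hα1 hx u₀⟩,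
      fun x hx => R.energyMap_pos M hT hpos hα hα1 hx hu₀, R.contDiffOn_energyMap M hT hα hα1 u₀,
      fun x hx => ⟨(R.hasFDerivAt_energyMap_pi M hT hα hα1 hx u₀).differentiableAt,
        R.jacobiMatrix_energyMap M hT hα hα1 hx u₀⟩, fun hadm x hx => ?_⟩
    · rw [R.expNeg_opSum_eq_K M hx hs]
      exact R.mem _
    · rw [R.jacobiMatrix_energyMap M hT hα hα1 hx u₀, neg_smul, neg_neg]
      exact (R.posDef_gramMatrix M hT hα hα1 hx hadm).smul hm
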